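/- Let $K$ be a finite simplicial complex in a finite-dimensional real normed space that is a combinatorial $d$-manifold: the link of every $k$-simplex of $K$ is a combinatorial $(d-k-1)$-sphere, i.e. PL homeomorphic to the boundary of a $(d-k)$-simplex. Write $M=|K|$. Let $g\colon K\to\mathbb{R}$ be a (Forman) discrete Morse function: every $k$-cell has at most one exceptional $(k-1)$-face, i.e. one whose value is not strictly smaller, and at most one exceptional $(k+1)$-coface, i.e. one whose value is not strictly larger. A cell is critical if it has neither an exceptional face nor an exceptional coface. A discrete Morse function is generic if it is injective and every proper face of codimension at least $2$ of a cell has a smaller value than the cell; two discrete Morse functions are equivalent if they have the same critical cells and the same pairs of a cell and an exceptional face of it. Then there is a generic discrete Morse function equivalent to $g$. Moreover, let $g'$ be any such function (for instance $g$ itself, if $g$ is generic), and choose for every simplex $S$ of $K$ a point $v_S$ in its relative interior. Then the simplices spanned by $v_{S_0},\dots,v_{S_m}$, for all chains $S_0\subset\dots\subset S_m$ of simplices of $K$, form a simplicial subdivision $K'$ of $K$ (a derived subdivision), $S\mapsto v_S$ is a bijection from the simplices of $K$ to the vertices of $K'$, and the function $f\colon M\to\mathbb{R}$ that is affine on every simplex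 of $K'$ and has $f(v_S)=g'(S)$ for all $S$ is a generic PL Morse function: it takes distinct values at distinct vertices of $K'$, and every vertex of $K'$ is strongly regular or non-degenerate critical. More precisely: - if $S$ is not critical for $g$, then $v_S$ is strongly regular for $f$: in some PL chart of $M$ centred at $v_S$, with coordinates $x_1,\dots,x_d$, one has $f(x_1,\dots,x_d)=f(v_S)+x_d$; - if $S$ is a critical $k$-cell of $g$, then $v_S$ is non-degenerate critical of index $k$ for $f$: in some PL chart of $M$ centred at $v_S$, one has $f(x_1,\dots,x_d)=f(v_S)-|x_1|-\dots-|x_k|+|x_{k+1}|+\dots+|x_d|$. Here a PL chart of $M$ centred at $p$ is a PL homeomorphism of an open neighbourhood of $p$ in $M$ onto an open subset of $\mathbb{R}^d$ that maps $p$ to $0$. -/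

import Mathlib

namespace PLMorse

open Set Topology

/-! ### Piecewise linear maps -/

section PL

variable {E F : Type*} [NormedAddCommGroup E] [NormedSpace ℝ E] [NormedAddCommGroup F]
  [NormedSpace ℝ F]

/-- `φ` is piecewise linear on `X`: every point of `X` has a neighbourhood in `X` which is a
finite union of convex polytopes on each of which `φ` agrees with an affine map. (In particular
`X` is a polyhedron, and `φ` is continuous on `X`.) -/
def IsPLOn (φ : E → F) (X : Set E) : Prop :=
  ∀ x ∈ X, ∃ P : Finset (Finset E),
    (∀ V ∈ P, convexHull ℝ (V : Set E) ⊆ X ∧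
      ∃ A : E →ᵃ[ℝ] F, EqOn φ A (convexHull ℝ (V : Set E))) ∧
    (⋃ V ∈ P, convexHull ℝ (V : Set E)) ∈ 𝓝[X] x

/-- `φ` is a PL homeomorphism of `X` onto `Y`, with inverse `ψ`. -/
structure IsPLHomeo (φ : E → F) (ψ : F → E) (X : Set E) (Y : Set F) : Prop where
  mapsTo : MapsTo φ X Y
  mapsTo_symm : MapsTo ψ Y X
  invOn : InvOn ψ φ X Y
  isPLOn : IsPLOn φ X
  isPLOn_symm : IsPLOn ψ Y

/-- `X` and `Y` are PL homeomorphic. -/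
def PLHomeomorphic (X : Set E) (Y : Set F) : Prop :=
  ∃ (φ : E → F) (ψ : F → E), IsPLHomeo φ ψ X Y

/-- `φ` is a PL chart of the polyhedron `X` around the point `p`: a PL homeomorphism of an open
neighbourhood `U` of `p` in `X` onto an open subset `V` of `ℝ^d`, with `p` at the origin of the
coordinates; `ψ` is the inverse. -/
structure IsPLChartAt {d : ℕ} (X : Set E) (p : E) (U : Set E) (V : Set (Fin d → ℝ))
    (φ : E → Fin d → ℝ) (ψ : (Fin d → ℝ) → E) : Prop where
  relOpen : ∃ O : Set E, IsOpen O ∧ U = X ∩ O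
  mem : p ∈ U
  isOpen : IsOpen V
  isPLHomeo : IsPLHomeo φ ψ U V
  map_center : φ p = 0

/-- `p` is a strongly regular point of `f : X → ℝ`: in some PL chart around `p`,
`f(x_1, …, x_d) = f(p) + x_d`. -/
def IsStronglyRegular (X : Set E) (d : ℕ) (f : E → ℝ) (p : E) : Prop :=
  ∃ (U : Set E) (V : Set (Fin d → ℝ)) (φ : E → Fin d → ℝ) (ψ : (Fin d → ℝ) → E),
    IsPLChartAt X p U V φ ψ ∧
      ∃ i : Fin d, (i : ℕ) + 1 = d ∧ ∀ x ∈ V, f (ψ x) = f p + x i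

/-- `p` is a non-degenerate critical point of index `k` of `f : X → ℝ`: in some PL chart around
`p`, `f(x_1, …, x_d) = f(p) - |x_1| - ⋯ - |x_k| + |x_{k+1}| + ⋯ + |x_d|`. -/
def IsNondegenerateCritical (X : Set E) (d k : ℕ) (f : E → ℝ) (p : E) : Prop :=
  k ≤ d ∧ ∃ (U : Set E) (V : Set (Fin d → ℝ)) (φ : E → Fin d → ℝ) (ψ : (Fin d → ℝ) → E),
    IsPLChartAt X p U V φ ψ ∧
      ∀ x ∈ V, f (ψ x) = f p + ∑ i : Fin d, if (i : ℕ) < k then -|x i| else |x i|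

end PL

/-! ### Simplicial complexes -/

section Complexes

variable {E : Type*} [AddCommGroup E] [Module ℝ E]

open scoped Classical in
/-- The link of `s` in `K`: all simplices disjoint from `s` that span a simplex of `K`
together with `s`. -/
def link (K : Geometry.SimplicialComplex ℝ E) (s : Finset E) :
    Geometry.SimplicialComplex ℝ E where
  faces := {t | t ∈ K.faces ∧ Disjoint t s ∧ t ∪ s ∈ K.faces}
  isRelLowerSet_faces := fun t ht => by
    refine ⟨K.nonempty_of_mem_faces ht.1, fun u hut hu => ⟨K.down_closed ht.1 hut hu, ?_, ?_⟩⟩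
    · exact Finset.disjoint_of_subset_left hut ht.2.1
    · exact K.down_closed ht.2.2 (Finset.union_subset_union_left hut)
        (hu.mono Finset.subset_union_left)
  indep := fun ht => K.indep ht.1
  inter_subset_convexHull := fun hs ht => K.inter_subset_convexHull hs.1 ht.1

/-- The boundary of the standard `n`-simplex; a PL sphere of dimension `n - 1`
(empty for `n = 0`). -/
def simplexBoundary (n : ℕ) : Set (Fin (n + 1) → ℝ) :=
  {x | x ∈ stdSimplex ℝ (Fin (n + 1)) ∧ ∃ i, x i = 0}

/-- `L` is a subdivision of `K`. -/
def IsSubdivision (L K : Geometry.SimplicialComplex ℝ E) : Prop :=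
  L.space = K.space ∧
    ∀ s ∈ L.faces, ∃ t ∈ K.faces, convexHull ℝ (s : Set E) ⊆ convexHull ℝ (t : Set E)

/-- `p` lies in the relative interior of the simplex with vertex set `s`: it is a convex
combination of the vertices with positive coefficients. -/
def InOpenSimplex (s : Finset E) (p : E) : Prop :=
  ∃ w : E → ℝ, (∀ x ∈ s, 0 < w x) ∧ ∑ x ∈ s, w x = 1 ∧ ∑ x ∈ s, w x • x = p

open scoped Classical in
/-- `L` is the derived subdivision of `K` with the interior points `v S`, `S ∈ K`: its simplices
are those with vertices `v S_0, …, v S_m` for the chains `S_0 ⊂ ⋯ ⊂ S_m` of simplices of `K`. -/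
structure IsDerivedSubdivision (K : Geometry.SimplicialComplex ℝ E) (v : Finset E → E)
    (L : Geometry.SimplicialComplex ℝ E) : Prop where
  interior : ∀ S ∈ K.faces, InOpenSimplex S (v S)
  isSubdivision : IsSubdivision L K
  faces_eq : L.faces = {s | ∃ C : Finset (Finset E), C.Nonempty ∧ (C : Set (Finset E)) ⊆ K.faces ∧
    IsChain (· ⊆ ·) (C : Set (Finset E)) ∧ s = C.image v}

/-- `f` is generic PL on `L`: affine on every simplex of `L`, with distinct values at distinct
vertices. -/
def IsGenericPL (L : Geometry.SimplicialComplex ℝ E) (f : E → ℝ) : Prop :=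
  (∀ s ∈ L.faces, ∃ A : E →ᵃ[ℝ] ℝ, EqOn f A (convexHull ℝ (s : Set E))) ∧
    InjOn f L.vertices

end Complexes

section Manifolds

variable {E : Type*} [NormedAddCommGroup E] [NormedSpace ℝ E]

/-- `K` is a combinatorial `d`-manifold (without boundary): the link of every `k`-simplex is a
combinatorial `(d - k - 1)`-sphere, that is, PL homeomorphic to the boundary of a
`(d - k)`-simplex. -/
def IsCombinatorialManifold (K : Geometry.SimplicialComplex ℝ E) (d : ℕ) : Prop :=
  ∀ s ∈ K.faces, ∃ n : ℕ, s.card + n = d + 1 ∧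
    PLHomeomorphic (link K s).space (simplexBoundary n)

/-- `f` is a PL Morse function on the `d`-manifold triangulated by `L`: it is generic PL, and
every vertex is strongly regular or non-degenerate critical. -/
def IsPLMorse (L : Geometry.SimplicialComplex ℝ E) (d : ℕ) (f : E → ℝ) : Prop :=
  IsGenericPL L f ∧ ∀ p ∈ L.vertices,
    IsStronglyRegular L.space d f p ∨ ∃ k, IsNondegenerateCritical L.space d k f p

end Manifolds

/-! ### Discrete Morse functions -/

section Discrete

variable {E : Type*} [AddCommGroup E] [Module ℝ E]

/-- `T` is an immediate face of `S` and `g T` is not strictly smaller than `g S`: `T` is an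
exceptional face of `S`, equivalently `S` is an exceptional coface of `T`. Only the values of `g`
on the faces of `K` are ever used. -/
def IsExceptional (K : Geometry.SimplicialComplex ℝ E) (g : Finset E → ℝ) (T S : Finset E) :
    Prop :=
  T ∈ K.faces ∧ S ∈ K.faces ∧ T ⊂ S ∧ T.card + 1 = S.card ∧ g S ≤ g T

/-- Forman's discrete Morse functions. -/
def IsDiscreteMorse (K : Geometry.SimplicialComplex ℝ E) (g : Finset E → ℝ) : Prop :=
  ∀ S ∈ K.faces, {T | IsExceptional K g T S}.Subsingleton ∧
    {R | IsExceptional K g S R}.Subsingleton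

/-- `S` is a critical cell of `g`: it has no exceptional face and no exceptional coface. -/
def IsCriticalCell (K : Geometry.SimplicialComplex ℝ E) (g : Finset E → ℝ) (S : Finset E) :
    Prop :=
  S ∈ K.faces ∧ (∀ T, ¬ IsExceptional K g T S) ∧ ∀ R, ¬ IsExceptional K g S R

/-- A discrete Morse function is generic if it is injective and every non-immediate proper face of
a cell has a smaller value. -/
def IsGenericDiscreteMorse (K : Geometry.SimplicialComplex ℝ E) (g : Finset E → ℝ) : Prop :=
  IsDiscreteMorse K g ∧ InjOn g K.faces ∧
    ∀ T ∈ K.faces, ∀ S ∈ K.faces, T ⊂ S → T.card + 1 ≠ S.card → g T < g S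

/-- `g` and `g'` have the same critical cells and induce the same matching of cells with their
exceptional faces. -/
def IsEquivalent (K : Geometry.SimplicialComplex ℝ E) (g g' : Finset E → ℝ) : Prop :=
  (∀ S, IsCriticalCell K g S ↔ IsCriticalCell K g' S) ∧
    ∀ T S, IsExceptional K g T S ↔ IsExceptional K g' T S

end Discrete

end PLMorse

/-! The claim is local at `v S` and becomes homogeneous once `|K|` is lifted to height one in `E ×
ℝ`. By `exists_coneEquiv_realize`, the cone over `|K|` is parametrised by nonnegative weights `c` on
simplices whose support is a chain, and `f` is the slice at height one of the linear function `∑ c T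
* g' T`. Where `c S > 0`, the rest of the support splits into a chain of proper faces and a chain of
proper cofaces of `S`. Since the weights sum to one, `f - f (v S)` is `∑ c T * (g' T - g' S)` over
these two halves (`exists_isPLChartAt`). The lower half is the boundary of an orthant, hence `ℝ^k`
with the total weight as `ℓ¹`-norm (`exists_coneEquiv_belowChains`); the upper half is the cone over
the link sphere, hence `ℝ^(d-k)` in the same way (`exists_coneEquiv_aboveChains`).

At a critical cell all coefficients are negative below and positive above. Rescaling the weights
absorbs their sizes, and the two `ℓ¹`-norms give the normal form. At any other cell, Forman's lemma
`IsDiscreteMorse.not_face_and_coface` leaves exactly one coefficient of the wrong sign. On the half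
containing it there is, up to sign, a linear function negative at one vertex and positive at all
others, and `exists_coneEquiv_last_coord` makes it a coordinate without any theory of PL balls.
After rescaling, its nonpositive set is a narrow cone around the ray of that vertex, in which moving
along the ray is a translation of `ℝ^m` (`exists_translation_const`). So this set is an epigraph: it
is also the nonpositive set of a PL function that falls at unit speed in a fixed direction
everywhere (`exists_height`). PL functions with equal signs differ by a PL homeomorphism
(`exists_coneEquiv_of_same_sign`), and a shear makes the second function linear. One more shear
absorbs the `ℓ¹`-norm of the other half.

PL maps are treated as continuous selections from finitely many linear maps (`IsFinLin`), a class
closed under composition and lattice operations; `isPLOn_of_selection` returns to polytopes at the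
end. The generic function of the first claim is a lexicographic rank whose leading entry is the
dimension, lowered by one for cells with an exceptional face (`exists_generic`). -/

namespace PLMorse
open Set Topology

/-! ### Polytopes, half-spaces and continuous selections of affine maps. -/

section Polytopes

variable {E F : Type*} [NormedAddCommGroup E] [NormedSpace ℝ E] [NormedAddCommGroup F]
  [NormedSpace ℝ F]

lemma affineMap_sum {ι : Type*} (t : Finset ι) (w : ι → ℝ) (z : ι → E) (h : ∑ i ∈ t, w i = 1)
    (a : E →ᵃ[ℝ] F) : a (∑ i ∈ t, w i • z i) = ∑ i ∈ t, w i • a (z i) := by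
  have ha : ∀ x, a x = a.linear x + a 0 := fun x => by
    simpa using a.map_vadd 0 x
  rw [ha, map_sum]
  simp only [ha (z _), smul_add, Finset.sum_add_distrib, ← Finset.sum_smul, h, one_smul, map_smul]

open scoped Classical in
-- The new vertices are those of `V` where `a ≥ 0`, together with the points where segments joining
-- a nonnegative to a negative vertex meet the hyperplane `a = 0`.
lemma exists_convexHull_inter_halfspace (V : Finset E) (a : E →ᵃ[ℝ] ℝ) :
    ∃ W : Finset E, convexHull ℝ (W : Set E) = convexHull ℝ (V : Set E) ∩ {x | 0 ≤ a x} := by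
  set A := V.filter (fun v => 0 ≤ a v) with hA
  set B := V.filter (fun v => ¬ 0 ≤ a v) with hB
  set c : E × E → E := fun p => (a p.1 - a p.2)⁻¹ • (a p.1 • p.2 + (-a p.2) • p.1) with hc
  have hconv : Convex ℝ (convexHull ℝ (V : Set E) ∩ {x | 0 ≤ a x}) := by
    refine (convex_convexHull ℝ _).inter ?_
    exact (convex_Ici (0 : ℝ)).affine_preimage a
  refine ⟨A ∪ (A ×ˢ B).image c, Subset.antisymm ?_ ?_⟩
  · refine convexHull_min ?_ hconv
    intro x hx
    simp only [Finset.coe_union, Finset.coe_image, Set.mem_union, Finset.mem_coe,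
      Set.mem_image, Finset.mem_product] at hx
    rcases hx with hx | ⟨⟨v, u⟩, ⟨hv, hu⟩, rfl⟩
    · exact ⟨subset_convexHull _ _ (Finset.mem_filter.1 hx).1, (Finset.mem_filter.1 hx).2⟩
    · simp only [hA, hB, Finset.mem_filter, not_le] at hv hu
      have hpos : 0 < a v - a u := by linarith
      have e : c (v, u) = (a v / (a v - a u)) • u + (-a u / (a v - a u)) • v := by
        simp only [hc, smul_add, smul_smul, div_eq_inv_mul]
      have hsum : a v / (a v - a u) + -a u / (a v - a u) = 1 := by field_simp; ring
      have h1 : 0 ≤ a v / (a v - a u) := div_nonneg hv.2 hpos.le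
      have h2 : 0 ≤ -a u / (a v - a u) := div_nonneg (by linarith) hpos.le
      refine ⟨?_, ?_⟩
      · rw [e]
        exact convex_convexHull ℝ _ (subset_convexHull _ _ hu.1) (subset_convexHull _ _ hv.1)
          h1 h2 hsum
      · have := affineMap_sum (Finset.univ : Finset (Fin 2))
          ![a v / (a v - a u), -a u / (a v - a u)] ![u, v] (by simpa [Fin.sum_univ_two] using hsum) a
        simp only [Fin.sum_univ_two, Matrix.cons_val_zero, Matrix.cons_val_one] at this
        simp only [Set.mem_ofPred_eq, e, this, smul_eq_mul]
        field_simp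
        linarith
  · rintro x ⟨hx, hax⟩
    rw [Finset.mem_convexHull'] at hx
    obtain ⟨w, hw0, hw1, rfl⟩ := hx
    simp only [Set.mem_ofPred_eq] at hax
    rw [affineMap_sum V w (fun v => v) hw1] at hax
    have hsplit : ∀ f : E → ℝ, ∑ v ∈ V, f v = ∑ v ∈ A, f v + ∑ v ∈ B, f v := fun f =>
      (Finset.sum_filter_add_sum_filter_not V (fun v => 0 ≤ a v) f).symm
    have hsplitE : ∑ v ∈ V, w v • v = ∑ v ∈ A, w v • v + ∑ v ∈ B, w v • v :=
      (Finset.sum_filter_add_sum_filter_not V (fun v => 0 ≤ a v) _).symm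
    simp only [smul_eq_mul] at hax
    rw [hsplit] at hw1 hax
    rw [hsplitE]
    set P := ∑ v ∈ A, w v * a v with hP
    set N := ∑ v ∈ B, w v * -a v with hN
    have hN' : ∑ v ∈ B, w v * a v = -N := by simp [hN]
    rw [hN'] at hax
    have hwA : ∀ v ∈ A, 0 ≤ w v := fun v hv => hw0 v (Finset.mem_filter.1 hv).1
    have hwB : ∀ v ∈ B, 0 ≤ w v := fun v hv => hw0 v (Finset.mem_filter.1 hv).1
    have haA : ∀ v ∈ A, 0 ≤ a v := fun v hv => (Finset.mem_filter.1 hv).2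
    have haB : ∀ v ∈ B, a v < 0 := fun v hv => not_le.1 (Finset.mem_filter.1 hv).2
    have hN0 : 0 ≤ N := Finset.sum_nonneg fun v hv =>
      mul_nonneg (hwB v hv) (by linarith [haB v hv])
    rcases hN0.eq_or_lt with h0 | hNpos
    · have hz : ∀ v ∈ B, w v = 0 := fun v hv => by
        have := (Finset.sum_eq_zero_iff_of_nonneg (fun v hv =>
          mul_nonneg (hwB v hv) (by linarith [haB v hv]))).1 h0.symm v hv
        rcases mul_eq_zero.1 this with h | h
        · exact h
        · linarith [haB v hv]
      have e1 : ∑ v ∈ B, w v = 0 := Finset.sum_eq_zero hz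
      have e2 : ∑ v ∈ B, w v • v = 0 := Finset.sum_eq_zero fun v hv => by simp [hz v hv]
      rw [e2, add_zero]
      refine (convex_convexHull ℝ _).sum_mem hwA (by linarith) fun v hv => ?_
      exact subset_convexHull _ _ (by simp [hv])
    · have hPpos : 0 < P := by linarith
      -- Transport plan: the negative mass `N` is balanced against the fraction `N / P` of the
      -- positive vertices. The weights on the crossing points have `B`-marginal `w`, and `1 - N /
      -- P` of each weight on `A` stays in place.
      have key := (convex_convexHull ℝ ((A ∪ (A ×ˢ B).image c : Finset E) : Set E)).sum_mem
        (t := A.disjSum (A ×ˢ B))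
        (w := Sum.elim (fun v => (1 - N / P) * w v)
          (fun p => w p.1 * w p.2 * (a p.1 - a p.2) / P))
        (z := Sum.elim id c) ?_ ?_ ?_
      · rw [Finset.sum_disjSum] at key
        convert key using 1
        simp only [Sum.elim_inl, Sum.elim_inr, id]
        have : ∀ p ∈ A ×ˢ B, (w p.1 * w p.2 * (a p.1 - a p.2) / P) • c p =
            (w p.1 * a p.1 / P) • (w p.2 • p.2) + (w p.2 * -a p.2 / P) • (w p.1 • p.1) := by
          rintro ⟨v, u⟩ hp
          simp only [Finset.mem_product] at hp
          have : a v - a u ≠ 0 := by linarith [haA v hp.1, haB u hp.2]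
          simp only [hc, smul_add, smul_smul]
          congr 2 <;> field_simp
        rw [Finset.sum_congr rfl this, Finset.sum_add_distrib, Finset.sum_product,
          Finset.sum_product_right]
        simp only [← Finset.smul_sum, ← Finset.sum_smul, ← Finset.sum_div, ← hP, ← hN,
          div_self hPpos.ne', one_smul]
        have : ∑ v ∈ A, ((1 - N / P) * w v) • v = (1 - N / P) • ∑ v ∈ A, w v • v := by
          simp [Finset.smul_sum, smul_smul]
        rw [this, sub_smul, one_smul]
        abel
      · rintro (v | ⟨v, u⟩) hi
        · simp only [Finset.inl_mem_disjSum] at hi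
          refine mul_nonneg ?_ (hwA v hi)
          rw [sub_nonneg, div_le_one hPpos]; linarith
        · simp only [Finset.inr_mem_disjSum, Finset.mem_product] at hi
          simp only [Sum.elim_inr]
          have := haA v hi.1
          have := haB u hi.2
          exact div_nonneg (mul_nonneg (mul_nonneg (hwA v hi.1) (hwB u hi.2)) (by linarith))
            hPpos.le
      · rw [Finset.sum_disjSum]
        simp only [Sum.elim_inl, Sum.elim_inr]
        have : ∀ p ∈ A ×ˢ B, w p.1 * w p.2 * (a p.1 - a p.2) / P =
            (w p.1 * a p.1 / P) * w p.2 + (w p.2 * -a p.2 / P) * w p.1 := by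
          intro p _; ring
        rw [Finset.sum_congr rfl this, Finset.sum_add_distrib, Finset.sum_product,
          Finset.sum_product_right]
        simp only [← Finset.mul_sum, ← Finset.sum_mul, ← Finset.sum_div, ← hP, ← hN,
          div_self hPpos.ne', one_mul]
        linarith
      · rintro (v | p) hi
        · simp only [Finset.inl_mem_disjSum] at hi
          exact subset_convexHull _ _ (by simp [hi])
        · simp only [Finset.inr_mem_disjSum] at hi
          refine subset_convexHull _ _ ?_
          simp only [Sum.elim_inr, Finset.coe_union, Finset.coe_image]
          exact Or.inr ⟨p, hi, rfl⟩

lemma exists_convexHull_inter_halfspaces {ι : Type*} (V : Finset E) (s : Finset ι)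
    (a : ι → E →ᵃ[ℝ] ℝ) :
    ∃ W : Finset E, convexHull ℝ (W : Set E) =
      convexHull ℝ (V : Set E) ∩ {x | ∀ i ∈ s, 0 ≤ a i x} := by
  classical
  induction s using Finset.induction_on with
  | empty => exact ⟨V, by simp⟩
  | insert i s hi ih =>
    obtain ⟨W, hW⟩ := ih
    obtain ⟨W', hW'⟩ := exists_convexHull_inter_halfspace W (a i)
    refine ⟨W', ?_⟩
    rw [hW', hW]
    ext x
    simp only [Set.mem_inter_iff, Set.mem_ofPred_eq, Finset.mem_insert, forall_eq_or_imp]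
    tauto

/-- Cut by one hyperplane after another and keep both halves of every piece. -/
lemma exists_convexHull_split {ι : Type*} (V : Finset E) (s : Finset ι) (a : ι → E →ᵃ[ℝ] ℝ) :
    ∃ P : Finset (Finset E), (⋃ W ∈ P, convexHull ℝ (W : Set E)) = convexHull ℝ (V : Set E) ∧
      ∀ W ∈ P, ∀ i ∈ s, (∀ x ∈ convexHull ℝ (W : Set E), 0 ≤ a i x) ∨
        ∀ x ∈ convexHull ℝ (W : Set E), a i x ≤ 0 := by
  classical
  induction s using Finset.induction_on with
  | empty => exact ⟨{V}, by simp, by simp⟩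
  | insert i s hi ih =>
    obtain ⟨P, hP, hs⟩ := ih
    choose p hp using fun W : Finset E => exists_convexHull_inter_halfspace W (a i)
    choose n hn using fun W : Finset E => exists_convexHull_inter_halfspace W (-a i)
    refine ⟨P.image p ∪ P.image n, ?_, ?_⟩
    · rw [← hP]
      simp only [Finset.set_biUnion_union, Finset.set_biUnion_finset_image]
      simp only [← Set.iUnion_union_distrib]
      refine Set.iUnion₂_congr fun W _ => ?_
      rw [hp, hn, ← Set.inter_union_distrib_left, Set.inter_eq_left]
      intro x _
      simpa using le_total 0 (a i x)
    · intro W hW j hj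
      rw [Finset.mem_union, Finset.mem_image, Finset.mem_image] at hW
      rw [Finset.mem_insert] at hj
      rcases hW with ⟨W, hW, rfl⟩ | ⟨W, hW, rfl⟩
      · rw [hp]
        rcases hj with rfl | hj
        · exact Or.inl fun x hx => hx.2
        · exact (hs W hW j hj).imp (fun h x hx => h x hx.1) fun h x hx => h x hx.1
      · rw [hn]
        rcases hj with rfl | hj
        · exact Or.inr fun x hx => by simpa using hx.2
        · exact (hs W hW j hj).imp (fun h x hx => h x hx.1) fun h x hx => h x hx.1

omit [NormedSpace ℝ F] in
/-- A continuous selection from finitely many continuous functions, any two of which either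
agree on `Q` or differ on each half-open segment from `q`, is one of them. -/
lemma exists_eqOn_of_selection {Q : Set E} (hQ : Convex ℝ Q) {q : E} (hq : q ∈ Q)
    {Λ : Set (E → F)} (hΛ : Λ.Finite) (hcont : ∀ A ∈ Λ, Continuous A) {φ : E → F}
    (hφ : ContinuousOn φ Q) (hsel : ∀ x ∈ Q, ∃ A ∈ Λ, φ x = A x)
    (heq : ∀ A ∈ Λ, ∀ A' ∈ Λ, A q = A' q → EqOn A A' Q)
    (hne : ∀ A ∈ Λ, ∀ A' ∈ Λ, A q ≠ A' q → ∀ x ∈ Q, ∀ s ∈ Ico (0 : ℝ) 1,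
      A (AffineMap.lineMap q x s) ≠ A' (AffineMap.lineMap q x s)) :
    ∃ A ∈ Λ, EqOn φ A Q := by
  obtain ⟨A, hA, hAq⟩ := hsel q hq
  refine ⟨A, hA, fun x hx => ?_⟩
  set γ : ℝ → E := fun s => AffineMap.lineMap q x s with hγ
  have hγc : Continuous γ := AffineMap.lineMap_continuous
  have hγQ : MapsTo γ (Icc 0 1) Q := fun s hs => hQ.segment_subset hq hx (by
    rw [segment_eq_image_lineMap]; exact ⟨s, hs, rfl⟩)
  have hφγ : ContinuousOn (fun s => φ (γ s)) (Icc 0 1) := hφ.comp hγc.continuousOn hγQ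
  have hcl : ∀ B ∈ Λ, IsClosed (Icc (0 : ℝ) 1 ∩ {s | φ (γ s) = B (γ s)}) := fun B hB => by
    have := (hφγ.prodMk ((hcont B hB).comp hγc).continuousOn).preimage_isClosed_of_isClosed
      isClosed_Icc isClosed_diagonal
    simpa [Set.preimage, Set.diagonal] using this
  set T := Icc (0 : ℝ) 1 ∩ {s | φ (γ s) = A (γ s)} with hT
  set T' := ⋃ B ∈ {B ∈ Λ | B q ≠ A q}, Icc (0 : ℝ) 1 ∩ {s | φ (γ s) = B (γ s)} with hT'
  have hT'c : IsClosed T' := (hΛ.subset (sep_subset _ _)).isClosed_biUnion fun B hB => hcl B hB.1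
  have hcover : Ico (0 : ℝ) 1 ⊆ T ∪ T' := fun s hs => by
    have hs' := Ico_subset_Icc_self hs
    obtain ⟨B, hB, hBe⟩ := hsel _ (hγQ hs')
    by_cases h : B q = A q
    · exact Or.inl ⟨hs', by rw [mem_ofPred_eq, hBe]; exact heq B hB A hA h (hγQ hs')⟩
    · exact Or.inr (mem_biUnion (show B ∈ {B ∈ Λ | B q ≠ A q} from ⟨hB, h⟩) ⟨hs', hBe⟩)
  -- Two closed sets cover a connected interval and `T` is met at `0`. A point of `T'` would force a
  -- common point, where two maps differing at `q` coincide.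
  have hsub : Ico (0 : ℝ) 1 ⊆ T := by
    intro s hs
    by_contra hsT
    obtain ⟨r, hr, hrT, hrT'⟩ := isPreconnected_closed_iff.1 isPreconnected_Ico T T' (hcl A hA) hT'c
      hcover ⟨0, by simp, by simp [hT, hγ, hAq]⟩ ⟨s, hs, (hcover hs).resolve_left hsT⟩
    obtain ⟨B, hB, hrB⟩ := mem_iUnion₂.1 hrT'
    exact hne B hB.1 A hA hB.2 x hx r hr (hrB.2.symm.trans hrT.2)
  -- Distinct maps may meet at the far endpoint, which is therefore reached by closure.
  have h1 : (1 : ℝ) ∈ T := by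
    have := closure_minimal hsub (hcl A hA)
    rw [closure_Ico (by norm_num)] at this
    exact this (by simp)
  simpa [hT, hγ] using h1.2

lemma centroid_affine {W : Finset E} {a : E →ᵃ[ℝ] ℝ} (hW : W.Nonempty) :
    a (∑ w ∈ W, (W.card : ℝ)⁻¹ • w) = (W.card : ℝ)⁻¹ * ∑ w ∈ W, a w := by
  have hc : (W.card : ℝ) ≠ 0 := by simpa using hW.ne_empty
  rw [affineMap_sum W (fun _ => (W.card : ℝ)⁻¹) (fun v => v) (by simp [hc])]
  simp [Finset.mul_sum]

lemma centroid_mem_convexHull {W : Finset E} (hW : W.Nonempty) :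
    ∑ w ∈ W, (W.card : ℝ)⁻¹ • w ∈ convexHull ℝ (W : Set E) := by
  have hc : (W.card : ℝ) ≠ 0 := by simpa using hW.ne_empty
  exact (convex_convexHull ℝ _).sum_mem (fun _ _ => by positivity) (by simp [hc])
    fun w hw => subset_convexHull _ _ hw

/-- The centroid weighs every vertex positively, so vanishing there forces a nonnegative functional
to vanish at each vertex. -/
lemma eq_zero_of_centroid {W : Finset E} (hW : W.Nonempty) {a : E →ᵃ[ℝ] ℝ}
    (ha : ∀ x ∈ convexHull ℝ (W : Set E), 0 ≤ a x) (h0 : a (∑ w ∈ W, (W.card : ℝ)⁻¹ • w) = 0)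
    {x : E} (hx : x ∈ convexHull ℝ (W : Set E)) : a x = 0 := by
  have hc : (W.card : ℝ) ≠ 0 := by simpa using hW.ne_empty
  rw [centroid_affine hW] at h0
  have h1 := (mul_eq_zero.1 h0).resolve_left (inv_ne_zero hc)
  have h2 := (Finset.sum_eq_zero_iff_of_nonneg fun w hw => ha w (subset_convexHull _ _ hw)).1 h1
  rw [Finset.mem_convexHull'] at hx
  obtain ⟨w, -, hw1, rfl⟩ := hx
  rw [affineMap_sum W w (fun v => v) hw1]
  exact Finset.sum_eq_zero fun v hv => by simp [h2 v hv]

lemma lineMap_ne_zero_of_centroid {W : Finset E} {a : E →ᵃ[ℝ] ℝ} {q x : E}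
    (ha : ∀ x ∈ convexHull ℝ (W : Set E), 0 ≤ a x) (hq : q ∈ convexHull ℝ (W : Set E))
    (hx : x ∈ convexHull ℝ (W : Set E)) (h0 : a q ≠ 0) {s : ℝ} (hs : s ∈ Ico (0 : ℝ) 1) :
    a (AffineMap.lineMap q x s) ≠ 0 := by
  rw [AffineMap.apply_lineMap, AffineMap.lineMap_apply_ring]
  have h1 : 0 < a q := lt_of_le_of_ne (ha q hq) h0.symm
  have : 0 < (1 - s) * a q := mul_pos (by linarith [hs.2]) h1
  have : 0 ≤ s * a x := mul_nonneg hs.1 (ha x hx)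
  linarith

/-- Cut along the zero sets of all coordinates of differences `A - A'`. On a piece each such
coordinate has a constant weak sign, so its value at the centroid decides whether it vanishes
identically or is nonzero on half-open segments from the centroid; `exists_eqOn_of_selection` then
applies. -/
lemma exists_affine_pieces [FiniteDimensional ℝ E] [FiniteDimensional ℝ F] (V : Finset E)
    {φ : E → F} (hφ : ContinuousOn φ (convexHull ℝ (V : Set E)))
    {Λ : Set (E →ᵃ[ℝ] F)} (hΛ : Λ.Finite)
    (hsel : ∀ x ∈ convexHull ℝ (V : Set E), ∃ A ∈ Λ, φ x = A x) :
    ∃ P : Finset (Finset E), (⋃ W ∈ P, convexHull ℝ (W : Set E)) = convexHull ℝ (V : Set E) ∧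
      ∀ W ∈ P, ∃ A : E →ᵃ[ℝ] F, EqOn φ A (convexHull ℝ (W : Set E)) := by
  classical
  let b := Module.finBasis ℝ F
  let a : (E →ᵃ[ℝ] F) × (E →ᵃ[ℝ] F) × Fin (Module.finrank ℝ F) → E →ᵃ[ℝ] ℝ := fun p =>
    (b.coord p.2.2).toAffineMap.comp (p.1 - p.2.1)
  obtain ⟨P, hP, hs⟩ := exists_convexHull_split V
    (hΛ.toFinset ×ˢ (hΛ.toFinset ×ˢ Finset.univ)) a
  refine ⟨P, hP, fun W hW => ?_⟩
  rcases W.eq_empty_or_nonempty with rfl | hne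
  · exact ⟨0, by simp⟩
  have hsub : convexHull ℝ (W : Set E) ⊆ convexHull ℝ (V : Set E) := by
    rw [← hP]; exact subset_biUnion_of_mem (u := fun W : Finset E => convexHull ℝ (W : Set E)) hW
  set q := ∑ w ∈ W, (W.card : ℝ)⁻¹ • w with hq
  have hqW : q ∈ convexHull ℝ (W : Set E) := centroid_mem_convexHull hne
  have ha : ∀ A A' i x, a (A, A', i) x = b.repr (A x) i - b.repr (A' x) i := by
    intro A A' i x; simp [a]
  have hsgn : ∀ A ∈ Λ, ∀ A' ∈ Λ, ∀ i,
      (∀ x ∈ convexHull ℝ (W : Set E), 0 ≤ a (A, A', i) x) ∨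
      (∀ x ∈ convexHull ℝ (W : Set E), a (A, A', i) x ≤ 0) := fun A hA A' hA' i =>
    hs W hW _ (by simp [hA, hA'])
  suffices h : ∃ B ∈ (fun A : E →ᵃ[ℝ] F => (A : E → F)) '' Λ,
      EqOn φ B (convexHull ℝ (W : Set E)) by
    obtain ⟨_, ⟨A, -, rfl⟩, hA⟩ := h
    exact ⟨A, hA⟩
  refine exists_eqOn_of_selection (convex_convexHull ℝ (W : Set E)) hqW
    (Λ := (fun A : E →ᵃ[ℝ] F => (A : E → F)) '' Λ) (hΛ.image _)
    (by rintro _ ⟨A, -, rfl⟩; exact A.continuous_of_finiteDimensional) (hφ.mono hsub)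
    (fun x hx => by
      obtain ⟨A, hA, h⟩ := hsel x (hsub hx)
      exact ⟨_, ⟨A, hA, rfl⟩, h⟩) ?_ ?_
  · rintro _ ⟨A, hA, rfl⟩ _ ⟨A', hA', rfl⟩ h x hx
    replace h : A q = A' q := h
    apply b.repr.injective
    ext i
    have h0 : a (A, A', i) q = 0 := by rw [ha, h, sub_self]
    have hx0 : a (A, A', i) x = 0 := by
      rcases hsgn A hA A' hA' i with h' | h'
      · exact eq_zero_of_centroid hne h' h0 hx
      · have := eq_zero_of_centroid (a := -a (A, A', i)) hne (fun x hx => by simpa using h' x hx)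
          (by simpa using h0) hx
        simpa using this
    rw [ha] at hx0
    exact sub_eq_zero.1 hx0
  · rintro _ ⟨A, hA, rfl⟩ _ ⟨A', hA', rfl⟩ h x hx s hs' hcon
    replace hcon : A (AffineMap.lineMap q x s) = A' (AffineMap.lineMap q x s) := hcon
    obtain ⟨i, hi⟩ : ∃ i, a (A, A', i) q ≠ 0 := by
      by_contra! hall
      apply h
      apply b.repr.injective
      ext i
      have := hall i
      rw [ha] at this
      exact sub_eq_zero.1 this
    have h0 : a (A, A', i) (AffineMap.lineMap q x s) = 0 := by
      rw [ha]
      exact sub_eq_zero.2 (by rw [hcon])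
    rcases hsgn A hA A' hA' i with h' | h'
    · exact lineMap_ne_zero_of_centroid h' hqW hx hi hs' h0
    · exact lineMap_ne_zero_of_centroid (a := -a (A, A', i)) (fun x hx => by simpa using h' x hx)
        hqW hx (by simpa using hi) hs' (by change -(a (A, A', i) _) = 0; rw [h0, neg_zero])

/-- Every point of `X` has a neighbourhood in `X` that is a finite union of polytopes. -/
def IsLocallyPolyhedral (X : Set E) : Prop :=
  ∀ x ∈ X, ∃ P : Finset (Finset E), (∀ V ∈ P, convexHull ℝ (V : Set E) ⊆ X) ∧
    (⋃ V ∈ P, convexHull ℝ (V : Set E)) ∈ 𝓝[X] x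

/-- The way back from selections to `IsPLOn`: every polytope of a local cover is refined by
`exists_affine_pieces`. -/
lemma isPLOn_of_selection [FiniteDimensional ℝ E] [FiniteDimensional ℝ F] {X : Set E}
    (hX : IsLocallyPolyhedral X) {φ : E → F} (hφ : ContinuousOn φ X) {Λ : Set (E →ᵃ[ℝ] F)}
    (hΛ : Λ.Finite) (hsel : ∀ x ∈ X, ∃ A ∈ Λ, φ x = A x) : IsPLOn φ X := by
  classical
  intro x hx
  obtain ⟨P, hPX, hP⟩ := hX x hx
  have : ∀ V : Finset E, ∃ Q : Finset (Finset E), V ∈ P →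
      (⋃ W ∈ Q, convexHull ℝ (W : Set E)) = convexHull ℝ (V : Set E) ∧
      ∀ W ∈ Q, ∃ A : E →ᵃ[ℝ] F, EqOn φ A (convexHull ℝ (W : Set E)) := by
    intro V
    by_cases hV : V ∈ P
    · obtain ⟨Q, hQ⟩ := exists_affine_pieces V (hφ.mono (hPX V hV)) hΛ
        fun x hx => hsel x (hPX V hV hx)
      exact ⟨Q, fun _ => hQ⟩
    · exact ⟨∅, fun h => absurd h hV⟩
  choose Q hQ using this
  refine ⟨P.biUnion Q, ?_, ?_⟩
  · intro W hW
    obtain ⟨V, hV, hWV⟩ := Finset.mem_biUnion.1 hW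
    refine ⟨?_, (hQ V hV).2 W hWV⟩
    refine Subset.trans ?_ (hPX V hV)
    rw [← (hQ V hV).1]
    exact subset_biUnion_of_mem (u := fun W : Finset E => convexHull ℝ (W : Set E)) hWV
  · rw [Finset.set_biUnion_biUnion]
    rwa [Set.iUnion₂_congr fun V hV => (hQ V hV).1]

/-- Intersect the polytopes with a small full-dimensional simplex around the point; its barycentric
coordinates present it as an intersection of half-spaces. -/
lemma isLocallyPolyhedral_inter_isOpen [FiniteDimensional ℝ E] (P : Finset (Finset E)) {O : Set E}
    (hO : IsOpen O) : IsLocallyPolyhedral ((⋃ V ∈ P, convexHull ℝ (V : Set E)) ∩ O) := by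
  classical
  rintro x ⟨-, hxO⟩
  obtain ⟨b, hxb, hbO⟩ := exists_mem_interior_convexHull_affineBasis (hO.mem_nhds hxO)
  choose Q hQ using fun V : Finset E =>
    exists_convexHull_inter_halfspaces V Finset.univ fun i => b.coord i
  have hQ' : ∀ V, convexHull ℝ (Q V : Set E) =
      convexHull ℝ (V : Set E) ∩ convexHull ℝ (range b) := fun V => by
    rw [hQ, b.convexHull_eq_nonneg_coord]; simp
  refine ⟨P.image Q, ?_, ?_⟩
  · simp only [Finset.mem_image, forall_exists_index, and_imp, forall_apply_eq_imp_iff₂]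
    intro V hV
    rw [hQ']
    exact inter_subset_inter
      (subset_biUnion_of_mem (u := fun W : Finset E => convexHull ℝ (W : Set E)) hV) hbO
  · rw [Finset.set_biUnion_finset_image]
    simp only [hQ']
    rw [← iUnion₂_inter]
    exact Filter.inter_mem (nhdsWithin_mono x inter_subset_left self_mem_nhdsWithin)
      (mem_nhdsWithin_of_mem_nhds (mem_interior_iff_mem_nhds.1 hxb))

lemma isLocallyPolyhedral_of_isOpen [FiniteDimensional ℝ E] {O : Set E}
    (hO : IsOpen O) : IsLocallyPolyhedral O := by
  classical
  intro x hxO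
  obtain ⟨b, hxb, hbO⟩ := exists_mem_interior_convexHull_affineBasis (hO.mem_nhds hxO)
  refine ⟨{Finset.univ.image b}, ?_, ?_⟩
  · simpa using hbO
  · simpa using mem_nhdsWithin_of_mem_nhds (mem_interior_iff_mem_nhds.1 hxb)

/-- A PL map on a compact set is a continuous selection from finitely many affine maps. -/
lemma IsPLOn.exists_selection [FiniteDimensional ℝ E] {X : Set E} (hX : IsCompact X)
    {φ : E → F} (h : IsPLOn φ X) :
    ContinuousOn φ X ∧ ∃ Λ : Set (E →ᵃ[ℝ] F), Λ.Finite ∧ ∀ x ∈ X, ∃ A ∈ Λ, φ x = A x := by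
  classical
  choose! P hP hPn using h
  constructor
  · intro x hx
    have hc : ContinuousOn φ (⋃ V ∈ P x, convexHull ℝ (V : Set E)) := by
      have := LocallyFinite.continuousOn_iUnion (X := E) (g := φ)
        (f := fun V : P x => convexHull ℝ (V.1 : Set E)) (locallyFinite_of_finite _)
        (fun V => V.1.finite_toSet.isClosed_convexHull _) (fun V => by
          obtain ⟨A, hA⟩ := (hP x hx V.1 V.2).2
          exact A.continuous_of_finiteDimensional.continuousOn.congr hA)
      rwa [iUnion_subtype] at this
    exact (hc x (mem_of_mem_nhdsWithin hx (hPn x hx))).mono_of_mem_nhdsWithin (hPn x hx)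
  · obtain ⟨t, htX, ht⟩ := hX.elim_nhdsWithin_subcover
      (fun x => ⋃ V ∈ P x, convexHull ℝ (V : Set E)) hPn
    have : ∀ V : Finset E, ∃ A : E →ᵃ[ℝ] F, (∃ x ∈ t, V ∈ P x) →
        EqOn φ A (convexHull ℝ (V : Set E)) := by
      intro V
      by_cases hV : ∃ x ∈ t, V ∈ P x
      · obtain ⟨x, hx, hV'⟩ := hV
        obtain ⟨A, hA⟩ := (hP x (htX x hx) V hV').2
        exact ⟨A, fun _ => hA⟩
      · exact ⟨0, fun h => absurd h hV⟩
    choose A hA using this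
    refine ⟨A '' (t.biUnion P), (Finset.finite_toSet _).image _, fun x hx => ?_⟩
    obtain ⟨y, hy, hxy⟩ := mem_iUnion₂.1 (ht hx)
    obtain ⟨V, hV, hxV⟩ := mem_iUnion₂.1 hxy
    exact ⟨A V, ⟨V, by simpa using ⟨y, hy, hV⟩, rfl⟩, hA V ⟨y, hy, hV⟩ hxV⟩

end Polytopes

/-! ### Homogeneous piecewise linear maps and equivalences of cones. -/

section Cones

variable {V W Z : Type*} [NormedAddCommGroup V] [NormedSpace ℝ V] [NormedAddCommGroup W]
  [NormedSpace ℝ W] [NormedAddCommGroup Z] [NormedSpace ℝ Z]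

/-- `φ` is on `X` a continuous selection from finitely many linear maps. -/
def IsFinLin (φ : V → W) (X : Set V) : Prop :=
  ContinuousOn φ X ∧ ∃ Λ : Set (V →ₗ[ℝ] W), Λ.Finite ∧ ∀ x ∈ X, ∃ L ∈ Λ, φ x = L x

lemma isFinLin_linear [FiniteDimensional ℝ V] (L : V →ₗ[ℝ] W) (X : Set V) : IsFinLin L X :=
  ⟨L.continuous_of_finiteDimensional.continuousOn, {L}, finite_singleton _, fun _ _ => ⟨L, rfl, rfl⟩⟩

lemma IsFinLin.mono {φ : V → W} {X Y : Set V} (h : IsFinLin φ Y) (hXY : X ⊆ Y) : IsFinLin φ X :=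
  ⟨h.1.mono hXY, h.2.imp fun _ hΛ => ⟨hΛ.1, fun x hx => hΛ.2 x (hXY hx)⟩⟩

lemma IsFinLin.comp {φ : V → W} {ψ : W → Z} {X : Set V} {Y : Set W} (hψ : IsFinLin ψ Y)
    (hφ : IsFinLin φ X) (hm : MapsTo φ X Y) : IsFinLin (ψ ∘ φ) X := by
  obtain ⟨hc, Λ, hΛ, hs⟩ := hφ
  obtain ⟨hc', Λ', hΛ', hs'⟩ := hψ
  refine ⟨hc'.comp hc hm, image2 (fun M L => M ∘ₗ L) Λ' Λ, hΛ'.image2 _ hΛ, fun x hx => ?_⟩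
  obtain ⟨L, hL, hLx⟩ := hs x hx
  obtain ⟨M, hM, hMx⟩ := hs' _ (hm hx)
  exact ⟨M ∘ₗ L, ⟨M, hM, L, hL, rfl⟩, by simp [hMx, ← hLx]⟩

lemma IsFinLin.prodMk {φ : V → W} {ψ : V → Z} {X : Set V} (hφ : IsFinLin φ X)
    (hψ : IsFinLin ψ X) : IsFinLin (fun x => (φ x, ψ x)) X := by
  obtain ⟨hc, Λ, hΛ, hs⟩ := hφ
  obtain ⟨hc', Λ', hΛ', hs'⟩ := hψ
  refine ⟨hc.prodMk hc', image2 (fun M L => M.prod L) Λ Λ', hΛ.image2 _ hΛ', fun x hx => ?_⟩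
  obtain ⟨L, hL, hLx⟩ := hs x hx
  obtain ⟨M, hM, hMx⟩ := hs' x hx
  exact ⟨_, ⟨L, hL, M, hM, rfl⟩, by simp [hMx, hLx]⟩

lemma IsFinLin.linear_comp [FiniteDimensional ℝ W] {φ : V → W} {X : Set V} (hφ : IsFinLin φ X)
    (L : W →ₗ[ℝ] Z) : IsFinLin (fun x => L (φ x)) X :=
  (isFinLin_linear L univ).comp hφ (mapsTo_univ _ _)

lemma IsFinLin.add {φ ψ : V → W} {X : Set V} (hφ : IsFinLin φ X)
    (hψ : IsFinLin ψ X) : IsFinLin (fun x => φ x + ψ x) X := by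
  obtain ⟨hc, Λ, hΛ, hs⟩ := hφ
  obtain ⟨hc', Λ', hΛ', hs'⟩ := hψ
  refine ⟨hc.add hc', image2 (fun M L => M + L) Λ Λ', hΛ.image2 _ hΛ', fun x hx => ?_⟩
  obtain ⟨L, hL, hLx⟩ := hs x hx
  obtain ⟨M, hM, hMx⟩ := hs' x hx
  exact ⟨_, ⟨L, hL, M, hM, rfl⟩, by simp [hMx, hLx]⟩

lemma IsFinLin.smul_vec [FiniteDimensional ℝ V] {φ : V → ℝ} {X : Set V} (hφ : IsFinLin φ X)
    (w : W) : IsFinLin (fun x => φ x • w) X :=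
  hφ.linear_comp (LinearMap.toSpanSingleton ℝ W w)

lemma IsFinLin.neg {φ : V → W} {X : Set V} (hφ : IsFinLin φ X) :
    IsFinLin (fun x => -φ x) X := by
  obtain ⟨hc, Λ, hΛ, hs⟩ := hφ
  refine ⟨hc.neg, (fun L => -L) '' Λ, hΛ.image _, fun x hx => ?_⟩
  obtain ⟨L, hL, hLx⟩ := hs x hx
  exact ⟨_, ⟨L, hL, rfl⟩, by simp [hLx]⟩

lemma IsFinLin.sub {φ ψ : V → W} {X : Set V} (hφ : IsFinLin φ X)
    (hψ : IsFinLin ψ X) : IsFinLin (fun x => φ x - ψ x) X := by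
  simpa [sub_eq_add_neg] using hφ.add hψ.neg

lemma IsFinLin.max {φ ψ : V → ℝ} {X : Set V} (hφ : IsFinLin φ X)
    (hψ : IsFinLin ψ X) : IsFinLin (fun x => max (φ x) (ψ x)) X := by
  obtain ⟨hc, Λ, hΛ, hs⟩ := hφ
  obtain ⟨hc', Λ', hΛ', hs'⟩ := hψ
  refine ⟨hc.sup hc', Λ ∪ Λ', hΛ.union hΛ', fun x hx => ?_⟩
  rcases max_choice (φ x) (ψ x) with h | h
  · obtain ⟨L, hL, hLx⟩ := hs x hx
    exact ⟨L, Or.inl hL, h.trans hLx⟩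
  · obtain ⟨L, hL, hLx⟩ := hs' x hx
    exact ⟨L, Or.inr hL, h.trans hLx⟩

lemma IsFinLin.abs {φ : V → ℝ} {X : Set V} (hφ : IsFinLin φ X) :
    IsFinLin (fun x => |φ x|) X := hφ.max hφ.neg

lemma isFinLin_zero (X : Set V) : IsFinLin (fun _ : V => (0 : W)) X :=
  ⟨continuousOn_const, {0}, finite_singleton _, fun _ _ => ⟨0, rfl, rfl⟩⟩

lemma IsFinLin.sum {ι : Type*} (s : Finset ι) {φ : ι → V → W} {X : Set V}
    (hφ : ∀ i ∈ s, IsFinLin (φ i) X) : IsFinLin (fun x => ∑ i ∈ s, φ i x) X := by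
  classical
  induction s using Finset.induction_on with
  | empty => simpa using isFinLin_zero X
  | insert i s hi ih =>
    simp only [Finset.sum_insert hi]
    exact (hφ i (by simp)).add (ih fun j hj => hφ j (by simp [hj]))

lemma IsFinLin.pi {ι : Type*} [Fintype ι] {φ : ι → V → ℝ} {X : Set V}
    (hφ : ∀ i, IsFinLin (φ i) X) : IsFinLin (fun x i => φ i x) X := by
  choose hc Λ hΛ hs using hφ
  refine ⟨continuousOn_pi.2 hc, (fun L : ι → V →ₗ[ℝ] ℝ => LinearMap.pi L) '' Set.pi univ Λ,
    (Set.Finite.pi fun i => hΛ i).image _, fun x hx => ?_⟩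
  · choose L hL hLx using fun i => hs i x hx
    exact ⟨_, ⟨L, fun i _ => hL i, rfl⟩, by ext i; simp [hLx]⟩

/-- Pasting linear maps along a finite closed cover. -/
lemma isFinLin_of_cover [FiniteDimensional ℝ V] {ι : Type*} [Finite ι] {D : ι → Set V}
    (hD : ∀ i, IsClosed (D i)) {φ : V → W} {L : ι → V →ₗ[ℝ] W} (h : ∀ i, EqOn φ (L i) (D i)) :
    IsFinLin φ (⋃ i, D i) := by
  refine ⟨(locallyFinite_of_finite _).continuousOn_iUnion hD fun i =>
    (L i).continuous_of_finiteDimensional.continuousOn.congr (h i), range L, finite_range _, ?_⟩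
  intro x hx
  obtain ⟨i, hi⟩ := mem_iUnion.1 hx
  exact ⟨L i, mem_range_self i, h i hi⟩

omit [NormedSpace ℝ W] in
/-- A continuous curve on a preconnected set with finitely many values is constant. -/
lemma eq_of_continuousOn_of_finite {S : Set ℝ} (hS : IsPreconnected S) {f : ℝ → W}
    (hf : ContinuousOn f S) {T : Set W} (hT : T.Finite) (hm : MapsTo f S T) {s t : ℝ}
    (hs : s ∈ S) (ht : t ∈ S) : f s = f t := by
  exact hS.constant_of_mapsTo hT.isDiscrete hf hm hs ht

/-- The curve `t ↦ t⁻¹ • φ (t • x)` is continuous and takes values among the finitely many `L x`, so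
it is constant. -/
lemma IsFinLin.map_pos_smul {φ : V → W} {X : Set V} (hφ : IsFinLin φ X) {x : V}
    (hx : ∀ t : ℝ, 0 < t → t • x ∈ X) {t : ℝ} (ht : 0 < t) : φ (t • x) = t • φ x := by
  obtain ⟨hc, Λ, hΛ, hs⟩ := hφ
  have := eq_of_continuousOn_of_finite (S := Ioi (0 : ℝ)) isPreconnected_Ioi
    (f := fun t => t⁻¹ • φ (t • x)) (T := (fun L : V →ₗ[ℝ] W => L x) '' Λ) ?_ (hΛ.image _) ?_
    (show t ∈ Ioi 0 from ht) (show (1 : ℝ) ∈ Ioi 0 by simp)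
  · simp only [inv_one, one_smul] at this
    rw [← this, smul_smul, mul_inv_cancel₀ ht.ne', one_smul]
  · refine ContinuousOn.smul (continuousOn_inv₀.mono fun t ht => (ne_of_gt (mem_Ioi.1 ht))) ?_
    exact hc.comp (by fun_prop) fun t ht => hx t ht
  · intro t ht
    obtain ⟨L, hL, h⟩ := hs _ (hx t ht)
    refine ⟨L, hL, ?_⟩
    simp only [h, map_smul, smul_smul, inv_mul_cancel₀ (ne_of_gt (mem_Ioi.1 ht)), one_smul]

/-- Mutually inverse bijections between `X` and `Y` which are continuous selections from finitely
many linear maps. -/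
structure ConeEquiv (X : Set V) (Y : Set W) (φ : V → W) (ψ : W → V) : Prop where
  mapsTo : MapsTo φ X Y
  mapsTo_symm : MapsTo ψ Y X
  left_inv : LeftInvOn ψ φ X
  right_inv : LeftInvOn φ ψ Y
  finLin : IsFinLin φ X
  finLin_symm : IsFinLin ψ Y

namespace ConeEquiv

variable {X : Set V} {Y : Set W} {T : Set Z} {φ : V → W} {ψ : W → V} {φ' : W → Z} {ψ' : Z → W}

lemma symm (h : ConeEquiv X Y φ ψ) : ConeEquiv Y X ψ φ :=
  ⟨h.mapsTo_symm, h.mapsTo, h.right_inv, h.left_inv, h.finLin_symm, h.finLin⟩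

lemma trans (h : ConeEquiv X Y φ ψ) (h' : ConeEquiv Y T φ' ψ') :
    ConeEquiv X T (φ' ∘ φ) (ψ ∘ ψ') where
  mapsTo := h'.mapsTo.comp h.mapsTo
  mapsTo_symm := h.mapsTo_symm.comp h'.mapsTo_symm
  left_inv x hx := by simp [h'.left_inv (h.mapsTo hx), h.left_inv hx]
  right_inv x hx := by simp [h.right_inv (h'.mapsTo_symm hx), h'.right_inv hx]
  finLin := h'.finLin.comp h.finLin h.mapsTo
  finLin_symm := h.finLin_symm.comp h'.finLin_symm h'.mapsTo_symm

lemma prod [FiniteDimensional ℝ V] [FiniteDimensional ℝ W] {V' W' : Type*}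
    [NormedAddCommGroup V'] [NormedSpace ℝ V'] [FiniteDimensional ℝ V']
    [NormedAddCommGroup W'] [NormedSpace ℝ W'] [FiniteDimensional ℝ W'] {X' : Set V'} {Y' : Set W'}
    {φ' : V' → W'} {ψ' : W' → V'} (h : ConeEquiv X Y φ ψ) (h' : ConeEquiv X' Y' φ' ψ') :
    ConeEquiv (X ×ˢ X') (Y ×ˢ Y') (Prod.map φ φ') (Prod.map ψ ψ') where
  mapsTo := h.mapsTo.prodMap h'.mapsTo
  mapsTo_symm := h.mapsTo_symm.prodMap h'.mapsTo_symm
  left_inv := fun x hx => Prod.ext (h.left_inv hx.1) (h'.left_inv hx.2)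
  right_inv := fun x hx => Prod.ext (h.right_inv hx.1) (h'.right_inv hx.2)
  finLin := (h.finLin.comp (isFinLin_linear (LinearMap.fst ℝ V V') _) fun x hx => hx.1).prodMk
    (h'.finLin.comp (isFinLin_linear (LinearMap.snd ℝ V V') _) fun x hx => hx.2)
  finLin_symm := (h.finLin_symm.comp (isFinLin_linear (LinearMap.fst ℝ W W') _)
    fun x hx => hx.1).prodMk
    (h'.finLin_symm.comp (isFinLin_linear (LinearMap.snd ℝ W W') _) fun x hx => hx.2)

lemma ofLinearEquiv [FiniteDimensional ℝ V] [FiniteDimensional ℝ W] (e : V ≃ₗ[ℝ] W)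
    (hXY : ∀ x, x ∈ X ↔ e x ∈ Y) : ConeEquiv X Y e e.symm where
  mapsTo x hx := (hXY x).1 hx
  mapsTo_symm y hy := (hXY _).2 (by simpa using hy)
  left_inv x _ := by simp
  right_inv y _ := by simp
  finLin := isFinLin_linear (e : V →ₗ[ℝ] W) X
  finLin_symm := isFinLin_linear (e.symm : W →ₗ[ℝ] V) Y

end ConeEquiv

end Cones

/-! ### Unions of coordinate orthants and their injective linear images. -/

section OrthantComplex

variable {I : Type*} [Fintype I] {W : Type*} [NormedAddCommGroup W] [NormedSpace ℝ W]

/-- A union of coordinate orthants `{c ≥ 0 | supp c ⊆ A}`. -/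
structure IsOrthantComplex (X : Set (I → ℝ)) : Prop where
  nonneg : ∀ c ∈ X, ∀ i, 0 ≤ c i
  down : ∀ c ∈ X, ∀ c' : I → ℝ, (∀ i, 0 ≤ c' i) → (∀ i, 0 < c' i → 0 < c i) → c' ∈ X

omit [Fintype I] in
lemma IsOrthantComplex.smul_mem {X : Set (I → ℝ)} (hX : IsOrthantComplex X) {c : I → ℝ}
    (hc : c ∈ X) {t : ℝ} (ht : 0 ≤ t) : t • c ∈ X :=
  hX.down c hc _ (fun i => mul_nonneg ht (hX.nonneg c hc i)) fun _ h =>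
    pos_of_mul_pos_right h ht

omit [Fintype I] in
/-- A linear map which is injective on an orthant complex has a linear left inverse on each of the
coordinate subspaces spanned by its orthants. -/
lemma IsOrthantComplex.exists_leftInverse {X : Set (I → ℝ)} (hX : IsOrthantComplex X)
    (Γ : (I → ℝ) →ₗ[ℝ] W) (hΓ : InjOn Γ X) {a : I → ℝ} (ha : a ∈ X) :
    ∃ L : W →ₗ[ℝ] I → ℝ, ∀ c : I → ℝ, (∀ i, a i = 0 → c i = 0) → L (Γ c) = c := by
  classical
  let S : Submodule ℝ (I → ℝ) := Submodule.pi univ fun i => if a i = 0 then ⊥ else ⊤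
  have hS : ∀ c, c ∈ S ↔ ∀ i, a i = 0 → c i = 0 := by
    intro c
    simp only [S, Submodule.mem_pi, Set.mem_univ, true_implies]
    refine forall_congr' fun i => ?_
    by_cases h : a i = 0 <;> simp [h]
  have hmem : ∀ c : I → ℝ, (∀ i, 0 ≤ c i) → (∀ i, a i = 0 → c i = 0) → c ∈ X := fun c h0 h1 =>
    hX.down _ ha c h0 fun i hi => lt_of_le_of_ne (hX.nonneg a ha i) fun h => hi.ne' (h1 i h.symm)
  obtain ⟨L, hL⟩ := (Γ.domRestrict S).exists_leftInverse_of_injective (by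
    rw [LinearMap.ker_eq_bot']
    rintro ⟨c, hc⟩ h0
    have h0 : Γ c = 0 := h0
    rw [hS] at hc
    -- Injectivity is known only on the orthant, not on its span: a kernel vector is the difference
    -- of its positive and negative parts, both in `X` and with equal images.
    have hp : (fun i => max (c i) 0) ∈ X := hmem _ (fun i => le_max_right _ _)
      fun i hi => by simp [hc i hi]
    have hn : (fun i => max (-c i) 0) ∈ X := hmem _ (fun i => le_max_right _ _)
      fun i hi => by simp [hc i hi]
    have hd : c = (fun i => max (c i) 0) - (fun i => max (-c i) 0) := by
      ext i
      simp only [Pi.sub_apply]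
      rcases le_total 0 (c i) with h | h
      · rw [max_eq_left h, max_eq_right (by linarith)]; ring
      · rw [max_eq_right h, max_eq_left (by linarith)]; ring
    have he : (fun i => max (c i) 0) = fun i => max (-c i) 0 := hΓ hp hn (by
      rw [hd, map_sub] at h0
      exact sub_eq_zero.1 h0)
    rw [he, sub_self] at hd
    exact Subtype.ext hd)
  refine ⟨S.subtype ∘ₗ L, fun c hc => ?_⟩
  exact congrArg Subtype.val (LinearMap.congr_fun hL ⟨c, (hS c).2 hc⟩)

open scoped Classical in
/-- A linear map which is injective on an orthant complex is a piecewise linear homeomorphism onto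
its image. -/
lemma IsOrthantComplex.exists_coneEquiv [FiniteDimensional ℝ W] {X : Set (I → ℝ)}
    (hX : IsOrthantComplex X)
    (Γ : (I → ℝ) →ₗ[ℝ] W) (hΓ : InjOn Γ X) : ∃ ψ : W → I → ℝ, ConeEquiv X (Γ '' X) Γ ψ := by
  have hleft : LeftInvOn (Function.invFunOn Γ X) Γ X := hΓ.leftInvOn_invFunOn
  let 𝒜 : Type _ := {A : Finset I // (fun i => if i ∈ A then (1 : ℝ) else 0) ∈ X}
  have hmem : ∀ A : 𝒜, ∀ c : I → ℝ, (∀ i, 0 ≤ c i) → (∀ i, i ∉ A.1 → c i = 0) → c ∈ X := by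
    intro A c h0 h1
    refine hX.down _ A.2 c h0 fun i hi => ?_
    by_cases h : i ∈ A.1
    · simp [h]
    · exact absurd (h1 i h) hi.ne'
  have hL : ∀ A : 𝒜, ∃ L : W →ₗ[ℝ] I → ℝ, ∀ c : I → ℝ, (∀ i, i ∉ A.1 → c i = 0) → L (Γ c) = c := by
    intro A
    obtain ⟨L, hL⟩ := hX.exists_leftInverse Γ hΓ A.2
    exact ⟨L, fun c hc => hL c fun i hi => hc i (by simpa using hi)⟩
  choose L hL using hL
  -- The image of one orthant, described by closed conditions through the left inverse, so that the
  -- inverse can be pasted along a finite closed cover.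
  let D : 𝒜 → Set W := fun A => {y | Γ (L A y) = y ∧ (∀ i, 0 ≤ L A y i) ∧
    ∀ i, i ∉ A.1 → L A y i = 0}
  have hDc : ∀ A, IsClosed (D A) := by
    intro A
    have hLc : Continuous (L A) := (L A).continuous_of_finiteDimensional
    have hLi : ∀ i, Continuous fun y => L A y i := fun i => (continuous_apply i).comp hLc
    have hΓc : Continuous Γ := Γ.continuous_of_finiteDimensional
    refine (isClosed_eq (hΓc.comp hLc) continuous_id).inter (IsClosed.inter ?_ ?_)
    · change IsClosed {y | ∀ i, 0 ≤ L A y i}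
      rw [ofPred_forall]
      exact isClosed_iInter fun i => isClosed_le continuous_const (hLi i)
    · change IsClosed {y | ∀ i, i ∉ A.1 → L A y i = 0}
      simp only [ofPred_forall]
      exact isClosed_iInter fun i => isClosed_iInter fun _ => isClosed_eq (hLi i) continuous_const
  have hDX : Γ '' X = ⋃ A, D A := by
    ext y
    simp only [mem_image, mem_iUnion]
    constructor
    · rintro ⟨c, hc, rfl⟩
      have hcA : (fun i => if i ∈ Finset.univ.filter (fun i => 0 < c i) then (1 : ℝ) else 0) ∈ X :=
        hX.down c hc _ (fun i => by split_ifs <;> norm_num) fun i hi => by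
          by_contra h
          simp [h] at hi
      refine ⟨⟨_, hcA⟩, ?_⟩
      have h0 : ∀ i, i ∉ Finset.univ.filter (fun i => 0 < c i) → c i = 0 := fun i hi =>
        le_antisymm (not_lt.1 (by simpa using hi)) (hX.nonneg c hc i)
      have hLc := hL ⟨_, hcA⟩ c h0
      refine ⟨by rw [hLc], fun i => by rw [hLc]; exact hX.nonneg c hc i, fun i hi => ?_⟩
      rw [hLc]; exact h0 i hi
    · rintro ⟨A, hy, h0, h1⟩
      exact ⟨L A y, hmem A _ h0 h1, hy⟩
  refine ⟨Function.invFunOn Γ X, mapsTo_image _ _, ?_, hleft, ?_, isFinLin_linear Γ X, ?_⟩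
  · rintro _ ⟨c, hc, rfl⟩
    rwa [hleft hc]
  · rintro _ ⟨c, hc, rfl⟩
    rw [hleft hc]
  · rw [hDX]
    refine isFinLin_of_cover hDc (L := L) fun A y hy => ?_
    have := hleft (hmem A _ hy.2.1 hy.2.2)
    rwa [hy.1] at this

end OrthantComplex

/-! ### Weights supported on chains of finite sets. -/

section ChainCone

variable {I J : Type*}

/-- The cone over the order complex of a finite family of finite sets. -/
def chainCone (s : I → Finset J) : Set (I → ℝ) :=
  {c | (∀ i, 0 ≤ c i) ∧ ∀ i j, 0 < c i → 0 < c j → s i ⊆ s j ∨ s j ⊆ s i}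

lemma isOrthantComplex_chainCone (s : I → Finset J) : IsOrthantComplex (chainCone s) where
  nonneg _ hc := hc.1
  down _ hc _ h0 h := ⟨h0, fun i j hi hj => hc.2 i j (h i hi) (h j hj)⟩

variable [Fintype I] {s : I → Finset J} {p : I → J → ℝ}

lemma exists_top {c : I → ℝ} (hc : c ∈ chainCone s) (h0 : c ≠ 0) :
    ∃ i, 0 < c i ∧ ∀ j, 0 < c j → s j ⊆ s i := by
  classical
  obtain ⟨k, hk⟩ : ∃ k, 0 < c k := by
    by_contra! h
    exact h0 (funext fun i => le_antisymm (h i) (hc.1 i))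
  obtain ⟨i, hi, hmax⟩ := (Finset.univ.filter fun i => 0 < c i).exists_max_image
    (fun i => (s i).card) ⟨k, by simpa using hk⟩
  simp only [Finset.mem_filter, Finset.mem_univ, true_and] at hi hmax
  refine ⟨i, hi, fun j hj => ?_⟩
  rcases hc.2 i j hi hj with h | h
  · exact (Finset.eq_of_subset_of_card_le h (hmax j hj)).ge
  · exact h

/-- The largest member of a chain can be read off from the combined weights as their support;
uniqueness and existence of chain coordinates both rest on this. -/
lemma sum_pos_iff_mem_top (hp : ∀ i x, 0 ≤ p i x) (hps : ∀ i x, 0 < p i x ↔ x ∈ s i) {c : I → ℝ}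
    (hc : ∀ i, 0 ≤ c i) {i : I} (hi : 0 < c i) (htop : ∀ j, 0 < c j → s j ⊆ s i) (x : J) :
    0 < ∑ j, c j * p j x ↔ x ∈ s i := by
  constructor
  · intro h
    obtain ⟨j, -, hj⟩ := Finset.exists_lt_of_sum_lt (f := fun _ => (0 : ℝ)) (by simpa using h)
    have hcj : 0 < c j := lt_of_le_of_ne (hc j) fun h => by simp [← h] at hj
    exact htop j hcj ((hps j x).1 (pos_of_mul_pos_right hj hcj.le))
  · intro h
    exact Finset.sum_pos' (fun j _ => mul_nonneg (hc j) (hp j x))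
      ⟨i, Finset.mem_univ _, mul_pos hi ((hps i x).2 h)⟩

/-- Remove the common part `min c c'`. The remainders have disjoint supports but the same combined
weights, hence the same top member, which is impossible unless both vanish. -/
lemma chainCone_unique (hs : Function.Injective s) (hne : ∀ i, (s i).Nonempty)
    (hp : ∀ i x, 0 ≤ p i x) (hps : ∀ i x, 0 < p i x ↔ x ∈ s i) {c c' : I → ℝ}
    (hc : c ∈ chainCone s) (hc' : c' ∈ chainCone s)
    (h : ∀ x, ∑ i, c i * p i x = ∑ i, c' i * p i x) : c = c' := by
  have hX := isOrthantComplex_chainCone s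
  set e : I → ℝ := fun i => min (c i) (c' i) with he
  have he0 : ∀ i, 0 ≤ e i := fun i => le_min (hc.1 i) (hc'.1 i)
  have hd : c - e ∈ chainCone s := hX.down c hc _
    (fun i => by simp [he]) fun i hi => by
      have := he0 i; simp only [Pi.sub_apply] at hi; linarith
  have hd' : c' - e ∈ chainCone s := hX.down c' hc' _
    (fun i => by simp [he]) fun i hi => by
      have := he0 i; simp only [Pi.sub_apply] at hi; linarith
  have hsum : ∀ x, ∑ i, (c - e) i * p i x = ∑ i, (c' - e) i * p i x := fun x => by
    simp only [Pi.sub_apply, sub_mul, Finset.sum_sub_distrib, h x]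
  have hz : ∀ {a b : I → ℝ}, a ∈ chainCone s → b ∈ chainCone s →
      (∀ x, ∑ i, a i * p i x = ∑ i, b i * p i x) → (∀ i, 0 < a i → b i = 0) → a = 0 := by
    intro a b ha hb hab hdis
    by_contra ha0
    obtain ⟨i, hi, htop⟩ := exists_top ha ha0
    have hsi := sum_pos_iff_mem_top hp hps ha.1 hi htop
    have hb0 : b ≠ 0 := by
      rintro rfl
      obtain ⟨x, hx⟩ := hne i
      have := (hsi x).2 hx
      rw [hab] at this
      simp at this
    obtain ⟨j, hj, htop'⟩ := exists_top hb hb0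
    have hsj := sum_pos_iff_mem_top hp hps hb.1 hj htop'
    have : i = j := hs (Finset.ext fun x => by rw [← hsi, ← hsj, hab])
    rw [this] at hi
    exact hj.ne' (hdis j hi)
  have h1 : c - e = 0 := hz hd hd' hsum fun i hi => by
    simp only [Pi.sub_apply, he, sub_pos, inf_lt_left, not_le] at hi ⊢
    rw [min_eq_right hi.le, sub_self]
  have h2 : c' - e = 0 := hz hd' hd (fun x => (hsum x).symm) fun i hi => by
    simp only [Pi.sub_apply, he, sub_pos, inf_lt_right, not_le] at hi ⊢
    rw [min_eq_left hi.le, sub_self]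
  rw [sub_eq_zero.1 h1, ← sub_eq_zero.1 h2]

/-- Greedy peeling: the support of `β` is some `s i`; subtract the largest multiple of `p i` that
keeps `β` nonnegative, and the support shrinks. The class `B`, closed under peeling, lets the
argument serve sign vectors, points of `K` and the boundary of an orthant alike. -/
lemma chainCone_exists (hps : ∀ i x, 0 < p i x ↔ x ∈ s i) (hp : ∀ i x, 0 ≤ p i x)
    {B : Set (J → ℝ)} (hB : ∀ β ∈ B, ∀ x, 0 ≤ β x)
    (hstep : ∀ β ∈ B, β ≠ 0 → ∃ i, (∀ x, 0 < β x ↔ x ∈ s i) ∧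
      ∀ t : ℝ, 0 ≤ t → (∀ x, 0 ≤ β x - t * p i x) → (fun x => β x - t * p i x) ∈ B)
    {β : J → ℝ} (hβ : β ∈ B) :
    ∃ c ∈ chainCone s, (∀ j, 0 < c j → ∀ x ∈ s j, 0 < β x) ∧ ∀ x, β x = ∑ i, c i * p i x := by
  classical
  suffices H : ∀ n : ℕ, ∀ β ∈ B, ∀ S : Finset J, (∀ x, 0 < β x ↔ x ∈ S) → S.card < n →
      ∃ c ∈ chainCone s, (∀ j, 0 < c j → ∀ x ∈ s j, 0 < β x) ∧ ∀ x, β x = ∑ i, c i * p i x by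
    by_cases h0 : β = 0
    · exact H 1 β hβ ∅ (by simp [h0]) (by simp)
    · obtain ⟨i, hi, -⟩ := hstep β hβ h0
      exact H _ β hβ (s i) hi (Nat.lt_succ_self _)
  intro n
  induction n with
  | zero => intro β _ S _ h; simp at h
  | succ n ih =>
    intro β hβ S hS hcard
    by_cases h0 : β = 0
    · exact ⟨0, ⟨by simp, by simp⟩, by simp, by simp [h0]⟩
    obtain ⟨i, hi, hst⟩ := hstep β hβ h0
    have hSi : S = s i := Finset.ext fun x => by rw [← hS, hi]
    have hne : (s i).Nonempty := by
      by_contra hem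
      rw [Finset.not_nonempty_iff_eq_empty] at hem
      apply h0
      funext x
      refine le_antisymm (not_lt.1 fun h => ?_) (hB β hβ x)
      have h := (hi x).1 h
      rw [hem] at h
      simp at h
    -- The least ratio is the largest admissible multiple, and `x₀` leaves the support.
    obtain ⟨x₀, hx₀, hmin⟩ := (s i).exists_min_image (fun x => β x / p i x) hne
    have hp₀ : 0 < p i x₀ := (hps i x₀).2 hx₀
    have ht : 0 < β x₀ / p i x₀ := div_pos ((hi x₀).2 hx₀) hp₀
    set t := β x₀ / p i x₀ with htdef
    have hnn : ∀ x, 0 ≤ β x - t * p i x := by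
      intro x
      by_cases hx : x ∈ s i
      · have := hmin x hx
        rw [le_div_iff₀ ((hps i x).2 hx)] at this
        linarith
      · have h1 : p i x = 0 := le_antisymm (not_lt.1 fun h => hx ((hps i x).1 h)) (hp i x)
        rw [h1]; simpa using hB β hβ x
    have hle : ∀ x, 0 < β x - t * p i x → x ∈ s i := fun x hx => by
      rw [← hi]
      have : 0 ≤ t * p i x := mul_nonneg ht.le (hp i x)
      linarith
    obtain ⟨c, hc, hcs, hcβ⟩ := ih _ (hst t ht.le hnn)
      ((s i).filter fun x => 0 < β x - t * p i x)
      (fun x => by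
        simp only [Finset.mem_filter]
        exact ⟨fun h => ⟨hle x h, h⟩, fun h => h.2⟩) (by
        have : ((s i).filter fun x => 0 < β x - t * p i x) ⊂ s i := by
          refine Finset.filter_ssubset.2 ⟨x₀, hx₀, ?_⟩
          rw [htdef, div_mul_cancel₀ _ hp₀.ne', sub_self]; exact lt_irrefl _
        have := Finset.card_lt_card this
        rw [hSi] at hcard
        omega)
    have hsub : ∀ j, 0 < c j → s j ⊆ s i := fun j hj x hx => hle x (hcs j hj x hx)
    refine ⟨fun j => c j + if j = i then t else 0, ⟨fun j => ?_, fun j k hj hk => ?_⟩,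
      fun j hj x hx => ?_, fun x => ?_⟩
    · have := hc.1 j
      dsimp only
      split_ifs <;> linarith
    · by_cases hji : j = i
      · subst hji
        by_cases hki : k = j
        · subst hki; simp
        · right; apply hsub; simpa [hki] using hk
      · by_cases hki : k = i
        · subst hki; left; apply hsub; simpa [hji] using hj
        · exact hc.2 j k (by simpa [hji] using hj) (by simpa [hki] using hk)
    · by_cases hji : j = i
      · subst hji; exact (hi x).2 hx
      · exact (hi x).2 (hsub j (by simpa [hji] using hj) hx)
    · have := hcβ x
      simp only [add_mul, Finset.sum_add_distrib, ← this, ite_mul, zero_mul, Finset.sum_ite_eq',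
        Finset.mem_univ, if_true]
      ring

end ChainCone

/-! ### Hyperplane arrangements and their barycentric subdivisions. -/

section Arrangement

variable {V : Type*} [NormedAddCommGroup V] [NormedSpace ℝ V]

/-- The positive and negative parts of the values of the functionals in `𝓛`. -/
noncomputable def signParts (𝓛 : Finset (V →ₗ[ℝ] ℝ)) (x : V) (j : 𝓛 × Bool) : ℝ :=
  max (if j.2 then j.1.1 x else -j.1.1 x) 0

/-- The sign vector of `x` with respect to the arrangement `𝓛`. -/
noncomputable def signSet (𝓛 : Finset (V →ₗ[ℝ] ℝ)) (x : V) : Finset (𝓛 × Bool) :=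
  open scoped Classical in Finset.univ.filter fun j => 0 < signParts 𝓛 x j

/-- The cells of the arrangement `𝓛`, apart from the cell of the origin. -/
abbrev SignCell (𝓛 : Finset (V →ₗ[ℝ] ℝ)) : Type _ :=
  {σ : Finset (𝓛 × Bool) // σ.Nonempty ∧ ∃ x, signSet 𝓛 x = σ}

variable {𝓛 : Finset (V →ₗ[ℝ] ℝ)}

lemma signParts_nonneg (x : V) (j : 𝓛 × Bool) : 0 ≤ signParts 𝓛 x j := le_max_right _ _

lemma mem_signSet {x : V} {j : 𝓛 × Bool} : j ∈ signSet 𝓛 x ↔ 0 < signParts 𝓛 x j := by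
  simp [signSet]

lemma mem_signSet_true {x : V} {l : 𝓛} : (l, true) ∈ signSet 𝓛 x ↔ 0 < l.1 x := by
  simp [mem_signSet, signParts]

lemma mem_signSet_false {x : V} {l : 𝓛} : (l, false) ∈ signSet 𝓛 x ↔ l.1 x < 0 := by
  simp [mem_signSet, signParts]

lemma signSet_smul {x : V} {t : ℝ} (ht : 0 < t) : signSet 𝓛 (t • x) = signSet 𝓛 x := by
  ext ⟨l, b⟩
  cases b
  · simp [mem_signSet_false, mul_neg_iff, ht, ht.le]
  · simp [mem_signSet_true, ht]

noncomputable instance : Fintype (SignCell 𝓛) := Fintype.ofFinite _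

variable {u : SignCell 𝓛 → V}

/-- Sign sets in a chain are nested, so opposite strict signs of `l` would both occur in the larger
one. -/
lemma signs_compatible (hu : ∀ i, signSet 𝓛 (u i) = i.1) {c : SignCell 𝓛 → ℝ}
    (hc : c ∈ chainCone fun i : SignCell 𝓛 => i.1) (l : 𝓛) :
    (∀ i, 0 ≤ c i * l.1 (u i)) ∨ ∀ i, c i * l.1 (u i) ≤ 0 := by
  by_contra! h
  obtain ⟨⟨i, hi⟩, j, hj⟩ := h
  have hci : 0 < c i := lt_of_le_of_ne (hc.1 i) fun h => by simp [← h] at hi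
  have hcj : 0 < c j := lt_of_le_of_ne (hc.1 j) fun h => by simp [← h] at hj
  have hi' : l.1 (u i) < 0 := by
    by_contra! h; exact absurd (mul_nonneg hci.le h) (not_le.2 hi)
  have hj' : 0 < l.1 (u j) := by
    by_contra! h; exact absurd (mul_nonpos_of_nonneg_of_nonpos hcj.le h) (not_le.2 hj)
  rw [← mem_signSet_false] at hi'
  rw [← mem_signSet_true] at hj'
  rcases hc.2 i j hci hcj with h | h
  · simp only [← hu] at h
    have h1 := mem_signSet_false.1 (h hi')
    have h2 := mem_signSet_true.1 hj'
    linarith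
  · simp only [← hu] at h
    have h1 := mem_signSet_false.1 hi'
    have h2 := mem_signSet_true.1 (h hj')
    linarith

/-- The positive part is additive on numbers of equal sign. Hence sign parts are linear along chains
and can serve as the weights `p` of the previous section. -/
lemma signParts_sum (hu : ∀ i, signSet 𝓛 (u i) = i.1) {c : SignCell 𝓛 → ℝ}
    (hc : c ∈ chainCone fun i : SignCell 𝓛 => i.1) (j : 𝓛 × Bool) :
    signParts 𝓛 (∑ i, c i • u i) j = ∑ i, c i * signParts 𝓛 (u i) j := by
  obtain ⟨l, b⟩ := j
  have hmul : ∀ i (r : ℝ), c i * max r 0 = max (c i * r) 0 := fun i r => by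
    rw [mul_max_of_nonneg _ _ (hc.1 i), mul_zero]
  have key : ∀ f : SignCell 𝓛 → ℝ, ((∀ i, 0 ≤ f i) ∨ ∀ i, f i ≤ 0) →
      max (∑ i, f i) 0 = ∑ i, max (f i) 0 := by
    rintro f (h | h)
    · rw [max_eq_left (Finset.sum_nonneg fun i _ => h i)]
      exact Finset.sum_congr rfl fun i _ => (max_eq_left (h i)).symm
    · rw [max_eq_right (Finset.sum_nonpos fun i _ => h i)]
      exact (Finset.sum_eq_zero fun i _ => max_eq_right (h i)).symm
  have hsgn := signs_compatible hu hc l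
  cases b
  · have e : -l.1 (∑ i, c i • u i) = ∑ i, c i * -l.1 (u i) := by
      rw [map_sum, ← Finset.sum_neg_distrib]
      exact Finset.sum_congr rfl fun i _ => by rw [map_smul, smul_eq_mul, mul_neg]
    simp only [signParts, Bool.false_eq_true, if_false]
    rw [e, key _ (hsgn.symm.imp (fun h i => by linarith [h i]) fun h i => by linarith [h i])]
    exact Finset.sum_congr rfl fun i _ => (hmul i _).symm
  · have e : l.1 (∑ i, c i • u i) = ∑ i, c i * l.1 (u i) := by
      rw [map_sum]
      exact Finset.sum_congr rfl fun i _ => by rw [map_smul, smul_eq_mul]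
    simp only [signParts, if_true]
    rw [e, key _ hsgn]
    exact Finset.sum_congr rfl fun i _ => (hmul i _).symm

/-- As long as the differences of the parts stay nonnegative, no functional crosses zero. This makes
the set of sign vectors closed under peeling. -/
lemma signParts_sub_smul {x y : V} (h : signSet 𝓛 y = signSet 𝓛 x) {t : ℝ}
    (ht : 0 ≤ t) (hnn : ∀ j, 0 ≤ signParts 𝓛 x j - t * signParts 𝓛 y j) (j : 𝓛 × Bool) :
    signParts 𝓛 (x - t • y) j = signParts 𝓛 x j - t * signParts 𝓛 y j := by
  obtain ⟨l, b⟩ := j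
  have h1 : 0 < l.1 y ↔ 0 < l.1 x := by rw [← mem_signSet_true, h, mem_signSet_true]
  have h2 : l.1 y < 0 ↔ l.1 x < 0 := by rw [← mem_signSet_false, h, mem_signSet_false]
  have n1 := hnn (l, true)
  have n2 := hnn (l, false)
  simp only [signParts, if_true, Bool.false_eq_true, if_false] at n1 n2
  rcases lt_trichotomy (l.1 x) 0 with hx | hx | hx
  · have hy := h2.2 hx
    rw [max_eq_left (by linarith), max_eq_left (by linarith)] at n2
    cases b
    · simp only [signParts, Bool.false_eq_true, if_false, map_sub, map_smul, smul_eq_mul]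
      rw [max_eq_left (by linarith), max_eq_left (by linarith), max_eq_left (by linarith)]; ring
    · simp only [signParts, if_true, map_sub, map_smul, smul_eq_mul]
      rw [max_eq_right (by linarith), max_eq_right (by linarith), max_eq_right (by linarith)]; ring
  · have hy : l.1 y = 0 := le_antisymm (not_lt.1 fun h => by linarith [h1.1 h])
      (not_lt.1 fun h => by linarith [h2.1 h])
    simp [signParts, hx, hy]
  · have hy := h1.2 hx
    rw [max_eq_left (by linarith), max_eq_left (by linarith)] at n1
    cases b
    · simp only [signParts, Bool.false_eq_true, if_false, map_sub, map_smul, smul_eq_mul]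
      rw [max_eq_right (by linarith), max_eq_right (by linarith), max_eq_right (by linarith)]; ring
    · simp only [signParts, if_true, map_sub, map_smul, smul_eq_mul]
      rw [max_eq_left (by linarith), max_eq_left (by linarith), max_eq_left (by linarith)]

lemma eq_of_signParts_eq (hsep : ∀ x : V, (∀ l ∈ 𝓛, l x = 0) → x = 0) {x y : V}
    (h : ∀ j, signParts 𝓛 x j = signParts 𝓛 y j) : x = y := by
  have hl : ∀ z : V, ∀ l : 𝓛, signParts 𝓛 z (l, true) - signParts 𝓛 z (l, false) = l.1 z := by
    intro z l
    simp only [signParts, if_true, Bool.false_eq_true, if_false]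
    rcases le_total 0 (l.1 z) with h | h
    · rw [max_eq_left h, max_eq_right (by linarith)]; ring
    · rw [max_eq_right h, max_eq_left (by linarith)]; ring
  refine sub_eq_zero.1 (hsep _ fun l hl' => ?_)
  rw [map_sub, ← hl x ⟨l, hl'⟩, ← hl y ⟨l, hl'⟩, h, h, sub_self]

/-- The barycentric subdivision of an arrangement: linear coordinates on its chains. -/
lemma exists_coneEquiv_signCell [FiniteDimensional ℝ V]
    (hsep : ∀ x : V, (∀ l ∈ 𝓛, l x = 0) → x = 0) (hu : ∀ i, signSet 𝓛 (u i) = i.1) :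
    ∃ ψ, ConeEquiv (chainCone fun i : SignCell 𝓛 => i.1) (univ : Set V)
      (Fintype.linearCombination ℝ u) ψ := by
  have hp : ∀ (i : SignCell 𝓛) j, 0 ≤ signParts 𝓛 (u i) j := fun i j => signParts_nonneg _ _
  have hps : ∀ (i : SignCell 𝓛) j, 0 < signParts 𝓛 (u i) j ↔ j ∈ i.1 := fun i j => by
    rw [← mem_signSet, hu]
  obtain ⟨ψ, hψ⟩ := (isOrthantComplex_chainCone fun i : SignCell 𝓛 => i.1).exists_coneEquiv
    (Fintype.linearCombination ℝ u) (by
      intro c hc c' hc' h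
      simp only [Fintype.linearCombination_apply] at h
      refine chainCone_unique Subtype.val_injective (fun i => i.2.1) hp hps hc hc' fun j => ?_
      rw [← signParts_sum hu hc, ← signParts_sum hu hc', h])
  refine ⟨ψ, ?_⟩
  convert hψ
  symm
  rw [eq_univ_iff_forall]
  intro x
  obtain ⟨c, hc, -, hcx⟩ := chainCone_exists (s := fun i : SignCell 𝓛 => i.1)
    (B := range (signParts 𝓛)) (β := signParts 𝓛 x) hps hp
    (by rintro _ ⟨x, rfl⟩ j; exact signParts_nonneg _ _) (by
      rintro _ ⟨y, rfl⟩ h0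
      have hne : (signSet 𝓛 y).Nonempty := by
        by_contra h
        rw [Finset.not_nonempty_iff_eq_empty] at h
        refine h0 (funext fun j => le_antisymm (not_lt.1 fun hj => ?_) (signParts_nonneg _ _))
        have := mem_signSet.2 hj
        rw [h] at this
        simp at this
      refine ⟨⟨signSet 𝓛 y, hne, y, rfl⟩, fun j => mem_signSet.symm, fun t ht hnn => ?_⟩
      exact ⟨y - t • u _, funext fun j => signParts_sub_smul (hu _) ht hnn j⟩)
    (mem_range_self x)
  refine ⟨c, hc, (eq_of_signParts_eq hsep fun j => ?_)⟩
  rw [hcx, Fintype.linearCombination_apply, signParts_sum hu hc]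

/-- The vertices of the chain and their combination lie in the closed cell `Q` of the top vertex. On
`Q` every difference `L - L'` keeps the weak sign it has at that vertex, so the selection is a
single linear map there. -/
lemma exists_linear_on_chain {b : V → ℝ} (hb : ContinuousOn b univ) {Λ : Set (V →ₗ[ℝ] ℝ)}
    [FiniteDimensional ℝ V]
    (hΛ : Λ.Finite) (hsel : ∀ x, ∃ L ∈ Λ, b x = L x) (hΛ𝓛 : ∀ L ∈ Λ, ∀ L' ∈ Λ, L - L' ∈ 𝓛)
    (hu : ∀ i, signSet 𝓛 (u i) = i.1) {c : SignCell 𝓛 → ℝ}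
    (hc : c ∈ chainCone fun i : SignCell 𝓛 => i.1) :
    b (∑ i, c i • u i) = ∑ i, c i * b (u i) := by
  by_cases hc0 : c = 0
  · subst hc0
    obtain ⟨L, -, h⟩ := hsel 0
    simp [h]
  obtain ⟨i, hi, htop⟩ := exists_top hc hc0
  set Q : Set V := {x | ∀ l : 𝓛, (l.1 (u i) ≤ 0 → l.1 x ≤ 0) ∧ (0 ≤ l.1 (u i) → 0 ≤ l.1 x)} with hQ
  have hQc : Convex ℝ Q := by
    intro x hx y hy a b ha hb _ l
    simp only [map_add, map_smul, smul_eq_mul]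
    refine ⟨fun h => ?_, fun h => ?_⟩
    · have := mul_nonpos_of_nonneg_of_nonpos ha ((hx l).1 h)
      have := mul_nonpos_of_nonneg_of_nonpos hb ((hy l).1 h)
      linarith
    · have := mul_nonneg ha ((hx l).2 h)
      have := mul_nonneg hb ((hy l).2 h)
      linarith
  have hiQ : u i ∈ Q := fun l => ⟨id, id⟩
  have huQ : ∀ j, 0 < c j → u j ∈ Q := by
    intro j hj l
    have hsub := htop j hj
    rw [← hu, ← hu] at hsub
    refine ⟨fun h => ?_, fun h => ?_⟩
    · by_contra! hlt
      have := mem_signSet_true.1 (hsub (mem_signSet_true.2 hlt))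
      linarith
    · by_contra! hlt
      have := mem_signSet_false.1 (hsub (mem_signSet_false.2 hlt))
      linarith
  have hΓQ : ∑ j, c j • u j ∈ Q := by
    intro l
    simp only [map_sum, map_smul, smul_eq_mul]
    refine ⟨fun h => Finset.sum_nonpos fun j _ => ?_, fun h => Finset.sum_nonneg fun j _ => ?_⟩
    · rcases (hc.1 j).eq_or_lt with h0 | h0
      · simp [← h0]
      · exact mul_nonpos_of_nonneg_of_nonpos h0.le ((huQ j h0 l).1 h)
    · rcases (hc.1 j).eq_or_lt with h0 | h0
      · simp [← h0]
      · exact mul_nonneg h0.le ((huQ j h0 l).2 h)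
  suffices h : ∃ B ∈ (fun L : V →ₗ[ℝ] ℝ => (L : V → ℝ)) '' Λ, EqOn b B Q by
    obtain ⟨_, ⟨L, -, rfl⟩, hL⟩ := h
    replace hL : ∀ x ∈ Q, b x = L x := hL
    rw [hL _ hΓQ, map_sum]
    refine Finset.sum_congr rfl fun j _ => ?_
    rcases (hc.1 j).eq_or_lt with h0 | h0
    · simp [← h0]
    · rw [hL _ (huQ j h0), map_smul, smul_eq_mul]
  refine exists_eqOn_of_selection hQc hiQ (hΛ.image _)
    (by rintro _ ⟨L, -, rfl⟩; exact L.continuous_of_finiteDimensional) (hb.mono (subset_univ _))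
    (fun x _ => by
      obtain ⟨L, hL, h⟩ := hsel x
      exact ⟨_, ⟨L, hL, rfl⟩, h⟩) ?_ ?_
  · rintro _ ⟨L, hL, rfl⟩ _ ⟨L', hL', rfl⟩ h x hx
    replace h : L (u i) = L' (u i) := h
    have h1 := hx ⟨_, hΛ𝓛 L hL L' hL'⟩
    simp only [LinearMap.sub_apply, h, sub_self, le_refl, true_implies] at h1
    change L x = L' x
    linarith [h1.1, h1.2]
  · rintro _ ⟨L, hL, rfl⟩ _ ⟨L', hL', rfl⟩ h x hx s hs hcon
    replace h : L (u i) ≠ L' (u i) := h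
    have h1 := hx ⟨_, hΛ𝓛 L hL L' hL'⟩
    simp only [LinearMap.sub_apply] at h1
    replace hcon : L (AffineMap.lineMap (u i) x s) = L' (AffineMap.lineMap (u i) x s) := hcon
    simp only [AffineMap.lineMap_apply_module, map_add, map_smul, smul_eq_mul] at hcon
    have hs1 : 0 < 1 - s := by linarith [hs.2]
    rcases lt_or_gt_of_ne h with h | h
    · have h2 := h1.1 (by linarith)
      nlinarith [mul_pos hs1 (sub_pos.2 h), mul_nonneg hs.1 (by linarith : 0 ≤ L' x - L x)]
    · have h2 := h1.2 (by linarith)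
      nlinarith [mul_pos hs1 (sub_pos.2 h), mul_nonneg hs.1 (by linarith : 0 ≤ L x - L' x)]

open scoped Classical in
/-- Two piecewise linear functions with the same sign differ by a piecewise linear
homeomorphism. -/
lemma exists_coneEquiv_of_same_sign [FiniteDimensional ℝ V] {b₁ b₂ : V → ℝ}
    (h₁ : IsFinLin b₁ univ) (h₂ : IsFinLin b₂ univ) (hpos : ∀ x, 0 < b₁ x ↔ 0 < b₂ x)
    (hneg : ∀ x, b₁ x < 0 ↔ b₂ x < 0) :
    ∃ H H' : V → V, ConeEquiv univ univ H H' ∧ ∀ x, b₂ (H x) = b₁ x := by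
  obtain ⟨hc₁, Λ₁, hΛ₁, hs₁⟩ := id h₁
  obtain ⟨hc₂, Λ₂, hΛ₂, hs₂⟩ := id h₂
  -- Differences within each family make `b₁` and `b₂` linear on chains; the coordinate functionals
  -- make the arrangement separate points.
  set 𝓛 : Finset (V →ₗ[ℝ] ℝ) := (hΛ₁.image2 (fun L L' => L - L') hΛ₁).toFinset ∪
    (hΛ₂.image2 (fun L L' => L - L') hΛ₂).toFinset ∪
    Finset.univ.image fun i => (Module.finBasis ℝ V).coord i with h𝓛
  have hsep : ∀ x : V, (∀ l ∈ 𝓛, l x = 0) → x = 0 := by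
    intro x hx
    apply (Module.finBasis ℝ V).repr.injective
    ext i
    simpa using hx ((Module.finBasis ℝ V).coord i) (by simp [h𝓛])
  have hd₁ : ∀ L ∈ Λ₁, ∀ L' ∈ Λ₁, L - L' ∈ 𝓛 := fun L hL L' hL' => by
    simp only [h𝓛, Finset.mem_union, Finite.mem_toFinset]
    exact Or.inl (Or.inl ⟨L, hL, L', hL', rfl⟩)
  have hd₂ : ∀ L ∈ Λ₂, ∀ L' ∈ Λ₂, L - L' ∈ 𝓛 := fun L hL L' hL' => by
    simp only [h𝓛, Finset.mem_union, Finite.mem_toFinset]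
    exact Or.inl (Or.inr ⟨L, hL, L', hL', rfl⟩)
  choose v hv using fun i : SignCell 𝓛 => i.2.2
  -- Each vertex moves along its ray until `b₂` takes the value of `b₁`. Equal signs make the factor
  -- positive, so the cell does not change; where both functions vanish any positive factor would
  -- do.
  set r : SignCell 𝓛 → ℝ := fun i => if b₂ (v i) = 0 then 1 else b₁ (v i) / b₂ (v i) with hr
  have hr0 : ∀ i, 0 < r i := by
    intro i
    simp only [hr]
    split_ifs with h
    · exact one_pos
    · rcases lt_or_gt_of_ne h with h | h
      · exact div_pos_of_neg_of_neg ((hneg _).2 h) h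
      · exact div_pos ((hpos _).2 h) h
  have hrb : ∀ i, b₂ (r i • v i) = b₁ (v i) := by
    intro i
    rw [h₂.map_pos_smul (fun _ _ => mem_univ _) (hr0 i)]
    simp only [hr, smul_eq_mul]
    split_ifs with h
    · rw [h, mul_zero]
      refine (le_antisymm (not_lt.1 fun h' => ?_) (not_lt.1 fun h' => ?_)).symm
      · exact ((hpos _).1 h').ne' h
      · exact ((hneg _).1 h').ne h
    · rw [div_mul_cancel₀ _ h]
  have hu : ∀ i, signSet 𝓛 (r i • v i) = i.1 := fun i => by rw [signSet_smul (hr0 i), hv]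
  obtain ⟨ψ₁, hψ₁⟩ := exists_coneEquiv_signCell hsep hv
  obtain ⟨ψ₂, hψ₂⟩ := exists_coneEquiv_signCell hsep hu
  -- The homeomorphism keeps the chain weights and replaces the vertices `v i` by `r i • v i`.
  refine ⟨_, _, hψ₁.symm.trans hψ₂, fun x => ?_⟩
  have hc := hψ₁.mapsTo_symm (mem_univ x)
  have e1 := exists_linear_on_chain hc₁ hΛ₁ (fun x => hs₁ x (mem_univ x)) hd₁ hv hc
  have e2 := exists_linear_on_chain hc₂ hΛ₂ (fun x => hs₂ x (mem_univ x)) hd₂ hu hc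
  have e3 := hψ₁.right_inv (mem_univ x)
  rw [Fintype.linearCombination_apply] at e3
  rw [e3] at e1
  simp only [Function.comp_apply, Fintype.linearCombination_apply]
  rw [e1, e2]
  simp only [hrb]

end Arrangement

/-! ### Straightening a piecewise linear function along a direction. -/

section Shear

variable {V : Type*} [NormedAddCommGroup V] [NormedSpace ℝ V]

/-- Far out along `ρ` the point is a large multiple of a small perturbation of `ρ`, so homogeneity
and continuity at `ρ` suffice. -/
lemma IsFinLin.exists_smul_add_mem {B : V → ℝ} (hB : IsFinLin B univ) {O : Set ℝ} (hO : IsOpen O)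
    (hOs : ∀ r ∈ O, ∀ s : ℝ, 0 < s → s * r ∈ O) {ρ : V} (hρ : B ρ ∈ O) (y : V) :
    ∃ s : ℝ, 0 < s ∧ B (y + s • ρ) ∈ O := by
  have hc : Continuous fun t : ℝ => B (ρ + t • y) :=
    (continuousOn_univ.1 hB.1).comp (by fun_prop)
  have h0 : ∀ᶠ t in 𝓝[>] (0 : ℝ), B (ρ + t • y) ∈ O :=
    (hc.continuousAt.eventually_mem (hO.mem_nhds (by simpa using hρ))).filter_mono
      nhdsWithin_le_nhds
  obtain ⟨t, ht, ht0⟩ := (h0.and self_mem_nhdsWithin).exists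
  replace ht0 : 0 < t := ht0
  refine ⟨t⁻¹, inv_pos.2 ht0, ?_⟩
  have : y + t⁻¹ • ρ = t⁻¹ • (ρ + t • y) := by
    rw [smul_add, smul_smul, inv_mul_cancel₀ ht0.ne', one_smul, add_comm]
  rw [this, hB.map_pos_smul (fun _ _ => mem_univ _) (inv_pos.2 ht0)]
  exact hOs _ ht _ (inv_pos.2 ht0)

/-- If `B` decreases with slope `1` in direction `ρ` where it is nonpositive, the set where it is
nonpositive is the epigraph of a piecewise linear function. -/
lemma exists_height {B : V → ℝ} (hB : IsFinLin B univ) {ρ : V}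
    (h1 : ∀ y, B y ≤ 0 → ∀ s : ℝ, 0 ≤ s → B (y + s • ρ) = B y - s) (h2 : B ρ < 0)
    (h3 : 0 < B (-ρ)) :
    ∃ K : V → ℝ, IsFinLin K univ ∧ (∀ y (s : ℝ), K (y + s • ρ) = K y - s) ∧
      (∀ y, 0 < B y ↔ 0 < K y) ∧ ∀ y, B y < 0 ↔ K y < 0 := by
  have hBc : Continuous B := continuousOn_univ.1 hB.1
  -- Every line in direction `ρ` is eventually negative forwards and positive backwards. The height
  -- `K y` is the time at which it meets the zero set.
  have hroot : ∀ y, ∃ s : ℝ, B (y + s • ρ) = 0 := by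
    intro y
    obtain ⟨s, -, hs⟩ := hB.exists_smul_add_mem isOpen_Iio
      (fun r hr s hs => mul_neg_of_pos_of_neg hs hr) (mem_Iio.2 h2) y
    obtain ⟨s', -, hs'⟩ := hB.exists_smul_add_mem isOpen_Ioi
      (fun r hr s hs => mul_pos hs hr) (mem_Ioi.2 h3) y
    have hc : Continuous fun s : ℝ => B (y + s • ρ) := hBc.comp (by fun_prop)
    exact mem_range_of_exists_le_of_exists_ge hc ⟨s, le_of_lt hs⟩
      ⟨-s', by simpa using le_of_lt (mem_Ioi.1 hs')⟩
  choose K hK0 using hroot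
  have hK : ∀ y s, K y ≤ s → B (y + s • ρ) = K y - s := by
    intro y s hs
    have := h1 (y + K y • ρ) (hK0 y).le (s - K y) (by linarith)
    rw [hK0, add_assoc, ← add_smul] at this
    rw [show K y + (s - K y) = s by ring] at this
    linarith
  have hK' : ∀ y s, B (y + s • ρ) ≤ 0 → K y ≤ s := by
    intro y s hs
    by_contra! hlt
    have := h1 _ hs (K y - s) (by linarith)
    rw [add_assoc, ← add_smul, show s + (K y - s) = K y by ring, hK0] at this
    linarith
  have hshift : ∀ y (s : ℝ), K (y + s • ρ) = K y - s := by
    intro y s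
    have e : y + s • ρ + (K y - s) • ρ = y + K y • ρ := by
      rw [add_assoc, ← add_smul]; congr 2; ring
    have hle := hK' (y + s • ρ) (K y - s) (by rw [e, hK0])
    have := hK _ _ hle
    rw [e, hK0] at this
    linarith
  refine ⟨K, ⟨continuousOn_univ.2 ?_, ?_⟩, hshift, fun y => ?_, fun y => ?_⟩
  · rw [continuous_iff_continuousAt]
    intro y
    have hc : Continuous fun z => B (z + (K y + 1) • ρ) := hBc.comp (by fun_prop)
    have hneg : B (y + (K y + 1) • ρ) < 0 := by rw [hK _ _ (by linarith)]; linarith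
    -- One unit past the root `B` is strictly negative, also for nearby lines, and there it
    -- determines `K` by the unit slope.
    have hev : ∀ᶠ z in 𝓝 y, K z = B (z + (K y + 1) • ρ) + (K y + 1) := by
      filter_upwards [hc.continuousAt.eventually_lt_const hneg] with z hz
      rw [hK _ _ (hK' _ _ hz.le)]; ring
    exact (hc.add continuous_const).continuousAt.congr (hev.mono fun z hz => hz.symm)
  · obtain ⟨-, Λ, hΛ, hs⟩ := hB
    refine ⟨Λ, hΛ, fun y _ => ?_⟩
    have : Finite Λ := hΛ
    choose L hL hLe using fun s : ℝ => hs (y + s • ρ) (mem_univ _)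
    -- Pigeonhole: two points past the root on the same line use the same linear map `L`. Comparing
    -- them gives `L ρ = -1`, and then `L y = K y`.
    obtain ⟨s, t, hst, he⟩ := Finite.exists_ne_map_eq_of_infinite
      (fun s : Ici (K y) => (⟨L s, hL s⟩ : Λ))
    have he : L s = L t := congrArg Subtype.val he
    refine ⟨L s, hL s, ?_⟩
    have e1 := hLe s
    have e2 := hLe t
    rw [hK _ _ s.2, map_add, map_smul, smul_eq_mul] at e1
    rw [hK _ _ t.2, ← he, map_add, map_smul, smul_eq_mul] at e2
    have hne : (s : ℝ) - t ≠ 0 := sub_ne_zero.2 fun h => hst (Subtype.ext h)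
    have : L s ρ = -1 := by
      apply mul_left_cancel₀ hne
      linarith
    rw [this] at e1
    linarith
  · constructor
    · intro h
      by_contra! h'
      have := hK y 0 h'
      simp only [zero_smul, add_zero] at this
      linarith
    · intro h
      by_contra! h'
      have := hK' y 0 (by simpa using h')
      linarith
  · constructor
    · intro h
      have h' := hK' y 0 (by simpa using h.le)
      have := hK y 0 h'
      simp only [zero_smul, add_zero] at this
      linarith
    · intro h
      have := hK y 0 h.le
      simp only [zero_smul, add_zero] at this
      linarith

/-- The sum `l + K` is constant along `ρ`, so sliding back by the same amount inverts the slide. -/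
lemma coneEquiv_shear [FiniteDimensional ℝ V] {K : V → ℝ} (hK : IsFinLin K univ) {ρ : V}
    (hshift : ∀ y (s : ℝ), K (y + s • ρ) = K y - s) {l : V →ₗ[ℝ] ℝ} (hl : l ρ = 1) :
    ∃ θ θ' : V → V, ConeEquiv univ univ θ θ' ∧ ∀ y, l (θ y) = -K y := by
  have hlF : IsFinLin (fun y => l y) univ := isFinLin_linear l univ
  have hid : IsFinLin (fun y : V => y) univ := isFinLin_linear LinearMap.id univ
  refine ⟨fun y => y + (-(l y + K y)) • ρ, fun y => y + (l y + K y) • ρ,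
    ⟨mapsTo_univ _ _, mapsTo_univ _ _, fun y _ => ?_, fun y _ => ?_,
      hid.add ((hlF.add hK).neg.smul_vec ρ), hid.add ((hlF.add hK).smul_vec ρ)⟩, fun y => ?_⟩
  · simp only [hshift, map_add, map_smul, hl, smul_eq_mul, mul_one]
    rw [add_assoc, ← add_smul]
    ring_nf
    simp
  · simp only [hshift, map_add, map_smul, hl, smul_eq_mul, mul_one]
    rw [add_assoc, ← add_smul]
    ring_nf
    simp
  · simp only [map_add, map_smul, hl, smul_eq_mul, mul_one]
    ring

end Shear

/-! ### Linear functions on a cone that are negative at a single vertex. -/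

section OneVertex

variable {I : Type*} [Fintype I] [DecidableEq I]

/-- Diagonal scaling. -/
noncomputable def diagScale (δ : I → ℝ) (hδ : ∀ i, δ i ≠ 0) : (I → ℝ) ≃ₗ[ℝ] (I → ℝ) :=
  LinearEquiv.piCongrRight fun i => LinearEquiv.smulOfNeZero ℝ ℝ (δ i) (hδ i)

omit [Fintype I] [DecidableEq I] in
lemma diagScale_apply (δ : I → ℝ) (hδ : ∀ i, δ i ≠ 0) (c : I → ℝ) (i : I) :
    diagScale δ hδ c i = δ i * c i := rfl

omit [DecidableEq I] in
lemma IsOrthantComplex.coneEquiv_diagScale {X : Set (I → ℝ)} (hX : IsOrthantComplex X)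
    {δ : I → ℝ} (hδ : ∀ i, 0 < δ i) :
    ConeEquiv X X (diagScale δ fun i => (hδ i).ne') (diagScale δ fun i => (hδ i).ne').symm := by
  refine ConeEquiv.ofLinearEquiv _ fun c => ⟨fun hc => ?_, fun hc => ?_⟩
  · refine hX.down c hc _ (fun i => ?_) fun i hi => ?_
    · exact mul_nonneg (hδ i).le (hX.nonneg c hc i)
    · exact pos_of_mul_pos_right hi (hδ i).le
  · refine hX.down _ hc _ (fun i => ?_) fun i hi => ?_
    · exact nonneg_of_mul_nonneg_right (hX.nonneg _ hc i) (hδ i)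
    · exact mul_pos (hδ i) hi

variable {X : Set (I → ℝ)} {V : Type*} [NormedAddCommGroup V] [NormedSpace ℝ V]
  {Φ : (I → ℝ) → V} {Ψ : V → I → ℝ}

/-- Near the ray of `x` only linear pieces correct at the vertex are selected, so `Φ (z + s • e) - s
• Φ e` takes finitely many values and is constant in `s`. The last clause keeps the antipode of the
ray out of the narrow cone. -/
lemma exists_translation_const (hX : IsOrthantComplex X) (hΦ : ConeEquiv X univ Φ Ψ) {x : I}
    (hx : Pi.single x 1 ∈ X) :
    ∃ C : ℝ, 0 < C ∧
      (∀ z ∈ X, C * ∑ i ∈ Finset.univ.erase x, z i ≤ z x → ∀ s : ℝ, 0 ≤ s →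
        z + s • Pi.single x 1 ∈ X ∧
        Φ (z + s • Pi.single x 1) = Φ z + s • Φ (Pi.single x 1)) ∧
      Ψ (-Φ (Pi.single x 1)) x <
        C * ∑ i ∈ Finset.univ.erase x, Ψ (-Φ (Pi.single x 1)) i := by
  set e : I → ℝ := Pi.single x 1 with he
  set N : (I → ℝ) → ℝ := fun z => ∑ i ∈ Finset.univ.erase x, z i with hN
  obtain ⟨hc, Λ, hΛ, hsel⟩ := id hΦ.finLin
  have hhom : ∀ z ∈ X, ∀ t : ℝ, 0 < t → Φ (t • z) = t • Φ z := fun z hz t ht =>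
    hΦ.finLin.map_pos_smul (fun t ht => hX.smul_mem hz ht.le) ht
  have h0X : (0 : I → ℝ) ∈ X := by simpa using hX.smul_mem hx le_rfl
  have hΦ0 : Φ 0 = 0 := by
    obtain ⟨L, -, h⟩ := hsel 0 h0X
    simpa using h
  have hρ : Φ e ≠ 0 := fun h => by
    have : e = 0 := hΦ.left_inv.injOn hx h0X (h.trans hΦ0.symm)
    simpa [he] using congrFun this x
  -- near `e` only the maps that are correct at `e` are selected
  obtain ⟨ε, hε, hnear⟩ : ∃ ε > 0, ∀ z ∈ X, dist z e < ε → ∀ L ∈ Λ, Φ z = L z → L e = Φ e := by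
    have hev : ∀ᶠ z in 𝓝[X] e, ∀ L ∈ Λ, Φ z = L z → L e = Φ e := by
      rw [Filter.eventually_all_finite hΛ]
      intro L _
      by_cases hL : L e = Φ e
      · exact Filter.Eventually.of_forall fun _ _ => hL
      · have h1 : ContinuousWithinAt (fun z => Φ z - L z) X e :=
          (hc e hx).sub L.continuous_of_finiteDimensional.continuousWithinAt
        filter_upwards [h1.eventually_ne (sub_ne_zero.2 (Ne.symm hL))] with z hz h
        exact absurd (sub_eq_zero.2 h) hz
    obtain ⟨ε, hε, h⟩ := Metric.mem_nhdsWithin_iff.1 hev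
    exact ⟨ε, hε, fun z hz hd => h ⟨hd, hz⟩⟩
  set w := Ψ (-Φ e) with hw
  have hwX : w ∈ X := hΦ.mapsTo_symm (mem_univ _)
  -- Otherwise `w` is a nonnegative multiple of `e`, while its image is `-Φ e`; homogeneity then
  -- gives `(w x + 1) • Φ e = 0`.
  have hNw : 0 < N w := by
    have hge : ∀ i ∈ Finset.univ.erase x, 0 ≤ w i := fun i _ => hX.nonneg w hwX i
    refine lt_of_le_of_ne (Finset.sum_nonneg hge) fun h => ?_
    have hz := (Finset.sum_eq_zero_iff_of_nonneg hge).1 h.symm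
    have hwe : w = w x • e := by
      ext i
      by_cases hi : i = x
      · subst hi; simp [he]
      · simp [he, hi, hz i (by simp [hi])]
    have hΦw : Φ w = -Φ e := hΦ.right_inv (mem_univ _)
    have hΦw' : Φ w = w x • Φ e := by
      rcases (hX.nonneg w hwX x).eq_or_lt with h0 | h0
      · rw [hwe, ← h0]; simp [hΦ0]
      · conv_lhs => rw [hwe]
        exact hhom e hx _ h0
    have : (w x + 1) • Φ e = 0 := by rw [add_smul, one_smul, ← hΦw', hΦw, neg_add_cancel]
    rcases smul_eq_zero.1 this with h' | h'
    · linarith [hX.nonneg w hwX x]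
    · exact hρ h'
  -- The first entry makes the cone narrow enough for `hnear`, the second puts `w` outside it.
  have hC : 0 < max (2 / ε) (w x / N w + 1) := lt_max_of_lt_left (by positivity)
  set C := max (2 / ε) (w x / N w + 1) with hCdef
  refine ⟨C, hC, fun z hz hzC s hs => ?_, ?_⟩
  · have hge : ∀ i ∈ Finset.univ.erase x, 0 ≤ z i := fun i _ => hX.nonneg z hz i
    rcases (hX.nonneg z hz x).eq_or_lt with h0 | h0
    · have hNz : N z = 0 := le_antisymm (by
        rw [← h0] at hzC
        exact nonpos_of_mul_nonpos_right hzC hC) (Finset.sum_nonneg hge)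
      have hzz := (Finset.sum_eq_zero_iff_of_nonneg hge).1 hNz
      have : z = 0 := by
        ext i
        by_cases hi : i = x
        · subst hi; exact h0.symm
        · exact hzz i (by simp [hi])
      subst this
      refine ⟨by simpa using hX.smul_mem hx hs, ?_⟩
      rw [zero_add, hΦ0, zero_add]
      rcases hs.eq_or_lt with h | h
      · simp [← h, hΦ0]
      · exact hhom e hx s h
    have hmem : ∀ r : ℝ, 0 ≤ r → z + r • e ∈ X := by
      intro r hr
      refine hX.down z hz _ (fun i => ?_) fun i hi => ?_
      · have := hX.nonneg z hz i
        have : 0 ≤ e i := hX.nonneg e hx i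
        simp only [Pi.add_apply, Pi.smul_apply, smul_eq_mul]
        positivity
      · by_cases h : i = x
        · rwa [h]
        · simpa [he, h] using hi
    refine ⟨hmem s hs, ?_⟩
    -- Scaled to have `x`-coordinate one, the point `z + r • e` is within `ε` of `e`, and by
    -- homogeneity it selects the same `L`.
    have hLe : ∀ r : ℝ, 0 ≤ r → ∀ L ∈ Λ, Φ (z + r • e) = L (z + r • e) → L e = Φ e := by
      intro r hr L hL hLz
      set z' := z + r • e with hz'
      have hz'x : z' x = z x + r := by simp [hz', he]
      have hz'i : ∀ i, i ≠ x → z' i = z i := fun i hi => by simp [hz', he, hi]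
      have hpos : 0 < z' x := by linarith
      refine hnear (((z' x)⁻¹) • z') (hX.smul_mem (hmem r hr) (inv_pos.2 hpos).le) ?_ L hL ?_
      · rw [dist_pi_lt_iff hε]
        intro i
        by_cases hi : i = x
        · subst hi
          simp [he, inv_mul_cancel₀ hpos.ne', hε]
        · simp only [Pi.smul_apply, smul_eq_mul, he, Pi.single_eq_of_ne hi, dist_zero_right,
            Real.norm_eq_abs]
          rw [hz'i i hi, abs_of_nonneg (mul_nonneg (inv_pos.2 hpos).le (hX.nonneg z hz i)),
            inv_mul_lt_iff₀ hpos]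
          have h1 : z i ≤ N z := Finset.single_le_sum hge (by simp [hi])
          have h2 : 2 / ε * N z ≤ z x :=
            (mul_le_mul_of_nonneg_right (le_max_left _ _) (Finset.sum_nonneg hge)).trans hzC
          have h3 : 2 * N z ≤ z x * ε := by
            rw [div_mul_eq_mul_div, div_le_iff₀ hε] at h2; exact h2
          have h4 : z x * ε ≤ z' x * ε := mul_le_mul_of_nonneg_right (by linarith) hε.le
          have h5 := mul_pos hpos hε
          have h6 := hX.nonneg z hz i
          linarith
      · rw [hhom _ (hmem r hr) _ (inv_pos.2 hpos), hLz, map_smul]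
    have key := eq_of_continuousOn_of_finite (S := Ici (0 : ℝ)) isPreconnected_Ici
      (f := fun r => Φ (z + r • e) - r • Φ e) (T := (fun L : (I → ℝ) →ₗ[ℝ] V => L z) '' Λ) ?_
      (hΛ.image _) ?_ (show s ∈ Ici 0 from hs) (show (0 : ℝ) ∈ Ici 0 by simp)
    · simp only [zero_smul, add_zero, sub_zero] at key
      rw [← key]; abel
    · refine ContinuousOn.sub (hc.comp (by fun_prop) fun r hr => hmem r hr) (by fun_prop)
    · intro r hr
      obtain ⟨L, hL, hLz⟩ := hsel _ (hmem r hr)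
      refine ⟨L, hL, ?_⟩
      have := hLe r hr L hL hLz
      simp only [hLz, map_add, map_smul, this, add_sub_cancel_right]
  · have h1 : w x / N w + 1 ≤ C := le_max_right _ _
    have h2 : (w x / N w + 1) * N w ≤ C * N w := mul_le_mul_of_nonneg_right h1 hNw.le
    rw [add_mul, div_mul_cancel₀ _ hNw.ne'] at h2
    linarith

/-- If `X` is piecewise linearly `ℝ^m`, a linear function on `X` which is negative at one vertex
and positive at the others can be made the last coordinate. -/
lemma exists_coneEquiv_last_coord {m : ℕ} {Φ : (I → ℝ) → Fin m → ℝ} {Ψ : (Fin m → ℝ) → I → ℝ}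
    (hX : IsOrthantComplex X) (hΦ : ConeEquiv X univ Φ Ψ) {x : I} (hx : Pi.single x 1 ∈ X)
    {a : I → ℝ} (hax : a x < 0) (ha : ∀ i, i ≠ x → 0 < a i) :
    ∃ (Φ' : (I → ℝ) → Fin m → ℝ) (Ψ' : (Fin m → ℝ) → I → ℝ), ConeEquiv X univ Φ' Ψ' ∧
      ∃ j : Fin m, (j : ℕ) + 1 = m ∧ ∀ c ∈ X, Φ' c j = ∑ i, a i * c i := by
  obtain ⟨C, hC, htr, hopp⟩ := exists_translation_const hX hΦ hx
  set e : I → ℝ := Pi.single x 1 with he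
  -- Only the signs of `a` matter: the diagonal scaling `γ` below carries `∑ a i * c i` to `b`,
  -- whose nonpositive set is the narrow cone.
  let b : (I → ℝ) →ₗ[ℝ] ℝ := C • (∑ i ∈ Finset.univ.erase x, LinearMap.proj i) - LinearMap.proj x
  have hb : ∀ z, b z = C * ∑ i ∈ Finset.univ.erase x, z i - z x := fun z => by simp [b]
  have hbe : b e = -1 := by
    rw [hb, Finset.sum_eq_zero]
    · simp [he]
    · intro i hi; simp [he, Finset.ne_of_mem_erase hi]
  have hB : IsFinLin (fun y => b (Ψ y)) univ := hΦ.finLin_symm.linear_comp b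
  obtain ⟨K, hK, hshift, hpos, hneg⟩ := exists_height (B := fun y => b (Ψ y)) hB (ρ := Φ e) (by
    intro y hy s hs
    have hyX := hΦ.mapsTo_symm (mem_univ y)
    simp only [hb] at hy
    obtain ⟨h1, h2⟩ := htr (Ψ y) hyX (by linarith) s hs
    have h3 := hΦ.left_inv h1
    rw [h2, hΦ.right_inv (mem_univ y)] at h3
    simp only [h3, map_add, map_smul, hbe, smul_eq_mul]
    ring) (by simp [hΦ.left_inv hx, hbe]) (by simp only [hb]; linarith)
  obtain ⟨H, H', hH, hKH⟩ := exists_coneEquiv_of_same_sign hB hK hpos hneg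
  have hρ : Φ e ≠ 0 := fun h => by
    have h1 := hshift 0 1
    rw [h, smul_zero, add_zero] at h1
    linarith
  obtain ⟨k, hk⟩ := Function.ne_iff.1 hρ
  simp only [Pi.zero_apply] at hk
  obtain ⟨θ, θ', hθ, hl⟩ := coneEquiv_shear hK hshift
    (l := (Φ e k)⁻¹ • (LinearMap.proj k : (Fin m → ℝ) →ₗ[ℝ] ℝ)) (by simp [hk])
  have hm : m - 1 < m := by have := k.2; omega
  set j : Fin m := ⟨m - 1, hm⟩ with hj
  -- After the shear, `(Φ e k)⁻¹` times coordinate `k` is `-K`; this factor turns the coordinate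
  -- into `K`, and a swap moves it to the last place.
  let δ : Fin m → ℝ := fun _ => -(Φ e k)⁻¹
  have hδ : ∀ i, δ i ≠ 0 := fun i => neg_ne_zero.2 (inv_ne_zero hk)
  have hA : ConeEquiv (univ : Set (Fin m → ℝ)) univ _ _ := ConeEquiv.ofLinearEquiv
    ((diagScale δ hδ).trans (LinearEquiv.funCongrLeft ℝ ℝ (Equiv.swap j k))) (by simp)
  let γ : I → ℝ := fun i => if i = x then -a x else a i / C
  have hγ : ∀ i, 0 < γ i := by
    intro i
    simp only [γ]
    split_ifs with h
    · linarith
    · exact div_pos (ha i h) hC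
  have hD := hX.coneEquiv_diagScale hγ
  refine ⟨_, _, (((hD.trans hΦ).trans hH).trans hθ).trans hA, j, by simp [hj]; omega, ?_⟩
  intro c hc
  have h1 := hD.mapsTo hc
  set c' := diagScale γ (fun i => (hγ i).ne') c with hc'
  have h2 : b c' = ∑ i, a i * c i := by
    rw [hb, ← Finset.add_sum_erase _ _ (Finset.mem_univ x), Finset.mul_sum]
    have : ∀ i ∈ Finset.univ.erase x, C * c' i = a i * c i := fun i hi => by
      simp only [hc', diagScale_apply, γ, Finset.ne_of_mem_erase hi, if_false]
      field_simp
    rw [Finset.sum_congr rfl this]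
    simp only [hc', diagScale_apply, γ, if_true]
    ring
  have h3 := hKH (Φ c')
  rw [hΦ.left_inv h1, h2] at h3
  have h4 := hl (H (Φ c'))
  simp only [LinearMap.smul_apply, LinearMap.proj_apply, smul_eq_mul, h3] at h4
  simp only [Function.comp_apply, ← hc', LinearEquiv.trans_apply, LinearEquiv.funCongrLeft_apply,
    LinearMap.funLeft_apply, Equiv.swap_apply_left, diagScale_apply, δ]
  linarith

end OneVertex

/-! ### The boundary of an orthant as a Euclidean space. -/

section OrthantBoundary

/-- The boundary of the nonnegative orthant. -/
def orthantBoundary (n : ℕ) : Set (Fin (n + 1) → ℝ) := {y | (∀ i, 0 ≤ y i) ∧ ∃ i, y i = 0}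

/-- The least coordinate. -/
noncomputable def minCoord {n : ℕ} (y : Fin (n + 1) → ℝ) : ℝ :=
  Finset.univ.inf' Finset.univ_nonempty y

lemma minCoord_le {n : ℕ} (y : Fin (n + 1) → ℝ) (i : Fin (n + 1)) : minCoord y ≤ y i :=
  Finset.inf'_le _ (Finset.mem_univ i)

lemma exists_eq_minCoord {n : ℕ} (y : Fin (n + 1) → ℝ) : ∃ i, minCoord y = y i := by
  obtain ⟨i, -, h⟩ := Finset.exists_mem_eq_inf' Finset.univ_nonempty y
  exact ⟨i, h⟩

lemma minCoord_eq {n : ℕ} {y : Fin (n + 1) → ℝ} {m : ℝ} (h : ∀ i, m ≤ y i) {i : Fin (n + 1)}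
    (hi : y i = m) : minCoord y = m :=
  le_antisymm (hi ▸ minCoord_le y i) (by obtain ⟨j, hj⟩ := exists_eq_minCoord y; rw [hj]; exact h j)

lemma isFinLin_minCoord {n : ℕ} : IsFinLin (minCoord (n := n)) univ := by
  refine ⟨Continuous.continuousOn ?_, range fun i => LinearMap.proj i, finite_range _, fun y _ => ?_⟩
  · exact Continuous.finset_inf'_apply _ fun i _ => continuous_apply i
  · obtain ⟨i, hi⟩ := exists_eq_minCoord y
    exact ⟨_, ⟨i, rfl⟩, hi⟩

lemma isFinLin_apply {m : ℕ} (i : Fin m) (X : Set (Fin m → ℝ)) : IsFinLin (fun y => y i) X :=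
  isFinLin_linear (LinearMap.proj i : (Fin m → ℝ) →ₗ[ℝ] ℝ) X

lemma isFinLin_init {n : ℕ} (X : Set (Fin (n + 1) → ℝ)) :
    IsFinLin (fun y (i : Fin n) => y i.castSucc) X :=
  IsFinLin.pi fun i => isFinLin_apply i.castSucc X

lemma IsFinLin.const_mul {V : Type*} [NormedAddCommGroup V] [NormedSpace ℝ V] {φ : V → ℝ}
    {X : Set V} (h : IsFinLin φ X) (r : ℝ) : IsFinLin (fun x => r * φ x) X :=
  h.linear_comp (r • LinearMap.id)

lemma IsFinLin.apply {V : Type*} [NormedAddCommGroup V] [NormedSpace ℝ V] {n : ℕ}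
    {φ : V → Fin n → ℝ} {X : Set V} (h : IsFinLin φ X) (i : Fin n) : IsFinLin (fun x => φ x i) X :=
  h.linear_comp (LinearMap.proj i)

/-- The boundary of the orthant is piecewise linearly `ℝ^n`, the coordinate sum becoming the
`ℓ¹`-norm. -/
lemma exists_coneEquiv_orthantBoundary (n : ℕ) :
    ∃ (Φ : (Fin (n + 1) → ℝ) → Fin n → ℝ) (Ψ : (Fin n → ℝ) → Fin (n + 1) → ℝ),
      ConeEquiv (orthantBoundary n) univ Φ Ψ ∧
      ∀ y ∈ orthantBoundary n, ∑ i, |Φ y i| = ∑ i, y i := by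
  induction n with
  | zero =>
    have : Subsingleton (Fin (0 + 1)) := inferInstanceAs (Subsingleton (Fin 1))
    refine ⟨fun _ => 0, fun _ => 0, ⟨mapsTo_univ _ _, fun _ _ => ⟨fun _ => le_rfl, 0, rfl⟩, ?_, ?_,
      isFinLin_zero _, isFinLin_zero _⟩, ?_⟩
    · rintro y ⟨-, i, hi⟩
      funext j
      rw [Subsingleton.elim j i, hi]; rfl
    · intro y _
      exact Subsingleton.elim _ _
    · rintro y ⟨-, i, hi⟩
      rw [Subsingleton.elim i 0] at hi
      simp [hi]
  | succ n ih =>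
    obtain ⟨Φ, Ψ, h, hsum⟩ := ih
    -- Subtracting the minimum `μ` of the first `n + 1` coordinates puts them in the smaller orthant
    -- boundary. Since `μ` or the last coordinate vanishes, the sign of `σ` tells which one
    -- survives, and the factor `N = n + 1` makes `|σ|` replace exactly the mass removed.
    set μ : (Fin (n + 2) → ℝ) → ℝ := fun y => minCoord fun i : Fin (n + 1) => y i.castSucc with hμ
    set N : ℝ := ((n + 1 : ℕ) : ℝ) with hN
    have hN0 : 0 < N := by rw [hN]; positivity
    set α : (Fin (n + 2) → ℝ) → Fin (n + 1) → ℝ := fun y i => y i.castSucc - μ y with hα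
    set σ : (Fin (n + 2) → ℝ) → ℝ := fun y => y (Fin.last _) - N * μ y with hσ
    have hμF : IsFinLin μ (orthantBoundary (n + 1)) :=
      isFinLin_minCoord.comp (isFinLin_init _) (mapsTo_univ _ _)
    have hαF : IsFinLin α (orthantBoundary (n + 1)) :=
      IsFinLin.pi fun i => (isFinLin_apply i.castSucc _).sub hμF
    have hσF : IsFinLin σ (orthantBoundary (n + 1)) :=
      (isFinLin_apply (Fin.last _) _).sub (hμF.const_mul N)
    have hαm : MapsTo α (orthantBoundary (n + 1)) (orthantBoundary n) := by
      intro y _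
      obtain ⟨i, hi⟩ := exists_eq_minCoord fun i : Fin (n + 1) => y i.castSucc
      exact ⟨fun i => sub_nonneg.2 (minCoord_le _ i), i, sub_eq_zero.2 hi.symm⟩
    -- either the last coordinate or the minimum of the others vanishes
    have hcase : ∀ y ∈ orthantBoundary (n + 1), (y (Fin.last _) = 0 ∧ 0 ≤ μ y) ∨
        (0 ≤ y (Fin.last _) ∧ μ y = 0) := by
      rintro y ⟨h0, i, hi⟩
      have hμ0 : 0 ≤ μ y := by
        obtain ⟨i, hi⟩ := exists_eq_minCoord fun i : Fin (n + 1) => y i.castSucc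
        simp only [hμ, hi, h0]
      induction i using Fin.lastCases with
      | last => exact Or.inl ⟨hi, hμ0⟩
      | cast i => exact Or.inr ⟨h0 _, minCoord_eq (fun i => h0 _) hi⟩
    refine ⟨fun y => Fin.snoc (Φ (α y)) (σ y),
      fun x => Fin.snoc (fun i => Ψ (fun j => x j.castSucc) i + N⁻¹ * max (-x (Fin.last _)) 0)
        (max (x (Fin.last _)) 0), ⟨mapsTo_univ _ _, ?_, ?_, ?_, ?_, ?_⟩, ?_⟩
    · intro x _
      have hz := h.mapsTo_symm (mem_univ fun j => x j.castSucc)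
      have hr : 0 ≤ N⁻¹ * max (-x (Fin.last _)) 0 :=
        mul_nonneg (inv_pos.2 hN0).le (le_max_right _ _)
      refine ⟨fun i => ?_, ?_⟩
      · induction i using Fin.lastCases with
        | last => simp
        | cast i => simp only [Fin.snoc_castSucc]; exact add_nonneg (hz.1 i) hr
      · rcases le_total 0 (x (Fin.last _)) with hx | hx
        · obtain ⟨i, hi⟩ := hz.2
          refine ⟨i.castSucc, ?_⟩
          simp only [Fin.snoc_castSucc, hi]
          rw [max_eq_right (by linarith)]; simp
        · exact ⟨Fin.last _, by simp [hx]⟩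
    · intro y hy
      have hinv := h.left_inv (hαm hy)
      ext i
      simp only [Fin.snoc_castSucc, Fin.snoc_last]
      induction i using Fin.lastCases with
      | last =>
        simp only [Fin.snoc_last, hσ]
        rcases hcase y hy with ⟨h1, h2⟩ | ⟨h1, h2⟩
        · rw [h1, max_eq_right]
          have := mul_nonneg hN0.le h2
          linarith
        · rw [h2, mul_zero, sub_zero, max_eq_left h1]
      | cast i =>
        rw [Fin.snoc_castSucc, show Ψ (fun j => Φ (α y) j) i = α y i from congrFun hinv i]
        simp only [hα, hσ]
        rcases hcase y hy with ⟨h1, h2⟩ | ⟨h1, h2⟩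
        · have := mul_nonneg hN0.le h2
          rw [h1, max_eq_left (by linarith), zero_sub, neg_neg, inv_mul_cancel_left₀ hN0.ne']
          ring
        · rw [h2, mul_zero, sub_zero, max_eq_right (by linarith)]; ring
    · intro x _
      have hz := h.mapsTo_symm (mem_univ fun j => x j.castSucc)
      have hinv := h.right_inv (mem_univ fun j => x j.castSucc)
      set z := Ψ fun j => x j.castSucc with hzdef
      set y : Fin (n + 2) → ℝ := Fin.snoc (fun i => z i + N⁻¹ * max (-x (Fin.last _)) 0)
        (max (x (Fin.last _)) 0) with hy
      have hμy : μ y = N⁻¹ * max (-x (Fin.last _)) 0 := by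
        obtain ⟨i, hi⟩ := hz.2
        refine minCoord_eq (fun i => ?_) (i := i) ?_
        · simp only [hy, Fin.snoc_castSucc]; linarith [hz.1 i]
        · simp only [hy, Fin.snoc_castSucc, hi, zero_add]
      have hαy : α y = z := by
        funext i
        simp only [hα, hμy]
        simp only [hy, Fin.snoc_castSucc]
        ring
      have hσy : σ y = x (Fin.last _) := by
        simp only [hσ, hμy]
        simp only [hy, Fin.snoc_last]
        rw [mul_inv_cancel_left₀ hN0.ne']
        rcases le_total 0 (x (Fin.last _)) with hx | hx
        · rw [max_eq_left hx, max_eq_right (by linarith)]; ring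
        · rw [max_eq_right hx, max_eq_left (by linarith)]; ring
      change Fin.snoc (Φ (α y)) (σ y) = x
      rw [hαy, hσy, hinv]
      ext i
      induction i using Fin.lastCases with
      | last => simp
      | cast i => simp
    · refine IsFinLin.pi fun i => ?_
      induction i using Fin.lastCases with
      | last => simpa only [Fin.snoc_last] using hσF
      | cast i =>
        simp only [Fin.snoc_castSucc]
        exact (h.finLin.comp hαF hαm).apply i
    · have hlast : IsFinLin (fun x : Fin (n + 1) → ℝ => x (Fin.last n)) univ := isFinLin_apply _ _
      refine IsFinLin.pi fun i => ?_
      induction i using Fin.lastCases with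
      | last =>
        simp only [Fin.snoc_last]
        exact hlast.max (isFinLin_zero _)
      | cast i =>
        simp only [Fin.snoc_castSucc]
        exact ((h.finLin_symm.comp (isFinLin_init univ) (mapsTo_univ _ _)).apply i).add
          ((hlast.neg.max (isFinLin_zero _)).const_mul _)
    · intro y hy
      have h1 := hsum _ (hαm hy)
      rw [Fin.sum_univ_castSucc, Fin.sum_univ_castSucc (f := y)]
      simp only [Fin.snoc_castSucc, Fin.snoc_last]
      rw [h1]
      simp only [hα, hσ, Finset.sum_sub_distrib,
        Finset.sum_const, Finset.card_univ, Fintype.card_fin, nsmul_eq_mul]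
      rw [← hN]
      rcases hcase y hy with ⟨h2, h3⟩ | ⟨h2, h3⟩
      · have := mul_nonneg hN0.le h3
        rw [h2, zero_sub, abs_neg, abs_of_nonneg this]; ring
      · rw [h3, mul_zero, sub_zero, sub_zero, abs_of_nonneg h2]

end OrthantBoundary

/-! ### Cones over polyhedra and over spheres. -/

section ConeOver

variable {E F : Type*} [NormedAddCommGroup E] [NormedSpace ℝ E] [FiniteDimensional ℝ E]
  [NormedAddCommGroup F] [NormedSpace ℝ F] [FiniteDimensional ℝ F]

/-- The cone over `X × {1}` in `E × ℝ`. -/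
def coneOver {E : Type*} [AddCommGroup E] [Module ℝ E] (X : Set E) : Set (E × ℝ) :=
  {p | p = 0 ∨ 0 < p.2 ∧ p.2⁻¹ • p.1 ∈ X}

omit [FiniteDimensional ℝ F] in
-- Homogenisation: an affine piece `A` becomes the linear map `(x, t) ↦ A.linear x + t • A 0`.
lemma isFinLin_coneMap {X : Set E} {φ : E → F} (hφ : ContinuousOn φ X)
    {Λ : Set (E →ᵃ[ℝ] F)} (hΛ : Λ.Finite) (hsel : ∀ x ∈ X, ∃ A ∈ Λ, φ x = A x) :
    IsFinLin (fun p : E × ℝ => p.2 • φ (p.2⁻¹ • p.1)) (coneOver X) := by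
  let lin : (E →ᵃ[ℝ] F) → (E × ℝ) →ₗ[ℝ] F := fun A =>
    A.linear ∘ₗ LinearMap.fst ℝ E ℝ + (LinearMap.toSpanSingleton ℝ F (A 0)) ∘ₗ LinearMap.snd ℝ E ℝ
  have hlin : ∀ A (p : E × ℝ), 0 < p.2 → p.2 • A (p.2⁻¹ • p.1) = lin A p := by
    intro A p hp
    have : A (p.2⁻¹ • p.1) = A.linear (p.2⁻¹ • p.1) + A 0 := by
      simpa using A.map_vadd 0 (p.2⁻¹ • p.1)
    rw [this, map_smul, smul_add, smul_smul, mul_inv_cancel₀ hp.ne', one_smul]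
    simp [lin]
  have hs : ∀ p ∈ coneOver X, ∃ L ∈ insert 0 (lin '' Λ), p.2 • φ (p.2⁻¹ • p.1) = L p := by
    rintro p (rfl | ⟨hp, hpX⟩)
    · exact ⟨0, by simp, by simp⟩
    · obtain ⟨A, hA, hAe⟩ := hsel _ hpX
      exact ⟨lin A, Or.inr ⟨A, hA, rfl⟩, by rw [hAe, hlin A p hp]⟩
  refine ⟨?_, _, (hΛ.image lin).insert 0, hs⟩
  rintro p (rfl | ⟨hp, hpX⟩)
  -- At the apex the rescaling `p.2⁻¹` is singular; continuity holds because all of the finitely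
  -- many selected linear maps are small near `0`.
  · rw [ContinuousWithinAt, Metric.tendsto_nhds]
    intro ε hε
    have : ∀ᶠ q in 𝓝[coneOver X] (0 : E × ℝ), ∀ L ∈ insert 0 (lin '' Λ), dist (L q) 0 < ε := by
      rw [Filter.eventually_all_finite ((hΛ.image lin).insert 0)]
      intro L _
      have hL : Continuous L := L.continuous_of_finiteDimensional
      have := (Metric.tendsto_nhds.1 (hL.tendsto 0)) ε hε
      rw [map_zero] at this
      exact this.filter_mono nhdsWithin_le_nhds
    filter_upwards [this, self_mem_nhdsWithin] with q hq hqX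
    obtain ⟨L, hL, hLe⟩ := hs q hqX
    rw [hLe]
    simpa using hq L hL
  · have hopen : {q : E × ℝ | 0 < q.2} ∈ 𝓝 p :=
      (isOpen_lt continuous_const continuous_snd).mem_nhds hp
    rw [← continuousWithinAt_inter hopen]
    have hc : ContinuousOn (fun p : E × ℝ => p.2⁻¹ • p.1) {q : E × ℝ | 0 < q.2} :=
      (continuous_snd.continuousOn.inv₀ fun q hq => ne_of_gt hq).smul continuous_fst.continuousOn
    refine ContinuousOn.continuousWithinAt ?_ ⟨Or.inr ⟨hp, hpX⟩, hp⟩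
    refine continuous_snd.continuousOn.smul (hφ.comp (hc.mono inter_subset_right) ?_)
    rintro q ⟨hq | hq, hq0⟩
    · rw [hq] at hq0
      simp at hq0
    · exact hq.2

omit [FiniteDimensional ℝ E] [FiniteDimensional ℝ F] in
lemma mapsTo_coneMap {X : Set E} {Y : Set F} {φ : E → F} (h : MapsTo φ X Y) :
    MapsTo (fun p : E × ℝ => (p.2 • φ (p.2⁻¹ • p.1), p.2)) (coneOver X) (coneOver Y) := by
  rintro p (rfl | ⟨hp, hpX⟩)
  · exact Or.inl (by simp)
  · refine Or.inr ⟨hp, ?_⟩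
    simp only [smul_smul, inv_mul_cancel₀ hp.ne', one_smul]
    exact h hpX

omit [FiniteDimensional ℝ E] [FiniteDimensional ℝ F] in
lemma leftInvOn_coneMap {X : Set E} {φ : E → F} {ψ : F → E} (h : LeftInvOn ψ φ X) :
    LeftInvOn (fun p : F × ℝ => (p.2 • ψ (p.2⁻¹ • p.1), p.2))
      (fun p : E × ℝ => (p.2 • φ (p.2⁻¹ • p.1), p.2)) (coneOver X) := by
  rintro p (rfl | ⟨hp, hpX⟩)
  · simp
  · simp only [smul_smul, inv_mul_cancel₀ hp.ne', one_smul, h hpX, mul_inv_cancel₀ hp.ne']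

lemma IsPLHomeo.coneEquiv {X : Set E} {Y : Set F} (hX : IsCompact X) (hY : IsCompact Y)
    {φ : E → F} {ψ : F → E} (h : IsPLHomeo φ ψ X Y) :
    ConeEquiv (coneOver X) (coneOver Y) (fun p => (p.2 • φ (p.2⁻¹ • p.1), p.2))
      (fun p => (p.2 • ψ (p.2⁻¹ • p.1), p.2)) where
  mapsTo := mapsTo_coneMap h.mapsTo
  mapsTo_symm := mapsTo_coneMap h.mapsTo_symm
  left_inv := leftInvOn_coneMap h.invOn.1
  right_inv := leftInvOn_coneMap h.invOn.2
  finLin := by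
    obtain ⟨hc, Λ, hΛ, hs⟩ := h.isPLOn.exists_selection hX
    exact (isFinLin_coneMap hc hΛ hs).prodMk (isFinLin_linear (LinearMap.snd ℝ E ℝ) _)
  finLin_symm := by
    obtain ⟨hc, Λ, hΛ, hs⟩ := h.isPLOn_symm.exists_selection hY
    exact (isFinLin_coneMap hc hΛ hs).prodMk (isFinLin_linear (LinearMap.snd ℝ F ℝ) _)

lemma isCompact_simplexBoundary (n : ℕ) : IsCompact (simplexBoundary n) := by
  have : simplexBoundary n = stdSimplex ℝ (Fin (n + 1)) ∩ ⋃ i, {x | x i = 0} := by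
    ext x; simp [simplexBoundary]
  rw [this]
  exact (isCompact_stdSimplex ℝ _).inter_right
    (isClosed_iUnion_of_finite fun i => isClosed_eq (continuous_apply i) continuous_const)

/-- On this cone the height equals the coordinate sum, so it can be dropped and recovered linearly.
-/
lemma coneEquiv_simplexBoundary (n : ℕ) :
    ConeEquiv (coneOver (simplexBoundary n)) (orthantBoundary n) Prod.fst
      fun y => (y, ∑ i, y i) where
  mapsTo := by
    rintro p (rfl | ⟨hp, hpX, i, hi⟩)
    · exact ⟨fun _ => le_rfl, 0, rfl⟩
    · refine ⟨fun i => ?_, i, ?_⟩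
      · exact nonneg_of_mul_nonneg_right (hpX.1 i) (inv_pos.2 hp)
      · simpa [hp.ne'] using hi
  mapsTo_symm := by
    rintro y ⟨h0, i, hi⟩
    rcases (Finset.sum_nonneg fun i _ => h0 i : 0 ≤ ∑ i, y i).eq_or_lt with h | h
    · left
      have := (Finset.sum_eq_zero_iff_of_nonneg fun i _ => h0 i).1 h.symm
      refine Prod.ext (funext fun i => this i (Finset.mem_univ i)) h.symm
    · refine Or.inr ⟨h, ⟨fun i => ?_, ?_⟩, i, ?_⟩
      · exact mul_nonneg (inv_pos.2 h).le (h0 i)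
      · simp [← Finset.mul_sum, inv_mul_cancel₀ h.ne']
      · simp [hi]
  left_inv := by
    rintro p (rfl | ⟨hp, hpX, i, hi⟩)
    · simp
    · refine Prod.ext rfl ?_
      have := hpX.2
      simp only [Pi.smul_apply, smul_eq_mul, ← Finset.mul_sum] at this
      rwa [inv_mul_eq_one₀ hp.ne', eq_comm] at this
  right_inv := fun _ _ => rfl
  finLin := isFinLin_linear (LinearMap.fst ℝ (Fin (n + 1) → ℝ) ℝ) _
  finLin_symm := (isFinLin_linear LinearMap.id _).prodMk
    (IsFinLin.sum _ fun i _ => isFinLin_apply i _)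

/-- The cone over a PL sphere of dimension `n - 1` is piecewise linearly `ℝ^n`. -/
lemma exists_coneEquiv_of_sphere {X : Set E} (hX : IsCompact X) {n : ℕ}
    (h : PLHomeomorphic X (simplexBoundary n)) :
    ∃ (Φ : E × ℝ → Fin n → ℝ) (Ψ : (Fin n → ℝ) → E × ℝ), ConeEquiv (coneOver X) univ Φ Ψ ∧
      ∀ p ∈ coneOver X, ∑ i, |Φ p i| = p.2 := by
  obtain ⟨φ, ψ, hφ⟩ := h
  obtain ⟨Φ, Ψ, hΦ, hsum⟩ := exists_coneEquiv_orthantBoundary n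
  have h1 := hφ.coneEquiv hX (isCompact_simplexBoundary n)
  have h2 := coneEquiv_simplexBoundary n
  refine ⟨_, _, (h1.trans h2).trans hΦ, fun p hp => ?_⟩
  have h3 := h1.mapsTo hp
  simp only [Function.comp_apply]
  rw [hsum _ (h2.mapsTo h3)]
  exact congrArg Prod.snd (h2.left_inv h3)

end ConeOver

/-! ### Uniqueness of barycentric weights in a simplicial complex. -/

section Barycentric

variable {E : Type*} [AddCommGroup E] [Module ℝ E]

lemma eq_of_affineIndependent {S : Finset E} (hS : AffineIndependent ℝ ((↑) : S → E)) {β γ : E → ℝ}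
    (h1 : ∑ x ∈ S, β x = ∑ x ∈ S, γ x) (h2 : ∑ x ∈ S, β x • x = ∑ x ∈ S, γ x • x) :
    ∀ x ∈ S, β x = γ x := by
  rw [affineIndependent_iff] at hS
  intro x hx
  have := hS Finset.univ (fun x => β x - γ x)
    (by rw [Finset.sum_coe_sort S fun x => β x - γ x, Finset.sum_sub_distrib, h1, sub_self])
    (by
      rw [Finset.sum_coe_sort S fun x => (β x - γ x) • x]
      simp only [sub_smul, Finset.sum_sub_distrib, h2, sub_self]) ⟨x, hx⟩ (Finset.mem_univ _)
  exact sub_eq_zero.1 this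

variable {K : Geometry.SimplicialComplex ℝ E}

/-- The common point lies in the hull of `S ∩ T`; affine independence of `S` and of `T` identifies
both weights with those on the intersection. -/
lemma weights_unique_of_sum_one {S T : Finset E} (hS : S ∈ K.faces) (hT : T ∈ K.faces)
    {β γ : E → ℝ} (hβ : ∀ x, 0 ≤ β x) (hγ : ∀ x, 0 ≤ γ x) (hβS : ∀ x, x ∉ S → β x = 0)
    (hγT : ∀ x, x ∉ T → γ x = 0) (h1 : ∑ x ∈ S, β x = 1) (h1' : ∑ x ∈ T, γ x = 1)
    (h : ∑ x ∈ S, β x • x = ∑ x ∈ T, γ x • x) : β = γ := by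
  classical
  have hz := K.inter_subset_convexHull hS hT
    ⟨Finset.mem_convexHull'.2 ⟨β, fun x _ => hβ x, h1, rfl⟩,
      Finset.mem_convexHull'.2 ⟨γ, fun x _ => hγ x, h1', h.symm⟩⟩
  rw [← Finset.coe_inter, Finset.mem_convexHull'] at hz
  obtain ⟨w, -, hw1, hw⟩ := hz
  set w' : E → ℝ := fun x => if x ∈ S ∩ T then w x else 0 with hw'
  have e1 : ∀ U, S ∩ T ⊆ U → ∑ x ∈ U, w' x = 1 := fun U hU => by
    rw [← hw1, ← Finset.sum_subset hU]
    · exact Finset.sum_congr rfl fun x hx => by simp only [hw', if_pos hx]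
    · intro x _ hx; simp only [hw', if_neg hx]
  have e2 : ∀ U, S ∩ T ⊆ U → ∑ x ∈ U, w' x • x = ∑ x ∈ S, β x • x := fun U hU => by
    rw [← hw, ← Finset.sum_subset hU]
    · exact Finset.sum_congr rfl fun x hx => by simp only [hw', if_pos hx]
    · intro x _ hx; simp only [hw', if_neg hx, zero_smul]
  have hβw := eq_of_affineIndependent (K.indep hS) (β := β) (γ := w')
    (by rw [h1, e1 S Finset.inter_subset_left]) (by rw [e2 S Finset.inter_subset_left])
  have hγw := eq_of_affineIndependent (K.indep hT) (β := γ) (γ := w')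
    (by rw [h1', e1 T Finset.inter_subset_right]) (by rw [e2 T Finset.inter_subset_right, h])
  funext x
  by_cases hx : x ∈ S
  · by_cases hx' : x ∈ T
    · rw [hβw x hx, hγw x hx']
    · rw [hβw x hx, hγT x hx']; simp [hw', hx']
  · by_cases hx' : x ∈ T
    · rw [hγw x hx', hβS x hx]; simp [hw', hx]
    · rw [hβS x hx, hγT x hx']

lemma weights_unique {F S T : Finset E} (hS : S ∈ K.faces) (hT : T ∈ K.faces) (hSF : S ⊆ F)
    (hTF : T ⊆ F) {β γ : E → ℝ} (hβ : ∀ x, 0 ≤ β x) (hγ : ∀ x, 0 ≤ γ x)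
    (hβS : ∀ x, x ∉ S → β x = 0) (hγT : ∀ x, x ∉ T → γ x = 0)
    (h1 : ∑ x ∈ F, β x = ∑ x ∈ F, γ x) (h : ∑ x ∈ F, β x • x = ∑ x ∈ F, γ x • x) : β = γ := by
  have s1 : ∑ x ∈ F, β x = ∑ x ∈ S, β x :=
    (Finset.sum_subset hSF fun x _ hx => hβS x hx).symm
  have s2 : ∑ x ∈ F, γ x = ∑ x ∈ T, γ x :=
    (Finset.sum_subset hTF fun x _ hx => hγT x hx).symm
  have s3 : ∑ x ∈ F, β x • x = ∑ x ∈ S, β x • x :=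
    (Finset.sum_subset hSF fun x _ hx => by rw [hβS x hx, zero_smul]).symm
  have s4 : ∑ x ∈ F, γ x • x = ∑ x ∈ T, γ x • x :=
    (Finset.sum_subset hTF fun x _ hx => by rw [hγT x hx, zero_smul]).symm
  rw [s1, s2] at h1
  rw [s3, s4] at h
  rcases (Finset.sum_nonneg fun x _ => hβ x : 0 ≤ ∑ x ∈ S, β x).eq_or_lt with h0 | h0
  · have z1 := (Finset.sum_eq_zero_iff_of_nonneg fun x _ => hβ x).1 h0.symm
    have z2 := (Finset.sum_eq_zero_iff_of_nonneg fun x _ => hγ x).1 (h1 ▸ h0.symm)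
    funext x
    have e1 : β x = 0 := by
      by_cases hx : x ∈ S
      · exact z1 x hx
      · exact hβS x hx
    have e2 : γ x = 0 := by
      by_cases hx : x ∈ T
      · exact z2 x hx
      · exact hγT x hx
    rw [e1, e2]
  · set t := ∑ x ∈ S, β x
    have ht := inv_pos.2 h0
    have := weights_unique_of_sum_one hS hT (β := fun x => t⁻¹ * β x) (γ := fun x => t⁻¹ * γ x)
      (fun x => mul_nonneg ht.le (hβ x)) (fun x => mul_nonneg ht.le (hγ x))
      (fun x hx => by rw [hβS x hx, mul_zero]) (fun x hx => by rw [hγT x hx, mul_zero])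
      (by rw [← Finset.mul_sum, inv_mul_cancel₀ h0.ne'])
      (by rw [← Finset.mul_sum, ← h1, inv_mul_cancel₀ h0.ne'])
      (by simp only [mul_smul, ← Finset.smul_sum, h])
    funext x
    exact mul_left_cancel₀ ht.ne' (congrFun this x)

lemma InOpenSimplex.mem_convexHull {S : Finset E} {p : E} (h : InOpenSimplex S p) :
    p ∈ convexHull ℝ (S : Set E) := by
  obtain ⟨w, h0, h1, rfl⟩ := h
  exact Finset.mem_convexHull'.2 ⟨w, fun x hx => (h0 x hx).le, h1, rfl⟩

end Barycentric

/-! ### The derived subdivision in chain coordinates. -/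

section Derived

variable {E : Type*} [NormedAddCommGroup E] [NormedSpace ℝ E] [FiniteDimensional ℝ E]
  {K : Geometry.SimplicialComplex ℝ E} [Fintype K.faces]

/-- The realization of the cone over the order complex of `K` with vertices `v S`. -/
noncomputable def realize (K : Geometry.SimplicialComplex ℝ E) [Fintype K.faces]
    (v : Finset E → E) : (K.faces → ℝ) →ₗ[ℝ] E × ℝ :=
  Fintype.linearCombination ℝ fun S => (v S.1, (1 : ℝ))

/-- The chains of simplices of `K`, in barycentric coordinates. -/
abbrev faceChains (K : Geometry.SimplicialComplex ℝ E) : Set (K.faces → ℝ) :=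
  chainCone fun S : K.faces => S.1

omit [FiniteDimensional ℝ E] in
lemma realize_apply (v : Finset E → E) (c : K.faces → ℝ) :
    realize K v c = (∑ S, c S • v S.1, ∑ S, c S) := by
  simp [realize, Fintype.linearCombination_apply, Prod.ext_iff, Prod.fst_sum, Prod.snd_sum]

omit [FiniteDimensional ℝ E] in
-- Here `p S` is the vector of barycentric coordinates of `v S`, whose support is exactly `S`. In
-- this form the results on `chainCone` apply to `realize`.
lemma exists_weights {v : Finset E → E} (hv : ∀ S ∈ K.faces, InOpenSimplex S (v S)) :
    ∃ (F : Finset E) (p : K.faces → E → ℝ), (∀ S : K.faces, S.1 ⊆ F) ∧ (∀ S x, 0 ≤ p S x) ∧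
      (∀ (S : K.faces) x, 0 < p S x ↔ x ∈ S.1) ∧
      ∀ c : K.faces → ℝ, realize K v c =
        (∑ x ∈ F, (∑ S, c S * p S x) • x, ∑ x ∈ F, ∑ S, c S * p S x) := by
  classical
  choose w hw0 hw1 hw using fun S : K.faces => hv S.1 S.2
  set F : Finset E := Finset.univ.biUnion fun S : K.faces => S.1
  have hF : ∀ S : K.faces, S.1 ⊆ F := fun S x hx => Finset.mem_biUnion.2 ⟨S, Finset.mem_univ _, hx⟩
  set p : K.faces → E → ℝ := fun S x => if x ∈ S.1 then w S x else 0 with hp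
  have e1 : ∀ S : K.faces, ∑ x ∈ F, p S x = 1 := fun S => by
    rw [← hw1 S, ← Finset.sum_subset (hF S)]
    · exact Finset.sum_congr rfl fun x hx => by simp only [hp, if_pos hx]
    · intro x _ hx; simp only [hp, if_neg hx]
  have e2 : ∀ S : K.faces, ∑ x ∈ F, p S x • x = v S.1 := fun S => by
    rw [← hw S, ← Finset.sum_subset (hF S)]
    · exact Finset.sum_congr rfl fun x hx => by simp only [hp, if_pos hx]
    · intro x _ hx; simp only [hp, if_neg hx, zero_smul]
  refine ⟨F, p, hF, fun S x => ?_, fun S x => ?_, fun c => ?_⟩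
  · simp only [hp]
    split_ifs with h
    · exact (hw0 S x h).le
    · exact le_rfl
  · simp only [hp]
    split_ifs with h
    · exact ⟨fun _ => h, fun _ => hw0 S x h⟩
    · simp [h]
  · rw [realize_apply]
    simp only [Finset.sum_smul]
    rw [Finset.sum_comm (s := F), Finset.sum_comm (s := F)]
    simp only [mul_smul, ← Finset.smul_sum, e2, ← Finset.mul_sum, e1, mul_one]

omit [FiniteDimensional ℝ E] in
-- The point determines the vertex weights by `weights_unique`, and these determine the chain
-- weights by `chainCone_unique`.
lemma injOn_realize {v : Finset E → E} (hv : ∀ S ∈ K.faces, InOpenSimplex S (v S)) :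
    InjOn (realize K v) (faceChains K) := by
  obtain ⟨F, p, hF, hp0, hps, hΓ⟩ := exists_weights hv
  intro c hc c' hc' h
  rcases isEmpty_or_nonempty K.faces with hem | ⟨⟨S₀⟩⟩
  · exact Subsingleton.elim _ _
  have hsupp : ∀ c ∈ faceChains K, ∃ S ∈ K.faces, ∀ x, x ∉ S → ∑ T, c T * p T x = 0 := by
    intro c hc
    by_cases h0 : c = 0
    · exact ⟨S₀.1, S₀.2, by simp [h0]⟩
    · obtain ⟨S, hS, htop⟩ := exists_top hc h0
      refine ⟨S.1, S.2, fun x hx => ?_⟩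
      have h1 := mt (sum_pos_iff_mem_top hp0 hps hc.1 hS htop x).1 hx
      exact le_antisymm (not_lt.1 h1)
        (Finset.sum_nonneg fun T _ => mul_nonneg (hc.1 T) (hp0 T x))
  obtain ⟨S, hS, hS0⟩ := hsupp c hc
  obtain ⟨T, hT, hT0⟩ := hsupp c' hc'
  rw [hΓ, hΓ, Prod.mk.injEq] at h
  have := weights_unique hS hT (hF ⟨S, hS⟩) (hF ⟨T, hT⟩)
    (fun x => Finset.sum_nonneg fun T _ => mul_nonneg (hc.1 T) (hp0 T x))
    (fun x => Finset.sum_nonneg fun T _ => mul_nonneg (hc'.1 T) (hp0 T x)) hS0 hT0 h.2 h.1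
  exact chainCone_unique Subtype.val_injective (fun S => K.nonempty_of_mem_faces S.2) hp0 hps
    hc hc' fun x => congrFun this x

omit [FiniteDimensional ℝ E] in
-- A chain is realised inside its top simplex by convexity; conversely, peeling the barycentric
-- weights of a point produces a chain.
lemma image_realize {v : Finset E → E} (hv : ∀ S ∈ K.faces, InOpenSimplex S (v S)) :
    realize K v '' faceChains K = coneOver K.space := by
  classical
  obtain ⟨F, p, hF, hp0, hps, hΓ⟩ := exists_weights hv
  apply Subset.antisymm
  · rintro _ ⟨c, hc, rfl⟩
    by_cases h0 : c = 0
    · left; simp [h0]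
    · obtain ⟨S, hS, htop⟩ := exists_top hc h0
      have ht : 0 < ∑ T, c T := Finset.sum_pos' (fun T _ => hc.1 T) ⟨S, Finset.mem_univ _, hS⟩
      rw [realize_apply]
      refine Or.inr ⟨ht, ?_⟩
      rw [Geometry.SimplicialComplex.mem_space_iff]
      refine ⟨S.1, S.2, ?_⟩
      simp only [Finset.smul_sum, smul_smul]
      rw [← Finset.sum_filter_of_ne (p := fun T => 0 < c T)]
      · refine (convex_convexHull ℝ _).sum_mem
          (fun T _ => mul_nonneg (inv_pos.2 ht).le (hc.1 T)) ?_ fun T hT => ?_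
        · rw [← Finset.mul_sum, Finset.sum_filter_of_ne, inv_mul_cancel₀ ht.ne']
          exact fun T _ h => lt_of_le_of_ne (hc.1 T) h.symm
        · exact convexHull_mono (Finset.coe_subset.2 (htop T (Finset.mem_filter.1 hT).2))
            (hv T.1 T.2).mem_convexHull
      · intro T _ h
        refine lt_of_le_of_ne (hc.1 T) fun h' => h ?_
        rw [← h', mul_zero, zero_smul]
  · rintro q (rfl | ⟨hq, hqK⟩)
    · exact ⟨0, ⟨fun _ => le_rfl, fun i j h => absurd h (lt_irrefl _)⟩, by simp⟩
    · obtain ⟨S, hS, hqS⟩ := Geometry.SimplicialComplex.mem_space_iff.1 hqK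
      obtain ⟨w, hw0, hw1, hw⟩ := Finset.mem_convexHull'.1 hqS
      obtain ⟨c, hc, -, hcβ⟩ := chainCone_exists (s := fun S : K.faces => S.1) (p := p)
        (B := {β | (∀ x, 0 ≤ β x) ∧ ∃ S ∈ K.faces, ∀ x, x ∉ S → β x = 0})
        (β := fun x => if x ∈ S then q.2 * w x else 0) hps hp0 (fun β hβ => hβ.1) (by
          rintro β ⟨hβ0, S, hS, hβS⟩ hne
          obtain ⟨x, hx⟩ := Function.ne_iff.1 hne
          have hpos : ∀ x, 0 < β x ↔ x ∈ S.filter fun x => 0 < β x := fun x => by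
            simp only [Finset.mem_filter]
            exact ⟨fun h => ⟨by_contra fun h' => h.ne' (hβS x h'), h⟩, fun h => h.2⟩
          have hxp : 0 < β x := lt_of_le_of_ne (hβ0 x) (Ne.symm hx)
          have hface : S.filter (fun x => 0 < β x) ∈ K.faces :=
            K.down_closed hS (Finset.filter_subset _ _) ⟨x, (hpos x).1 hxp⟩
          refine ⟨⟨_, hface⟩, hpos, fun t ht hnn => ⟨hnn, S, hS, fun x hx => ?_⟩⟩
          have h1 : p ⟨_, hface⟩ x = 0 := le_antisymm (not_lt.1 fun h =>
            hx (Finset.mem_filter.1 ((hps _ x).1 h)).1) (hp0 _ x)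
          change β x - t * p _ x = 0
          rw [h1, hβS x hx]; ring)
        ⟨fun x => by
          dsimp only
          split_ifs with h
          · exact mul_nonneg hq.le (hw0 x h)
          · exact le_rfl, S, hS, fun x hx => if_neg hx⟩
      refine ⟨c, hc, ?_⟩
      rw [hΓ]
      simp only [← hcβ]
      have hSF := hF ⟨S, hS⟩
      refine Prod.ext ?_ ?_
      · dsimp only
        rw [← Finset.sum_subset hSF (fun x _ hx => by rw [if_neg hx, zero_smul])]
        rw [Finset.sum_congr rfl fun x hx => by rw [if_pos hx, mul_smul], ← Finset.smul_sum, hw,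
          smul_smul, mul_inv_cancel₀ hq.ne', one_smul]
      · dsimp only
        rw [← Finset.sum_subset hSF (fun x _ hx => by rw [if_neg hx])]
        rw [Finset.sum_congr rfl fun x hx => by rw [if_pos hx], ← Finset.mul_sum, hw1, mul_one]

/-- The derived subdivision: the cone over `K` is the cone over its order complex. -/
lemma exists_coneEquiv_realize {v : Finset E → E} (hv : ∀ S ∈ K.faces, InOpenSimplex S (v S)) :
    ∃ ψ, ConeEquiv (faceChains K) (coneOver K.space) (realize K v) ψ := by
  rw [← image_realize hv]
  exact (isOrthantComplex_chainCone _).exists_coneEquiv _ (injOn_realize hv)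

/-- The affine map `z ↦ m (z, 1)`. -/
noncomputable def affSlice {W : Type*} [AddCommGroup W] [Module ℝ W] (m : E × ℝ →ₗ[ℝ] W) :
    E →ᵃ[ℝ] W :=
  (m ∘ₗ LinearMap.inl ℝ E ℝ).toAffineMap + AffineMap.const ℝ E (m (0, 1))

omit [FiniteDimensional ℝ E] in
lemma affSlice_apply {W : Type*} [AddCommGroup W] [Module ℝ W] (m : E × ℝ →ₗ[ℝ] W) (z : E) :
    affSlice m z = m (z, 1) := by
  simp [affSlice, ← map_add]

omit [NormedSpace ℝ E] [FiniteDimensional ℝ E] in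
lemma mem_coneOver_one [Module ℝ E] {X : Set E} {z : E} : (z, (1 : ℝ)) ∈ coneOver X ↔ z ∈ X := by
  simp [coneOver]

variable {v : Finset E → E}

omit [FiniteDimensional ℝ E] in
open scoped Classical in
omit [Fintype K.faces] in
lemma mem_faceChains_of_chain {C : Finset (Finset E)}
    (hch : IsChain (· ⊆ ·) (C : Set (Finset E))) {c : K.faces → ℝ} (h0 : ∀ S, 0 ≤ c S)
    (hcC : ∀ S : K.faces, S.1 ∉ C → c S = 0) : c ∈ faceChains K := by
  refine ⟨h0, fun S T hS hT => ?_⟩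
  have hSC : S.1 ∈ C := by_contra fun h => hS.ne' (hcC S h)
  have hTC : T.1 ∈ C := by_contra fun h => hT.ne' (hcC T h)
  exact hch.total hSC hTC

omit [FiniteDimensional ℝ E] in
open scoped Classical in
lemma single_mem_faceChains (S : K.faces) : (Pi.single S 1 : K.faces → ℝ) ∈ faceChains K := by
  refine mem_faceChains_of_chain (C := {S.1}) (by simp) (fun T => ?_) fun T hT => ?_
  · by_cases h : T = S
    · subst h; simp
    · simp [h]
  · have : T ≠ S := fun h => by subst h; simp at hT
    simp [this]

omit [FiniteDimensional ℝ E] in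
open scoped Classical in
lemma realize_single (S : K.faces) : realize K v (Pi.single S 1) = (v S.1, 1) := by
  rw [realize_apply]
  simp [Pi.single_apply]

omit [FiniteDimensional ℝ E] in
lemma injOn_of_inOpenSimplex (hv : ∀ S ∈ K.faces, InOpenSimplex S (v S)) : InjOn v K.faces := by
  classical
  intro S hS T hT h
  have := injOn_realize hv (single_mem_faceChains ⟨S, hS⟩) (single_mem_faceChains ⟨T, hT⟩)
    (by rw [realize_single, realize_single, h])
  by_contra hne
  have h1 := congrFun this ⟨S, hS⟩
  rw [Pi.single_eq_same, Pi.single_eq_of_ne (fun h => hne (congrArg Subtype.val h))] at h1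
  exact one_ne_zero h1

omit [FiniteDimensional ℝ E] in
open scoped Classical in
-- Simplices of the subdivision are slices at height one of realised orthants, so facts about how
-- they meet reduce to injectivity of `realize`.
lemma mem_convexHull_image_iff (hv : ∀ S ∈ K.faces, InOpenSimplex S (v S))
    {C : Finset (Finset E)} (hC : (C : Set (Finset E)) ⊆ K.faces) {z : E} :
    z ∈ convexHull ℝ ((C.image v : Finset E) : Set E) ↔ ∃ c : K.faces → ℝ, (∀ S, 0 ≤ c S) ∧
      (∀ S : K.faces, S.1 ∉ C → c S = 0) ∧ realize K v c = (z, 1) := by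
  have hinj : InjOn v C := (injOn_of_inOpenSimplex hv).mono hC
  have hsum : ∀ f : Finset E → ℝ,
      ∑ S : K.faces, (if S.1 ∈ C then f S.1 else 0) = ∑ S ∈ C, f S := by
    intro f
    rw [← Finset.sum_filter]
    refine Finset.sum_bij (fun S _ => S.1) (fun S hS => (Finset.mem_filter.1 hS).2)
      (fun S _ T _ h => Subtype.ext h) (fun S hS => ⟨⟨S, hC hS⟩, by simpa using hS, rfl⟩)
      fun _ _ => rfl
  rw [Finset.mem_convexHull']
  constructor
  · rintro ⟨w, hw0, hw1, hw⟩
    rw [Finset.sum_image hinj] at hw1 hw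
    refine ⟨fun S => if S.1 ∈ C then w (v S.1) else 0, fun S => ?_, fun S hS => if_neg hS, ?_⟩
    · dsimp only
      split_ifs with h
      · exact hw0 _ (Finset.mem_image_of_mem v h)
      · exact le_rfl
    · rw [realize_apply, hsum fun S => w (v S), hw1]
      simp only [ite_smul, zero_smul]
      rw [Finset.sum_congr rfl fun (S : K.faces) _ => rfl, ← hw]
      congr 1
      rw [← Finset.sum_filter]
      refine Finset.sum_bij (fun S _ => S.1) (fun S hS => (Finset.mem_filter.1 hS).2)
        (fun S _ T _ h => Subtype.ext h) (fun S hS => ⟨⟨S, hC hS⟩, by simpa using hS, rfl⟩)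
        fun _ _ => rfl
  · rintro ⟨c, h0, hcC, hc⟩
    rw [realize_apply, Prod.mk.injEq] at hc
    obtain ⟨w, hw⟩ : ∃ w : E → ℝ, ∀ S : K.faces, w (v S.1) = c S := by
      refine ⟨fun x => if h : ∃ S : K.faces, v S.1 = x then c h.choose else 0, fun S => ?_⟩
      have h : ∃ T : K.faces, v T.1 = v S.1 := ⟨S, rfl⟩
      simp only [dif_pos h]
      congr 1
      exact Subtype.ext (injOn_of_inOpenSimplex hv h.choose.2 S.2 h.choose_spec)
    have key : ∀ S ∈ C, ∃ S' : K.faces, S'.1 = S := fun S hS => ⟨⟨S, hC hS⟩, rfl⟩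
    refine ⟨w, fun x hx => ?_, ?_, ?_⟩
    · obtain ⟨S, hS, rfl⟩ := Finset.mem_image.1 hx
      obtain ⟨S, rfl⟩ := key S hS
      rw [hw]; exact h0 S
    · rw [Finset.sum_image hinj, ← hsum fun S => w (v S), ← hc.2]
      refine Finset.sum_congr rfl fun S _ => ?_
      split_ifs with h
      · exact hw S
      · exact (hcC S h).symm
    · rw [Finset.sum_image hinj, ← hc.1]
      symm
      rw [← Finset.sum_filter_of_ne (p := fun S : K.faces => S.1 ∈ C)]
      · refine Finset.sum_bij (fun S _ => S.1) (fun S hS => (Finset.mem_filter.1 hS).2)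
          (fun S _ T _ h => Subtype.ext h) (fun S hS => ⟨⟨S, hC hS⟩, by simpa using hS, rfl⟩)
          fun S _ => by rw [hw]
      · intro S _ h
        by_contra h'
        exact h (by rw [hcC S h', zero_smul])

omit [FiniteDimensional ℝ E] in
open scoped Classical in
lemma exists_functional_of_chain (hv : ∀ S ∈ K.faces, InOpenSimplex S (v S))
    {C : Finset (Finset E)} (hch : IsChain (· ⊆ ·) (C : Set (Finset E))) :
    ∃ L : E × ℝ →ₗ[ℝ] K.faces → ℝ, ∀ c : K.faces → ℝ, (∀ S : K.faces, S.1 ∉ C → c S = 0) →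
      L (realize K v c) = c := by
  obtain ⟨L, hL⟩ := (isOrthantComplex_chainCone fun S : K.faces => S.1).exists_leftInverse
    (realize K v) (injOn_realize hv) (a := fun S => if S.1 ∈ C then 1 else 0)
    (mem_faceChains_of_chain hch (fun S => by split_ifs <;> norm_num) fun S hS => if_neg hS)
  exact ⟨L, fun c hc => hL c fun S hS => hc S (by simpa using hS)⟩

open scoped Classical in
/-- The derived subdivision. -/
noncomputable def derived (hv : ∀ S ∈ K.faces, InOpenSimplex S (v S)) :
    Geometry.SimplicialComplex ℝ E where
  faces := {s | ∃ C : Finset (Finset E), C.Nonempty ∧ (C : Set (Finset E)) ⊆ K.faces ∧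
    IsChain (· ⊆ ·) (C : Set (Finset E)) ∧ s = C.image v}
  isRelLowerSet_faces := by
    rintro _ ⟨C, hne, hC, hch, rfl⟩
    refine ⟨hne.image v, fun t ht htne => ?_⟩
    have hsub : (C.filter fun S => v S ∈ t) ⊆ C := Finset.filter_subset _ _
    have himg : t = (C.filter fun S => v S ∈ t).image v := by
      ext x
      simp only [Finset.mem_image, Finset.mem_filter]
      constructor
      · intro hx
        obtain ⟨S, hS, rfl⟩ := Finset.mem_image.1 (ht hx)
        exact ⟨S, ⟨hS, hx⟩, rfl⟩
      · rintro ⟨S, ⟨-, hS⟩, rfl⟩; exact hS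
    refine ⟨C.filter fun S => v S ∈ t, ?_, (Finset.coe_subset.2 hsub).trans hC,
      hch.mono (Finset.coe_subset.2 hsub), himg⟩
    rw [himg] at htne
    exact Finset.image_nonempty.1 htne
  indep := by
    rintro _ ⟨C, hne, hC, hch, rfl⟩
    obtain ⟨L, hL⟩ := exists_functional_of_chain hv hch
    rw [affineIndependent_iff]
    intro s w h1 h2 x hx
    obtain ⟨S₀, hS₀, hxS⟩ := Finset.mem_image.1 x.2
    -- the values of the coordinates on the vertices
    have hcoord : ∀ y : (C.image v : Finset E), L (y.1, 1) ⟨S₀, hC hS₀⟩ = if y = x then 1 else 0 := by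
      intro y
      obtain ⟨T, hT, hyT⟩ := Finset.mem_image.1 y.2
      rw [← hyT, ← realize_single (K := K) ⟨T, hC hT⟩, hL]
      · rw [Pi.single_apply]
        by_cases h : T = S₀
        · subst h
          have : y = x := Subtype.ext (hyT.symm.trans hxS)
          simp [this]
        · have : y ≠ x := fun h' => h (injOn_of_inOpenSimplex hv (hC hT) (hC hS₀)
            (by rw [hyT, hxS, h']))
          rw [if_neg this, if_neg fun h' => h (congrArg Subtype.val h').symm]
      · intro S hS
        exact Pi.single_eq_of_ne (fun h => hS (by rw [h]; exact hT)) _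
    have h3 : ∑ y ∈ s, w y • ((y.1, 1) : E × ℝ) = 0 := by
      refine Prod.ext ?_ ?_
      · simpa [Prod.fst_sum] using h2
      · simpa [Prod.snd_sum] using h1
    have h4 := congrArg (fun q => L q ⟨S₀, hC hS₀⟩) h3
    simp only [map_sum, map_smul, Finset.sum_apply, Pi.smul_apply, hcoord, map_zero,
      Pi.zero_apply, smul_eq_mul, mul_ite, mul_one, mul_zero, Finset.sum_ite_eq', hx,
      if_true] at h4
    exact h4
  inter_subset_convexHull := by
    rintro _ _ ⟨C, -, hC, hch, rfl⟩ ⟨D, -, hD, hdh, rfl⟩ z ⟨hz, hz'⟩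
    obtain ⟨c, h0, hcC, hc⟩ := (mem_convexHull_image_iff hv hC).1 hz
    obtain ⟨c', h0', hcC', hc'⟩ := (mem_convexHull_image_iff hv hD).1 hz'
    -- A common point has only one vector of chain weights, which is therefore supported in `C ∩ D`.
    have := injOn_realize hv (mem_faceChains_of_chain hch h0 hcC)
      (mem_faceChains_of_chain hdh h0' hcC') (hc.trans hc'.symm)
    subst this
    have hz2 := (mem_convexHull_image_iff hv (C := C ∩ D)
      (by rw [Finset.coe_inter]; exact inter_subset_left.trans hC) (z := z)).2
      ⟨c, h0, fun S hS => by
        rw [Finset.mem_inter, not_and_or] at hS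
        exact hS.elim (hcC S) (hcC' S), hc⟩
    refine convexHull_mono ?_ hz2
    rw [← Finset.coe_inter]
    exact Finset.coe_subset.2 (Finset.image_inter_subset _ _ _)

open scoped Classical in
omit [FiniteDimensional ℝ E] in
lemma isDerivedSubdivision_derived (hv : ∀ S ∈ K.faces, InOpenSimplex S (v S)) :
    IsDerivedSubdivision K v (derived hv) where
  interior := hv
  faces_eq := rfl
  isSubdivision := by
    refine ⟨?_, ?_⟩
    · ext z
      rw [Geometry.SimplicialComplex.mem_space_iff, ← mem_coneOver_one (X := K.space),
        ← image_realize hv]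
      constructor
      · rintro ⟨_, ⟨C, -, hC, hch, rfl⟩, hz⟩
        obtain ⟨c, h0, hcC, hc⟩ := (mem_convexHull_image_iff hv hC).1 hz
        exact ⟨c, mem_faceChains_of_chain hch h0 hcC, hc⟩
      · rintro ⟨c, hc, hcz⟩
        set C : Finset (Finset E) := (Finset.univ.filter fun S : K.faces => 0 < c S).image Subtype.val
        have hmem : ∀ S : K.faces, S.1 ∈ C ↔ 0 < c S := by
          intro S
          simp [C]
        have hC : (C : Set (Finset E)) ⊆ K.faces := by
          intro S hS
          obtain ⟨T, -, rfl⟩ := Finset.mem_image.1 hS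
          exact T.2
        refine ⟨C.image v, ⟨C, ?_, hC, ?_, rfl⟩, (mem_convexHull_image_iff hv hC).2
          ⟨c, hc.1, fun S hS => ?_, hcz⟩⟩
        · by_contra hem
          rw [Finset.not_nonempty_iff_eq_empty] at hem
          have : c = 0 := funext fun S => le_antisymm
            (not_lt.1 fun h => by simpa [hem] using (hmem S).2 h) (hc.1 S)
          rw [this, map_zero, Prod.ext_iff] at hcz
          exact zero_ne_one hcz.2
        · intro S hS T hT _
          exact hc.2 ⟨S, hC hS⟩ ⟨T, hC hT⟩ ((hmem ⟨S, hC hS⟩).1 hS) ((hmem ⟨T, hC hT⟩).1 hT)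
        · exact le_antisymm (not_lt.1 fun h => hS ((hmem S).2 h)) (hc.1 S)
    · rintro _ ⟨C, hne, hC, hch, rfl⟩
      obtain ⟨S, hS, hmax⟩ := C.exists_max_image Finset.card hne
      refine ⟨S, hC hS, convexHull_min ?_ (convex_convexHull ℝ _)⟩
      intro x hx
      obtain ⟨T, hT, rfl⟩ := Finset.mem_image.1 (Finset.mem_coe.1 hx)
      have hTS : T ⊆ S := by
        rcases hch.total hT hS with h | h
        · exact h
        · exact (Finset.eq_of_subset_of_card_le h (hmax T hT)).ge
      exact convexHull_mono (Finset.coe_subset.2 hTS) (hv T (hC hT)).mem_convexHull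

omit [FiniteDimensional ℝ E] in
lemma bijOn_derived_vertices (hv : ∀ S ∈ K.faces, InOpenSimplex S (v S)) :
    BijOn v K.faces (derived hv).vertices := by
  classical
  refine ⟨fun S hS => ?_, injOn_of_inOpenSimplex hv, ?_⟩
  · exact ⟨{S}, by simp, by simpa using hS, by simp, by simp⟩
  · rintro x ⟨C, ⟨S, hS⟩, hC, -, hx⟩
    have : v S ∈ ({x} : Finset E) := by
      rw [hx]; exact Finset.mem_image_of_mem v hS
    exact ⟨S, hC hS, by simpa using this⟩

end Derived

/-! ### From homogeneous maps to their slices at height one. -/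

section Slices

variable {E W : Type*} [NormedAddCommGroup E] [NormedSpace ℝ E] [FiniteDimensional ℝ E]
  [NormedAddCommGroup W] [NormedSpace ℝ W] [FiniteDimensional ℝ W]

lemma IsFinLin.isPLOn_slice {χ : E × ℝ → W} {D : Set (E × ℝ)} (hχ : IsFinLin χ D) {U : Set E}
    (hU : IsLocallyPolyhedral U) (hUD : ∀ z ∈ U, (z, (1 : ℝ)) ∈ D) :
    IsPLOn (fun z => χ (z, 1)) U := by
  obtain ⟨hc, Λ, hΛ, hs⟩ := hχ
  refine isPLOn_of_selection hU (hc.comp (by fun_prop) hUD) (hΛ.image affSlice) fun z hz => ?_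
  obtain ⟨L, hL, h⟩ := hs _ (hUD z hz)
  exact ⟨_, ⟨L, hL, rfl⟩, by rw [affSlice_apply, h]⟩

lemma IsFinLin.isPLOn_const_add {χ : E → W} {V : Set E} (hχ : IsFinLin χ V)
    (hV : IsLocallyPolyhedral V) (w : W) : IsPLOn (fun y => w + χ y) V := by
  obtain ⟨hc, Λ, hΛ, hs⟩ := hχ
  refine isPLOn_of_selection hV (continuousOn_const.add hc)
    (hΛ.image fun L => AffineMap.const ℝ E w + L.toAffineMap) fun z hz => ?_
  obtain ⟨L, hL, h⟩ := hs _ hz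
  exact ⟨_, ⟨L, hL, rfl⟩, by simp [h]⟩

end Slices

/-! ### The star of a vertex and its charts. -/

section Star

variable {E : Type*} [NormedAddCommGroup E] [NormedSpace ℝ E]
  {K : Geometry.SimplicialComplex ℝ E}

/-- The proper faces of `S`. -/
abbrev Below (S : K.faces) : Type _ := {T : K.faces // T.1 ⊂ S.1}

/-- The proper cofaces of `S`. -/
abbrev Above (S : K.faces) : Type _ := {T : K.faces // S.1 ⊂ T.1}

/-- Chains of proper faces of `S`. -/
abbrev belowChains (S : K.faces) : Set (Below S → ℝ) := chainCone fun T : Below S => T.1.1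

/-- Chains of proper cofaces of `S`. -/
abbrev aboveChains (S : K.faces) : Set (Above S → ℝ) := chainCone fun T : Above S => T.1.1

/-- Restriction of chains to the proper faces and cofaces of `S`. -/
def starRestrict (S : K.faces) : (K.faces → ℝ) →ₗ[ℝ] (Below S → ℝ) × (Above S → ℝ) :=
  (LinearMap.funLeft ℝ ℝ Subtype.val).prod (LinearMap.funLeft ℝ ℝ Subtype.val)

open scoped Classical in
/-- Extension by zero of chains of proper faces and cofaces of `S`. -/
noncomputable def starExtend (S : K.faces) :
    (Below S → ℝ) × (Above S → ℝ) →ₗ[ℝ] K.faces → ℝ :=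
  LinearMap.pi fun T => if h : T.1 ⊂ S.1 then LinearMap.proj ⟨T, h⟩ ∘ₗ LinearMap.fst ℝ _ _ else
    if h : S.1 ⊂ T.1 then LinearMap.proj ⟨T, h⟩ ∘ₗ LinearMap.snd ℝ _ _ else 0

variable {S : K.faces}

lemma starExtend_below (p : (Below S → ℝ) × (Above S → ℝ)) (T : Below S) :
    starExtend S p T.1 = p.1 T := by
  simp [starExtend, T.2]

lemma starExtend_above (p : (Below S → ℝ) × (Above S → ℝ)) (T : Above S) :
    starExtend S p T.1 = p.2 T := by
  have h : ¬ T.1.1 ⊂ S.1 := fun h => (T.2.trans h).ne rfl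
  simp [starExtend, T.2, h]

lemma starExtend_of_not (p : (Below S → ℝ) × (Above S → ℝ)) {T : K.faces} (h1 : ¬ T.1 ⊂ S.1)
    (h2 : ¬ S.1 ⊂ T.1) : starExtend S p T = 0 := by
  simp [starExtend, h1, h2]

variable [Fintype K.faces]

noncomputable instance : Fintype (Below S) := Fintype.ofFinite _

noncomputable instance : Fintype (Above S) := Fintype.ofFinite _

lemma sum_starExtend (p : (Below S → ℝ) × (Above S → ℝ)) (a : K.faces → ℝ) :
    ∑ T, starExtend S p T * a T = ∑ T, p.1 T * a T.1 + ∑ T, p.2 T * a T.1 := by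
  classical
  rw [← Finset.sum_filter_add_sum_filter_not Finset.univ fun T : K.faces => T.1 ⊂ S.1]
  congr 1
  · rw [Finset.sum_subtype (p := fun T : K.faces => T.1 ⊂ S.1) _ (by simp)]
    exact Finset.sum_congr rfl fun T _ => by rw [starExtend_below]
  · rw [← Finset.sum_subset (s₁ := Finset.univ.filter fun T : K.faces => S.1 ⊂ T.1)]
    · rw [Finset.sum_subtype (p := fun T : K.faces => S.1 ⊂ T.1) _ (by simp)]
      exact Finset.sum_congr rfl fun T _ => by rw [starExtend_above]
    · intro T hT
      simp only [Finset.mem_filter, Finset.mem_univ, true_and] at hT ⊢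
      exact fun h => (hT.trans h).ne rfl
    · intro T hT hT'
      simp only [Finset.mem_filter, Finset.mem_univ, true_and] at hT hT'
      rw [starExtend_of_not p hT hT', zero_mul]

/-- The mass of a chain of proper faces and cofaces. -/
noncomputable def starMass (S : K.faces) : (Below S → ℝ) × (Above S → ℝ) →ₗ[ℝ] ℝ :=
  (∑ T, LinearMap.proj T) ∘ₗ starExtend S

lemma starMass_apply (p : (Below S → ℝ) × (Above S → ℝ)) :
    starMass S p = ∑ T, starExtend S p T := by
  simp [starMass]

omit [Fintype K.faces] in
lemma starRestrict_mem {c : K.faces → ℝ} (hc : c ∈ faceChains K) :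
    starRestrict S c ∈ belowChains S ×ˢ aboveChains S :=
  ⟨⟨fun T => hc.1 T.1, fun T T' h h' => hc.2 T.1 T'.1 h h'⟩,
    ⟨fun T => hc.1 T.1, fun T T' h h' => hc.2 T.1 T'.1 h h'⟩⟩

open scoped Classical in
omit [Fintype K.faces] in
-- When `S` itself carries weight, every other simplex in the support is comparable with it, so
-- restriction loses only the weight of `S`.
lemma starExtend_restrict {c : K.faces → ℝ} (hc : c ∈ faceChains K) (hS : 0 < c S) :
    starExtend S (starRestrict S c) + c S • Pi.single S 1 = c := by
  funext T
  simp only [Pi.add_apply, Pi.smul_apply, smul_eq_mul]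
  by_cases h1 : T.1 ⊂ S.1
  · have hne : T ≠ S := fun h => by subst h; exact h1.ne rfl
    rw [starExtend_below (T := ⟨T, h1⟩), Pi.single_eq_of_ne hne]
    simp [starRestrict, LinearMap.funLeft_apply]
  by_cases h2 : S.1 ⊂ T.1
  · have hne : T ≠ S := fun h => by subst h; exact h2.ne rfl
    rw [starExtend_above (T := ⟨T, h2⟩), Pi.single_eq_of_ne hne]
    simp [starRestrict, LinearMap.funLeft_apply]
  rw [starExtend_of_not _ h1 h2]
  by_cases hTS : T = S
  · subst hTS; simp
  · have hne : T.1 ≠ S.1 := fun h => hTS (Subtype.ext h)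
    rw [Pi.single_eq_of_ne hTS, mul_zero, add_zero]
    refine (le_antisymm (not_lt.1 fun h => ?_) (hc.1 T)).symm
    rcases hc.2 T S h hS with h' | h'
    · exact h1 (h'.ssubset_of_ne hne)
    · exact h2 (h'.ssubset_of_ne hne.symm)

open scoped Classical in
omit [Fintype K.faces] in
-- The join structure of the star: a chain below `S`, then `S`, then a chain above `S` is again a
-- chain.
lemma starExtend_add_mem {p : (Below S → ℝ) × (Above S → ℝ)}
    (hp : p ∈ belowChains S ×ˢ aboveChains S) {r : ℝ} (hr : 0 ≤ r) :
    starExtend S p + r • Pi.single S 1 ∈ faceChains K := by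
  have hS0 : starExtend S p S = 0 := starExtend_of_not p (fun h => h.ne rfl) fun h => h.ne rfl
  have hcases : ∀ T : K.faces, T.1 ⊂ S.1 ∨ S.1 ⊂ T.1 ∨ T = S ∨
      (T ≠ S ∧ starExtend S p T = 0) := by
    intro T
    by_cases h1 : T.1 ⊂ S.1
    · exact Or.inl h1
    by_cases h2 : S.1 ⊂ T.1
    · exact Or.inr (Or.inl h2)
    by_cases h3 : T = S
    · exact Or.inr (Or.inr (Or.inl h3))
    · exact Or.inr (Or.inr (Or.inr ⟨h3, starExtend_of_not p h1 h2⟩))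
  have hb : ∀ T : Below S, (starExtend S p + r • Pi.single S 1 : K.faces → ℝ) T.1 = p.1 T := by
    intro T
    have hne : T.1 ≠ S := fun h => T.2.ne (congrArg Subtype.val h)
    simp [starExtend_below, Pi.single_eq_of_ne hne]
  have ha : ∀ T : Above S, (starExtend S p + r • Pi.single S 1 : K.faces → ℝ) T.1 = p.2 T := by
    intro T
    have hne : T.1 ≠ S := fun h => T.2.ne (congrArg Subtype.val h).symm
    simp [starExtend_above, Pi.single_eq_of_ne hne]
  refine ⟨fun T => ?_, fun T T' hT hT' => ?_⟩
  · rcases hcases T with h | h | h | ⟨h, h'⟩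
    · rw [hb ⟨T, h⟩]; exact hp.1.1 _
    · rw [ha ⟨T, h⟩]; exact hp.2.1 _
    · subst h; simp [hS0, hr]
    · simp [h', h]
  · rcases hcases T with h | h | h | ⟨h, h'⟩
    · rcases hcases T' with k | k | k | ⟨k, k'⟩
      · rw [hb ⟨T, h⟩] at hT
        rw [hb ⟨T', k⟩] at hT'
        exact hp.1.2 _ _ hT hT'
      · exact Or.inl (h.trans k).subset
      · subst k; exact Or.inl h.subset
      · simp [k', k] at hT'
    · rcases hcases T' with k | k | k | ⟨k, k'⟩
      · exact Or.inr (k.trans h).subset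
      · rw [ha ⟨T, h⟩] at hT
        rw [ha ⟨T', k⟩] at hT'
        exact hp.2.2 _ _ hT hT'
      · subst k; exact Or.inr h.subset
      · simp [k', k] at hT'
    · subst h
      rcases hcases T' with k | k | k | ⟨k, k'⟩
      · exact Or.inr k.subset
      · exact Or.inl k.subset
      · subst k; exact Or.inl subset_rfl
      · simp [k', k] at hT'
    · simp [h', h] at hT

open scoped Classical in
omit [Fintype K.faces] in
lemma starRestrict_extend_add (p : (Below S → ℝ) × (Above S → ℝ)) (r : ℝ) :
    starRestrict S (starExtend S p + r • Pi.single S 1) = p := by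
  refine Prod.ext (funext fun T => ?_) (funext fun T => ?_)
  · have hne : T.1 ≠ S := fun h => T.2.ne (congrArg Subtype.val h)
    simp [starRestrict, LinearMap.funLeft_apply, starExtend_below, Pi.single_eq_of_ne hne]
  · have hne : T.1 ≠ S := fun h => T.2.ne (congrArg Subtype.val h).symm
    simp [starRestrict, LinearMap.funLeft_apply, starExtend_above, Pi.single_eq_of_ne hne]

variable [FiniteDimensional ℝ E] {v : Finset E → E}

omit [FiniteDimensional ℝ E] in
lemma space_eq_biUnion : ∃ P : Finset (Finset E),
    K.space = ⋃ V ∈ P, convexHull ℝ (V : Set E) := by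
  classical
  refine ⟨Finset.univ.image (Subtype.val : K.faces → Finset E), ?_⟩
  ext z
  simp [Geometry.SimplicialComplex.mem_space_iff]

open scoped Classical in
/-- A piecewise linear parametrization of the star of `S` gives a chart around `v S`. -/
lemma exists_isPLChartAt (hv : ∀ S ∈ K.faces, InOpenSimplex S (v S)) {ψ : E × ℝ → K.faces → ℝ}
    (hψ : ConeEquiv (faceChains K) (coneOver K.space) (realize K v) ψ) {d : ℕ}
    {Φ : (Below S → ℝ) × (Above S → ℝ) → Fin d → ℝ}
    {Ξ : (Fin d → ℝ) → (Below S → ℝ) × (Above S → ℝ)}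
    (hΦ : ConeEquiv (belowChains S ×ˢ aboveChains S) univ Φ Ξ) (a : K.faces → ℝ)
    {H : (Fin d → ℝ) → ℝ}
    (hH : ∀ p ∈ belowChains S ×ˢ aboveChains S, H (Φ p) =
      ∑ T, p.1 T * (a T.1 - a S) + ∑ T, p.2 T * (a T.1 - a S)) :
    ∃ (U : Set E) (V : Set (Fin d → ℝ)) (φ : E → Fin d → ℝ) (χ : (Fin d → ℝ) → E),
      IsPLChartAt K.space (v S.1) U V φ χ ∧
      ∀ y ∈ V, ∑ T, ψ (χ y, 1) T * a T = ∑ T, ψ (v S.1, 1) T * a T + H y := by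
  set e : K.faces → ℝ := Pi.single S 1 with he
  have hS0 : ∀ p, starExtend S p S = 0 := fun p =>
    starExtend_of_not p (fun h => h.ne rfl) fun h => h.ne rfl
  have hψe : ψ (v S.1, 1) = e := by
    rw [← realize_single, hψ.left_inv (single_mem_faceChains S)]
  have hcS : ∀ z ∈ K.space, ψ (z, 1) ∈ faceChains K ∧ realize K v (ψ (z, 1)) = (z, 1) := fun z hz =>
    ⟨hψ.mapsTo_symm (mem_coneOver_one.2 hz), hψ.right_inv (mem_coneOver_one.2 hz)⟩
  -- The weight of `S` is what the two halves leave of the total mass one. Its positivity defines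
  -- the open star `U`, and the same condition in coordinates defines `V`.
  set c' : (Fin d → ℝ) → K.faces → ℝ := fun y =>
    starExtend S (Ξ y) + (1 - starMass S (Ξ y)) • e with hc'
  set χ : (Fin d → ℝ) → E := fun y => (realize K v (c' y)).1 with hχ
  set U : Set E := {z | z ∈ K.space ∧ 0 < ψ (z, 1) S} with hU
  set V : Set (Fin d → ℝ) := {y | starMass S (Ξ y) < 1} with hV
  have hc'mem : ∀ y ∈ V, c' y ∈ faceChains K := fun y hy =>
    starExtend_add_mem (hΦ.mapsTo_symm (mem_univ y)) (sub_nonneg.2 (le_of_lt hy))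
  have hc'S : ∀ y, c' y S = 1 - starMass S (Ξ y) := fun y => by simp [hc', hS0, he]
  have hc'real : ∀ y, realize K v (c' y) = (χ y, 1) := by
    intro y
    refine Prod.ext rfl ?_
    rw [realize_apply]
    simp [hc', Finset.sum_add_distrib, ← starMass_apply, he, Pi.single_apply]
  have hψc' : ∀ y ∈ V, ψ (χ y, 1) = c' y := fun y hy => by
    rw [← hc'real, hψ.left_inv (hc'mem y hy)]
  have hmass : ∀ z ∈ U, 1 - starMass S (starRestrict S (ψ (z, 1))) = ψ (z, 1) S := by
    intro z hz
    obtain ⟨h1, h2⟩ := hcS z hz.1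
    have h3 := congrArg (fun c : K.faces → ℝ => ∑ T, c T) (starExtend_restrict h1 hz.2)
    simp only [Pi.add_apply, Finset.sum_add_distrib, ← starMass_apply] at h3
    rw [realize_apply] at h2
    have h4 : ∑ T, ψ (z, 1) T = 1 := (Prod.ext_iff.1 h2).2
    rw [h4] at h3
    simp only [Pi.smul_apply, smul_eq_mul, ← Finset.mul_sum, Pi.single_apply,
      Finset.sum_ite_eq', Finset.mem_univ, if_true, mul_one] at h3
    linarith
  have hΞφ : ∀ z ∈ U, Ξ (Φ (starRestrict S (ψ (z, 1)))) = starRestrict S (ψ (z, 1)) := fun z hz =>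
    hΦ.left_inv (starRestrict_mem (hcS z hz.1).1)
  have hc'φ : ∀ z ∈ U, c' (Φ (starRestrict S (ψ (z, 1)))) = ψ (z, 1) := fun z hz => by
    simp only [hc']
    rw [hΞφ z hz, hmass z hz, starExtend_restrict (hcS z hz.1).1 hz.2]
  have hcont : ContinuousOn (fun z : E => ψ (z, 1) S) K.space := by
    have h1 : ContinuousOn (fun z : E => ψ (z, 1)) K.space :=
      hψ.finLin_symm.1.comp (by fun_prop) fun z hz => mem_coneOver_one.2 hz
    exact (continuous_apply S).comp_continuousOn h1
  obtain ⟨O, hO, hOU⟩ := continuousOn_iff'.1 hcont (Ioi 0) isOpen_Ioi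
  have hUO : U = K.space ∩ O := by
    rw [inter_comm, ← hOU]
    ext z
    simp only [hU, Set.mem_ofPred_eq, mem_inter_iff, mem_preimage, mem_Ioi]
    exact and_comm
  have hUpoly : IsLocallyPolyhedral U := by
    obtain ⟨P, hP⟩ := space_eq_biUnion (K := K)
    rw [hUO, hP]
    exact isLocallyPolyhedral_inter_isOpen P hO
  have hVo : IsOpen V := by
    have h1 : Continuous fun y => starMass S (Ξ y) :=
      (starMass S).continuous_of_finiteDimensional.comp
        (continuousOn_univ.1 hΦ.finLin_symm.1)
    exact isOpen_lt h1 continuous_const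
  refine ⟨U, V, fun z => Φ (starRestrict S (ψ (z, 1))), χ, ⟨⟨O, hO, hUO⟩, ?_, hVo, ⟨?_, ?_, ⟨?_, ?_⟩,
    ?_, ?_⟩, ?_⟩, ?_⟩
  · refine ⟨Geometry.SimplicialComplex.mem_space_iff.2 ⟨S.1, S.2, (hv S.1 S.2).mem_convexHull⟩, ?_⟩
    rw [hψe]; simp [he]
  · intro z hz
    change starMass S (Ξ _) < 1
    rw [hΞφ z hz]
    have := hmass z hz
    have := hz.2
    linarith
  · intro y hy
    have h1 := hψ.mapsTo (hc'mem y hy)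
    rw [hc'real] at h1
    refine ⟨mem_coneOver_one.1 h1, ?_⟩
    rw [hψc' y hy, hc'S]
    exact sub_pos.2 hy
  · intro z hz
    change (realize K v (c' _)).1 = z
    rw [hc'φ z hz, (hcS z hz.1).2]
  · intro y hy
    change Φ (starRestrict S (ψ (χ y, 1))) = y
    rw [hψc' y hy]
    simp only [hc', he]
    rw [starRestrict_extend_add, hΦ.right_inv (mem_univ y)]
  · have h1 : IsFinLin (fun q : E × ℝ => Φ (starRestrict S (ψ q))) (coneOver K.space) :=
      hΦ.finLin.comp (hψ.finLin_symm.linear_comp (starRestrict S)) fun q hq =>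
        starRestrict_mem (hψ.mapsTo_symm hq)
    exact h1.isPLOn_slice hUpoly fun z hz => mem_coneOver_one.2 hz.1
  -- The inverse chart is `v S` plus a linear map applied to the star coordinates.
  · let M : (Below S → ℝ) × (Above S → ℝ) →ₗ[ℝ] E := LinearMap.fst ℝ E ℝ ∘ₗ realize K v ∘ₗ
      (starExtend S - (LinearMap.toSpanSingleton ℝ (K.faces → ℝ) e) ∘ₗ starMass S)
    have h1 : IsFinLin (fun y => M (Ξ y)) V :=
      (hΦ.finLin_symm.mono (subset_univ V)).linear_comp M
    have h2 := h1.isPLOn_const_add (isLocallyPolyhedral_of_isOpen hVo) (realize K v e).1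
    convert h2 using 2 with y
    simp only [hχ, hc', M, LinearMap.comp_apply, LinearMap.fst_apply, LinearMap.sub_apply,
      LinearMap.toSpanSingleton_apply, map_add, map_sub, map_smul, Prod.fst_add, Prod.fst_sub,
      Prod.smul_fst, sub_smul, one_smul]
    abel
  · have h0 : starRestrict S e = 0 := by
      have := starRestrict_extend_add (S := S) 0 1
      rwa [map_zero, zero_add, one_smul] at this
    have hmem : (0 : (Below S → ℝ) × (Above S → ℝ)) ∈ belowChains S ×ˢ aboveChains S := by
      rw [← h0]; exact starRestrict_mem (single_mem_faceChains S)
    obtain ⟨L, -, hL⟩ := hΦ.finLin.2.choose_spec.2 0 hmem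
    rw [hψe, h0, hL, map_zero]
  -- With total weight one, `∑ c T * a T` equals `a S` plus the sum of `c T * (a T - a S)` over the
  -- two halves.
  · intro y hy
    have h1 := hH _ (hΦ.mapsTo_symm (mem_univ y))
    rw [hΦ.right_inv (mem_univ y), ← sum_starExtend (Ξ y) fun T => a T - a S] at h1
    rw [hψc' y hy, hψe, h1]
    simp only [hc', he, Pi.add_apply, Pi.smul_apply, smul_eq_mul, add_mul, mul_sub,
      Finset.sum_add_distrib, Finset.sum_sub_distrib, ← Finset.sum_mul, ← starMass_apply,
      Pi.single_apply, mul_ite, ite_mul, mul_one, mul_zero, zero_mul, one_mul, Finset.sum_ite_eq',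
      Finset.mem_univ, if_true, sub_mul]
    ring

end Star

/-! ### Reindexing chains. -/

section Reindex

variable {I I' J J' : Type*}

lemma comp_mem_chainCone {s : I → Finset J} {s' : I' → Finset J'} (e : I ≃ I')
    (h : ∀ i j, s i ⊆ s j ↔ s' (e i) ⊆ s' (e j)) {c : I' → ℝ} :
    c ∈ chainCone s' ↔ c ∘ e ∈ chainCone s := by
  refine and_congr ⟨fun hc i => hc (e i), fun hc i => ?_⟩
    ⟨fun hc i j hi hj => ?_, fun hc i j hi hj => ?_⟩
  · simpa using hc (e.symm i)
  · rw [h, h]; exact hc _ _ hi hj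
  · have := hc (e.symm i) (e.symm j) (by simpa using hi) (by simpa using hj)
    simpa [h] using this

end Reindex

/-! ### The lower and upper halves of the star as Euclidean spaces. -/

section StarHalves

variable {E : Type*} [NormedAddCommGroup E] [NormedSpace ℝ E]
  {K : Geometry.SimplicialComplex ℝ E}

/-- The barycentre of a finite set. -/
noncomputable def barycentre (s : Finset E) : E := ∑ x ∈ s, (s.card : ℝ)⁻¹ • x

lemma inOpenSimplex_barycentre {s : Finset E} (hs : s.Nonempty) :
    InOpenSimplex s (barycentre s) := by
  have h : (0 : ℝ) < s.card := by exact_mod_cast hs.card_pos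
  refine ⟨fun _ => (s.card : ℝ)⁻¹, fun x _ => inv_pos.2 h, ?_, rfl⟩
  simp [h.ne']

open scoped Classical in
/-- The simplices of the link of `S` correspond to the proper cofaces of `S`. -/
noncomputable def linkEquiv (S : K.faces) : (link K S.1).faces ≃ Above S where
  toFun t := ⟨⟨t.1 ∪ S.1, t.2.2.2⟩, by
    refine Finset.ssubset_iff_subset_ne.2 ⟨Finset.subset_union_right, fun h => ?_⟩
    obtain ⟨x, hx⟩ := K.nonempty_of_mem_faces t.2.1
    exact Finset.disjoint_left.1 t.2.2.1 hx (h.symm ▸ Finset.mem_union_left _ hx)⟩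
  invFun T := ⟨T.1.1 \ S.1, by
    refine ⟨K.down_closed T.1.2 Finset.sdiff_subset ?_, Finset.sdiff_disjoint, ?_⟩
    · exact Finset.sdiff_nonempty.2 T.2.2
    · rw [Finset.sdiff_union_of_subset T.2.1]; exact T.1.2⟩
  left_inv t := Subtype.ext (Finset.union_sdiff_cancel_right t.2.2.1)
  right_inv T := Subtype.ext (Subtype.ext (Finset.sdiff_union_of_subset T.2.1))

lemma linkEquiv_subset (S : K.faces) (t u : (link K S.1).faces) :
    t.1 ⊆ u.1 ↔ (linkEquiv S t).1.1 ⊆ (linkEquiv S u).1.1 := by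
  classical
  change _ ↔ t.1 ∪ S.1 ⊆ u.1 ∪ S.1
  refine ⟨fun h => Finset.union_subset_union_left h, fun h x hx => ?_⟩
  rcases Finset.mem_union.1 (h (Finset.mem_union_left _ hx)) with h' | h'
  · exact h'
  · exact absurd h' (Finset.disjoint_left.1 t.2.2.1 hx)

variable [FiniteDimensional ℝ E] [Fintype K.faces]

lemma isCompact_space : IsCompact K.space := by
  obtain ⟨P, hP⟩ := space_eq_biUnion (K := K)
  rw [hP]
  exact P.isCompact_biUnion fun V _ => V.finite_toSet.isCompact_convexHull ℝ

/-- Removing `S` identifies cofaces with simplices of the link, and the barycentric subdivision of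
the link turns chains into the cone over its space. Height in that cone is the total weight. -/
lemma exists_coneEquiv_aboveChains (S : K.faces) {n : ℕ}
    (h : PLHomeomorphic (link K S.1).space (simplexBoundary n)) :
    ∃ (Φ : (Above S → ℝ) → Fin n → ℝ) (Ψ : (Fin n → ℝ) → Above S → ℝ),
      ConeEquiv (aboveChains S) univ Φ Ψ ∧ ∀ c ∈ aboveChains S, ∑ i, |Φ c i| = ∑ T, c T := by
  classical
  let _ : Fintype (link K S.1).faces := Fintype.ofEquiv _ (linkEquiv S).symm
  obtain ⟨Φ, Ψ, hΦ, hsum⟩ := exists_coneEquiv_of_sphere isCompact_space h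
  obtain ⟨ψ, hψ⟩ := exists_coneEquiv_realize (K := link K S.1) (v := barycentre)
    fun t ht => inOpenSimplex_barycentre ((link K S.1).nonempty_of_mem_faces ht)
  have h1 : ConeEquiv (aboveChains S) (faceChains (link K S.1)) _ _ :=
    ConeEquiv.ofLinearEquiv (LinearEquiv.funCongrLeft ℝ ℝ (linkEquiv S)) fun c =>
      comp_mem_chainCone (linkEquiv S) (linkEquiv_subset S)
  refine ⟨_, _, (h1.trans hψ).trans hΦ, fun c hc => ?_⟩
  have h2 := hsum _ ((h1.trans hψ).mapsTo hc)
  simp only [Function.comp_apply] at h2 ⊢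
  rw [h2, realize_apply]
  exact Equiv.sum_comp (linkEquiv S) c

omit [FiniteDimensional ℝ E] in
-- Proper faces of `S` are the proper nonempty subsets of `k + 1` vertices, and their chains
-- subdivide the boundary of the orthant; the manifold hypothesis plays no role here.
lemma exists_coneEquiv_belowChains (S : K.faces) {k : ℕ} (hk : S.1.card = k + 1) :
    ∃ (Φ : (Below S → ℝ) → Fin k → ℝ) (Ψ : (Fin k → ℝ) → Below S → ℝ),
      ConeEquiv (belowChains S) univ Φ Ψ ∧ ∀ c ∈ belowChains S, ∑ i, |Φ c i| = ∑ T, c T := by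
  classical
  let e : S.1 ≃ Fin (k + 1) := S.1.equivFinOfCardEq hk
  let s : Below S → Finset (Fin (k + 1)) := fun T => Finset.univ.filter fun i =>
    (e.symm i).1 ∈ T.1.1
  have hmem : ∀ (T : Below S) i, i ∈ s T ↔ (e.symm i).1 ∈ T.1.1 := fun T i => by simp [s]
  have hsub : ∀ T T' : Below S, T.1.1 ⊆ T'.1.1 ↔ s T ⊆ s T' := by
    intro T T'
    refine ⟨fun h i hi => (hmem _ _).2 (h ((hmem _ _).1 hi)), fun h x hx => ?_⟩
    have h1 := (hmem T' (e ⟨x, T.2.1 hx⟩)).1 (h ((hmem _ _).2 (by simpa using hx)))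
    simpa using h1
  have hX : belowChains S = chainCone s := by
    ext c
    exact (comp_mem_chainCone (Equiv.refl _) fun i j => (hsub i j).symm).trans Iff.rfl
  have hinj : Function.Injective s := fun T T' h =>
    Subtype.ext (Subtype.ext (((hsub _ _).2 h.subset).antisymm ((hsub _ _).2 h.superset)))
  have hne : ∀ T, (s T).Nonempty := fun T => by
    obtain ⟨x, hx⟩ := K.nonempty_of_mem_faces T.1.2
    exact ⟨e ⟨x, T.2.1 hx⟩, (hmem _ _).2 (by simpa using hx)⟩
  let p : Below S → Fin (k + 1) → ℝ := fun T i => if i ∈ s T then ((s T).card : ℝ)⁻¹ else 0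
  have hcard : ∀ T, (0 : ℝ) < (s T).card := fun T => by exact_mod_cast (hne T).card_pos
  have hps : ∀ T i, 0 < p T i ↔ i ∈ s T := fun T i => by
    by_cases h : i ∈ s T <;> simp only [p, h, if_true, if_false, lt_irrefl, inv_pos, hcard T]
  have hp : ∀ T i, 0 ≤ p T i := fun T i => by
    by_cases h : i ∈ s T <;> simp only [p, h, if_true, if_false, le_refl, inv_nonneg, (hcard T).le]
  have hp1 : ∀ T, ∑ i, p T i = 1 := fun T => by
    simp only [p, Finset.sum_ite_mem, Finset.univ_inter, Finset.sum_const, nsmul_eq_mul]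
    exact mul_inv_cancel₀ (hcard T).ne'
  let Γ : (Below S → ℝ) →ₗ[ℝ] Fin (k + 1) → ℝ := Fintype.linearCombination ℝ p
  have hΓ : ∀ c i, Γ c i = ∑ T, c T * p T i := fun c i => by
    simp [Γ, Fintype.linearCombination_apply]
  have hΓinj : InjOn Γ (chainCone s) := fun c hc c' hc' h =>
    chainCone_unique hinj hne hp hps hc hc' fun i => by rw [← hΓ, ← hΓ, h]
  have himg : Γ '' chainCone s = orthantBoundary k := by
    apply Subset.antisymm
    · rintro _ ⟨c, hc, rfl⟩
      have h0 : ∀ i, 0 ≤ Γ c i := fun i => by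
        rw [hΓ]; exact Finset.sum_nonneg fun T _ => mul_nonneg (hc.1 T) (hp T i)
      refine ⟨h0, ?_⟩
      by_cases hc0 : c = 0
      · exact ⟨0, by simp [hc0]⟩
      obtain ⟨T, hT, htop⟩ := exists_top hc hc0
      -- A vertex of `S` missing from the top face gives the vanishing coordinate.
      obtain ⟨x, hxS, hxT⟩ := Finset.exists_of_ssubset T.2
      refine ⟨e ⟨x, hxS⟩, le_antisymm (not_lt.1 fun h => hxT ?_) (h0 _)⟩
      rw [hΓ, sum_pos_iff_mem_top hp hps hc.1 hT htop, hmem] at h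
      simpa using h
    · intro β hβ
      have hstep : ∀ β ∈ orthantBoundary k, β ≠ 0 → ∃ T, (∀ i, 0 < β i ↔ i ∈ s T) ∧
          ∀ t : ℝ, 0 ≤ t → (∀ i, 0 ≤ β i - t * p T i) →
            (fun i => β i - t * p T i) ∈ orthantBoundary k := by
        rintro β ⟨h0, i₀, hi₀⟩ hβ0
        obtain ⟨i₁, hi₁⟩ : ∃ i, β i ≠ 0 := Function.ne_iff.1 hβ0
        let A : Finset E := (Finset.univ.filter fun i => 0 < β i).image fun i => (e.symm i).1
        have hA : ∀ i, (e.symm i).1 ∈ A ↔ 0 < β i := fun i => by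
          simp [A]
        have hAS : A ⊆ S.1 := fun x hx => by
          obtain ⟨i, -, rfl⟩ := Finset.mem_image.1 hx
          exact (e.symm i).2
        have hAK : A ∈ K.faces := K.down_closed S.2 hAS
          ⟨_, (hA i₁).2 (lt_of_le_of_ne (h0 i₁) hi₁.symm)⟩
        have hAS' : A ⊂ S.1 := Finset.ssubset_iff_subset_ne.2 ⟨hAS, fun h =>
          ((hA i₀).1 (h.superset (e.symm i₀).2)).ne' hi₀⟩
        have hAs : ∀ i, 0 < β i ↔ i ∈ s ⟨⟨A, hAK⟩, hAS'⟩ := fun i => by rw [hmem, hA]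
        refine ⟨⟨⟨A, hAK⟩, hAS'⟩, hAs, fun t _ h => ⟨h, i₀, ?_⟩⟩
        have h1 : i₀ ∉ s ⟨⟨A, hAK⟩, hAS'⟩ := fun h => ((hAs i₀).2 h).ne' hi₀
        simp only [p, if_neg h1, hi₀, mul_zero, sub_zero]
      obtain ⟨c, hc, -, h⟩ := chainCone_exists hps hp (fun β hβ => hβ.1) hstep hβ
      exact ⟨c, hc, funext fun i => by rw [hΓ, h]⟩
  obtain ⟨ψ, hψ⟩ := (isOrthantComplex_chainCone s).exists_coneEquiv Γ hΓinj
  rw [himg] at hψ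
  obtain ⟨Φ, Ψ, hΦ, hsum⟩ := exists_coneEquiv_orthantBoundary k
  rw [hX]
  refine ⟨_, _, hψ.trans hΦ, fun c hc => ?_⟩
  simp only [Function.comp_apply]
  rw [hsum _ (hψ.mapsTo hc)]
  simp only [hΓ]
  rw [Finset.sum_comm]
  simp only [← Finset.mul_sum, hp1, mul_one]

end StarHalves

/-! ### Absorbing positive coefficients into the weights. -/

section Scaling

variable {I : Type*} [Fintype I]

lemma exists_coneEquiv_weighted {X : Set (I → ℝ)} (hX : IsOrthantComplex X) {n : ℕ}
    {Φ : (I → ℝ) → Fin n → ℝ} {Ψ : (Fin n → ℝ) → I → ℝ} (hΦ : ConeEquiv X univ Φ Ψ)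
    (hsum : ∀ c ∈ X, ∑ i, |Φ c i| = ∑ T, c T) {a : I → ℝ} (ha : ∀ i, 0 < a i) :
    ∃ (Φ' : (I → ℝ) → Fin n → ℝ) (Ψ' : (Fin n → ℝ) → I → ℝ),
      ConeEquiv X univ Φ' Ψ' ∧ ∀ c ∈ X, ∑ i, |Φ' c i| = ∑ T, c T * a T := by
  have h1 := hX.coneEquiv_diagScale ha
  refine ⟨_, _, h1.trans hΦ, fun c hc => ?_⟩
  simp only [Function.comp_apply]
  rw [hsum _ (h1.mapsTo hc)]
  simp only [diagScale_apply, mul_comm]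

end Scaling

/-! ### Combining and straightening coordinates. -/

section Coordinates

variable {V W : Type*} [NormedAddCommGroup V] [NormedSpace ℝ V] [NormedAddCommGroup W]
  [NormedSpace ℝ W]

lemma exists_coneEquiv_append [FiniteDimensional ℝ V] [FiniteDimensional ℝ W] {X : Set V}
    {Y : Set W} {k n : ℕ} {Φ₁ : V → Fin k → ℝ} {Ψ₁ : (Fin k → ℝ) → V} {Φ₂ : W → Fin n → ℝ}
    {Ψ₂ : (Fin n → ℝ) → W} (h₁ : ConeEquiv X univ Φ₁ Ψ₁) (h₂ : ConeEquiv Y univ Φ₂ Ψ₂) :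
    ∃ (Φ : V × W → Fin (k + n) → ℝ) (Ψ : (Fin (k + n) → ℝ) → V × W),
      ConeEquiv (X ×ˢ Y) univ Φ Ψ ∧ ∀ p, (∀ i, Φ p (Fin.castAdd n i) = Φ₁ p.1 i) ∧
        ∀ j, Φ p (Fin.natAdd k j) = Φ₂ p.2 j := by
  let e : ((Fin k → ℝ) × (Fin n → ℝ)) ≃ₗ[ℝ] Fin (k + n) → ℝ :=
    (LinearEquiv.sumArrowLequivProdArrow (Fin k) (Fin n) ℝ ℝ).symm.trans
      (LinearEquiv.funCongrLeft ℝ ℝ finSumFinEquiv.symm)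
  have h := (h₁.prod h₂).trans (ConeEquiv.ofLinearEquiv (Y := univ) e (by simp))
  refine ⟨_, _, h, fun p => ⟨fun i => ?_, fun j => ?_⟩⟩
  · simp [e, LinearEquiv.funCongrLeft_apply, LinearMap.funLeft_apply]
    rfl
  · simp [e, LinearEquiv.funCongrLeft_apply, LinearMap.funLeft_apply]
    rfl

lemma exists_coneEquiv_coord {X : Set V} {d : ℕ} {Φ : V → Fin d → ℝ} {Ψ : (Fin d → ℝ) → V}
    (h : ConeEquiv X univ Φ Ψ) {i : Fin d} {G : (Fin d → ℝ) → ℝ} (hG : IsFinLin G univ)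
    (hshift : ∀ y (s : ℝ), G (y + s • Pi.single i 1) = G y + s) (j : Fin d) :
    ∃ (Φ' : V → Fin d → ℝ) (Ψ' : (Fin d → ℝ) → V),
      ConeEquiv X univ Φ' Ψ' ∧ ∀ c, Φ' c j = G (Φ c) := by
  obtain ⟨θ, θ', hθ, hl⟩ := coneEquiv_shear hG.neg (ρ := Pi.single i 1)
    (fun y s => by rw [hshift]; ring) (l := LinearMap.proj i) (by simp)
  have hσ : ConeEquiv (univ : Set (Fin d → ℝ)) univ _ _ :=
    ConeEquiv.ofLinearEquiv (LinearEquiv.funCongrLeft ℝ ℝ (Equiv.swap i j)) (by simp)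
  refine ⟨_, _, (h.trans hθ).trans hσ, fun c => ?_⟩
  have := hl (Φ c)
  simpa [LinearEquiv.funCongrLeft_apply, LinearMap.funLeft_apply] using this

end Coordinates

/-! ### The local form of the function at a vertex. -/

section Vertices

variable {E : Type*} [NormedAddCommGroup E] [NormedSpace ℝ E] [FiniteDimensional ℝ E]
  {K : Geometry.SimplicialComplex ℝ E} [Fintype K.faces] {v : Finset E → E} {S : K.faces}
  {ψ : E × ℝ → K.faces → ℝ} {a : K.faces → ℝ} {k n : ℕ}

omit [FiniteDimensional ℝ E] in
lemma exists_coneEquiv_below_weighted (hk : S.1.card = k + 1)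
    (hb : ∀ T : Below S, a T.1 < a S) :
    ∃ (Φ : (Below S → ℝ) → Fin k → ℝ) (Ψ : (Fin k → ℝ) → Below S → ℝ),
      ConeEquiv (belowChains S) univ Φ Ψ ∧
      ∀ c ∈ belowChains S, -∑ i, |Φ c i| = ∑ T, c T * (a T.1 - a S) := by
  obtain ⟨Φ, Ψ, h, hs⟩ := exists_coneEquiv_belowChains S hk
  obtain ⟨Φ', Ψ', h', hs'⟩ := exists_coneEquiv_weighted (isOrthantComplex_chainCone _) h hs
    (a := fun T => a S - a T.1) fun T => sub_pos.2 (hb T)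
  refine ⟨Φ', Ψ', h', fun c hc => ?_⟩
  rw [hs' c hc, ← Finset.sum_neg_distrib]
  exact Finset.sum_congr rfl fun T _ => by ring

lemma exists_coneEquiv_above_weighted
    (hl : PLHomeomorphic (link K S.1).space (simplexBoundary n))
    (hb : ∀ T : Above S, a S < a T.1) :
    ∃ (Φ : (Above S → ℝ) → Fin n → ℝ) (Ψ : (Fin n → ℝ) → Above S → ℝ),
      ConeEquiv (aboveChains S) univ Φ Ψ ∧
      ∀ c ∈ aboveChains S, ∑ i, |Φ c i| = ∑ T, c T * (a T.1 - a S) := by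
  obtain ⟨Φ, Ψ, h, hs⟩ := exists_coneEquiv_aboveChains S hl
  exact exists_coneEquiv_weighted (isOrthantComplex_chainCone _) h hs
    (a := fun T => a T.1 - a S) fun T => sub_pos.2 (hb T)

lemma isNondegenerateCritical_of_values (hv : ∀ S ∈ K.faces, InOpenSimplex S (v S))
    (hψ : ConeEquiv (faceChains K) (coneOver K.space) (realize K v) ψ)
    (hk : S.1.card = k + 1) (hl : PLHomeomorphic (link K S.1).space (simplexBoundary n))
    (hb : ∀ T : Below S, a T.1 < a S) (ha : ∀ T : Above S, a S < a T.1) :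
    IsNondegenerateCritical K.space (k + n) k (fun z => ∑ T, ψ (z, 1) T * a T) (v S.1) := by
  obtain ⟨Φ₁, Ψ₁, h₁, hs₁⟩ := exists_coneEquiv_below_weighted hk hb
  obtain ⟨Φ₂, Ψ₂, h₂, hs₂⟩ := exists_coneEquiv_above_weighted hl ha
  obtain ⟨Φ, Ψ, h, hΦ⟩ := exists_coneEquiv_append h₁ h₂
  obtain ⟨U, V, φ, χ, hχ, hf⟩ := exists_isPLChartAt hv hψ h a
    (H := fun y => ∑ i : Fin (k + n), if (i : ℕ) < k then -|y i| else |y i|) fun p hp => by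
      rw [← hs₁ _ hp.1, ← hs₂ _ hp.2, Fin.sum_univ_add]
      simp [(hΦ p).1, (hΦ p).2]
  exact ⟨Nat.le_add_right _ _, U, V, φ, χ, hχ, hf⟩

lemma isStronglyRegular_of_coord (hv : ∀ S ∈ K.faces, InOpenSimplex S (v S))
    (hψ : ConeEquiv (faceChains K) (coneOver K.space) (realize K v) ψ) {d : ℕ}
    {Φ : (Below S → ℝ) × (Above S → ℝ) → Fin d → ℝ}
    {Ξ : (Fin d → ℝ) → (Below S → ℝ) × (Above S → ℝ)}
    (hΦ : ConeEquiv (belowChains S ×ˢ aboveChains S) univ Φ Ξ) {i : Fin d}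
    {G : (Fin d → ℝ) → ℝ} (hG : IsFinLin G univ)
    (hshift : ∀ y (s : ℝ), G (y + s • Pi.single i 1) = G y + s)
    (hGa : ∀ p ∈ belowChains S ×ˢ aboveChains S, G (Φ p) =
      ∑ T, p.1 T * (a T.1 - a S) + ∑ T, p.2 T * (a T.1 - a S)) :
    IsStronglyRegular K.space d (fun z => ∑ T, ψ (z, 1) T * a T) (v S.1) := by
  have hd : d - 1 + 1 = d := Nat.sub_add_cancel i.pos
  let j : Fin d := ⟨d - 1, by omega⟩
  obtain ⟨Φ', Ξ', h', hj⟩ := exists_coneEquiv_coord hΦ hG hshift j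
  obtain ⟨U, V, φ, χ, hχ, hf⟩ := exists_isPLChartAt hv hψ h' a (H := fun y => y j)
    fun p hp => by rw [hj, hGa p hp]
  exact ⟨U, V, φ, χ, hχ, j, hd, hf⟩

open scoped Classical in
lemma single_mem_chainCone {I J : Type*} (s : I → Finset J) (x : I) :
    (Pi.single x 1 : I → ℝ) ∈ chainCone s := by
  have h : ∀ i, 0 < (Pi.single x 1 : I → ℝ) i → i = x := fun i hi => by
    by_contra hne
    simp [hne] at hi
  refine ⟨fun i => ?_, fun i j hi hj => ?_⟩
  · by_cases hi : i = x
    · subst hi; simp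
    · simp [hi]
  · rw [h i hi, h j hj]; exact Or.inl subset_rfl

/-- The upper half contributes a single coordinate by `exists_coneEquiv_last_coord`, the lower half
minus an `ℓ¹`-norm. Their sum still grows at unit speed in that coordinate, so a shear finishes. -/
lemma isStronglyRegular_of_exceptional_coface (hv : ∀ S ∈ K.faces, InOpenSimplex S (v S))
    (hψ : ConeEquiv (faceChains K) (coneOver K.space) (realize K v) ψ)
    (hk : S.1.card = k + 1) (hl : PLHomeomorphic (link K S.1).space (simplexBoundary n))
    (hb : ∀ T : Below S, a T.1 < a S) {R : Above S} (hR : a R.1 < a S)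
    (ha : ∀ T : Above S, T ≠ R → a S < a T.1) :
    IsStronglyRegular K.space (k + n) (fun z => ∑ T, ψ (z, 1) T * a T) (v S.1) := by
  classical
  obtain ⟨Φ₁, Ψ₁, h₁, hs₁⟩ := exists_coneEquiv_below_weighted hk hb
  obtain ⟨Φ₀, Ψ₀, h₀, -⟩ := exists_coneEquiv_aboveChains S hl
  obtain ⟨Φ₂, Ψ₂, h₂, j, -, hj⟩ := exists_coneEquiv_last_coord (isOrthantComplex_chainCone _) h₀
    (x := R) (by convert single_mem_chainCone _ R) (a := fun T => a T.1 - a S) (sub_neg.2 hR)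
    fun T hT => sub_pos.2 (ha T hT)
  obtain ⟨Φ, Ψ, h, hΦ⟩ := exists_coneEquiv_append h₁ h₂
  refine isStronglyRegular_of_coord hv hψ h (i := Fin.natAdd k j)
    (G := fun y => -∑ i, |y (Fin.castAdd n i)| + y (Fin.natAdd k j)) ?_ ?_ ?_
  · exact (IsFinLin.sum _ fun i _ => (isFinLin_apply _ _).abs).neg.add (isFinLin_apply _ _)
  · intro y s
    have hne : ∀ i, Fin.castAdd n i ≠ Fin.natAdd k j := fun i h => by
      have := congrArg Fin.val h
      have := i.2
      simp at *
      omega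
    simp [hne, add_assoc]
  · intro p hp
    simp only [(hΦ p).1, (hΦ p).2, hs₁ _ hp.1, hj _ hp.2]
    simp only [mul_comm]

lemma isStronglyRegular_of_exceptional_face (hv : ∀ S ∈ K.faces, InOpenSimplex S (v S))
    (hψ : ConeEquiv (faceChains K) (coneOver K.space) (realize K v) ψ)
    (hk : S.1.card = k + 1) (hl : PLHomeomorphic (link K S.1).space (simplexBoundary n))
    {R : Below S} (hR : a S < a R.1) (hb : ∀ T : Below S, T ≠ R → a T.1 < a S)
    (ha : ∀ T : Above S, a S < a T.1) :
    IsStronglyRegular K.space (k + n) (fun z => ∑ T, ψ (z, 1) T * a T) (v S.1) := by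
  classical
  obtain ⟨Φ₀, Ψ₀, h₀, -⟩ := exists_coneEquiv_belowChains S hk
  obtain ⟨Φ₁, Ψ₁, h₁, j, -, hj⟩ := exists_coneEquiv_last_coord (isOrthantComplex_chainCone _) h₀
    (x := R) (by convert single_mem_chainCone _ R) (a := fun T => a S - a T.1) (sub_neg.2 hR)
    fun T hT => sub_pos.2 (hb T hT)
  obtain ⟨Φ₂, Ψ₂, h₂, hs₂⟩ := exists_coneEquiv_above_weighted hl ha
  -- The straightened function was `a S - a T`, negative at `R` alone, so the lower coordinates are
  -- negated to restore the sign.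
  obtain ⟨Φ, Ψ, h, hΦ⟩ := exists_coneEquiv_append
    (h₁.trans (ConeEquiv.ofLinearEquiv (Y := univ) (LinearEquiv.neg ℝ) (by simp))) h₂
  refine isStronglyRegular_of_coord hv hψ h (i := Fin.castAdd n j)
    (G := fun y => y (Fin.castAdd n j) + ∑ i, |y (Fin.natAdd k i)|) ?_ ?_ ?_
  · exact (isFinLin_apply _ _).add (IsFinLin.sum _ fun i _ => (isFinLin_apply _ _).abs)
  · intro y s
    have hne : ∀ i, Fin.natAdd k i ≠ Fin.castAdd n j := fun i h => by
      have := congrArg Fin.val h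
      have := j.2
      simp at *
      omega
    simp [hne, add_right_comm]
  · intro p hp
    simp only [(hΦ p).1, (hΦ p).2, hs₂ _ hp.2]
    congr 1
    simp only [Function.comp_apply, LinearEquiv.neg_apply, Pi.neg_apply, hj _ hp.1]
    rw [← Finset.sum_neg_distrib]
    exact Finset.sum_congr rfl fun T _ => by ring

end Vertices

/-! ### Generic representatives of discrete Morse functions. -/

section Generic

variable {E : Type*} [AddCommGroup E] [Module ℝ E] {K : Geometry.SimplicialComplex ℝ E}
  {g g' : Finset E → ℝ}

/-- Forman's argument: with `x ∈ R \ S`, the cell `T ∪ {x}` is the other one between `T` and `R`.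
Uniqueness of exceptional cells gives `g T < g (T ∪ {x}) < g R ≤ g S ≤ g T`. -/
lemma IsDiscreteMorse.not_face_and_coface (hg : IsDiscreteMorse K g) {T S R : Finset E}
    (hTS : IsExceptional K g T S) : ¬ IsExceptional K g S R := by
  classical
  intro hSR
  obtain ⟨hT, hS, hTS', hc, h1⟩ := id hTS
  obtain ⟨-, hR, hSR', hc', h2⟩ := id hSR
  obtain ⟨x, hxR, hxS⟩ := Finset.exists_of_ssubset hSR'
  have hxT : x ∉ T := fun h => hxS (hTS'.1 h)
  have hsub : insert x T ⊆ R := Finset.insert_subset hxR (hTS'.1.trans hSR'.1)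
  have hcard : (insert x T).card = T.card + 1 := Finset.card_insert_of_notMem hxT
  have hK : insert x T ∈ K.faces := K.down_closed hR hsub (Finset.insert_nonempty _ _)
  have hne : insert x T ≠ S := fun h => hxS (h ▸ Finset.mem_insert_self x T)
  have h3 : g (insert x T) < g R := not_le.1 fun h => hne ((hg R hR).1
    ⟨hK, hR, Finset.ssubset_iff_subset_ne.2 ⟨hsub, fun h => by rw [h] at hcard; omega⟩,
      by omega, h⟩ hSR)
  have h4 : g T < g (insert x T) := not_le.1 fun h => hne ((hg T hT).2
    ⟨hT, hK, Finset.ssubset_insert hxT, hcard.symm, h⟩ hTS)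
  linarith

lemma isEquivalent_of_exceptional (h : ∀ T S, IsExceptional K g T S ↔ IsExceptional K g' T S) :
    IsEquivalent K g g' :=
  ⟨fun S => by simp only [IsCriticalCell, h], h⟩

lemma exists_strictMono_rank {α β : Type*} [LinearOrder β] {s : Set α} (hs : s.Finite)
    (key : α → β) : ∃ r : α → ℝ, ∀ x ∈ s, ∀ y ∈ s, r x < r y ↔ key x < key y := by
  classical
  have hmono : ∀ x y, key x ≤ key y → (hs.toFinset.filter (key · < key x)).card ≤
      (hs.toFinset.filter (key · < key y)).card := fun x y h =>
    Finset.card_le_card fun z hz => by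
      simp only [Finset.mem_filter] at hz ⊢
      exact ⟨hz.1, hz.2.trans_le h⟩
  refine ⟨fun x => ((hs.toFinset.filter (key · < key x)).card : ℝ), fun x hx y _ => ?_⟩
  rw [Nat.cast_lt]
  refine ⟨fun h => not_le.1 fun h' => (hmono y x h').not_gt h, fun h => ?_⟩
  refine Finset.card_lt_card (Finset.ssubset_iff_of_subset (fun z hz => ?_) |>.2 ⟨x, ?_, ?_⟩)
  · simp only [Finset.mem_filter] at hz ⊢
    exact ⟨hz.1, hz.2.trans h⟩
  · simp [hx, h]
  · simp

open scoped Classical in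
theorem exists_generic (hfin : K.faces.Finite) (hg : IsDiscreteMorse K g) :
    ∃ g' : Finset E → ℝ, IsGenericDiscreteMorse K g' ∧ IsEquivalent K g g' := by
  obtain ⟨idx, hidx⟩ := countable_iff_exists_injOn.1 hfin.countable
  -- Lowering cells with an exceptional face puts both members of a matched pair on the same level,
  -- while faces of codimension at least two remain strictly below.
  let lev : Finset E → ℕ := fun S => S.card - if ∃ T, IsExceptional K g T S then 1 else 0
  -- Within a level `g` decides. Reversed cardinality breaks ties in favour of the exceptional
  -- inequality, and the index makes the key injective.
  let key : Finset E → ℕ ×ₗ ℝ ×ₗ ℕᵒᵈ ×ₗ ℕ := fun S =>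
    toLex (lev S, toLex (g S, toLex (OrderDual.toDual S.card, idx S)))
  obtain ⟨g', hg'⟩ := exists_strictMono_rank hfin key
  have hlev : ∀ S, lev S ≤ S.card := fun S => Nat.sub_le _ _
  have hlev' : ∀ S, S.card - 1 ≤ lev S := fun S => by
    simp only [lev]; split_ifs <;> omega
  have hkey : ∀ S T, lev S ≤ lev T → g S < g T → key S < key T := fun S T h h' => by
    rcases h.lt_or_eq with h | h
    · exact Prod.Lex.toLex_lt_toLex.2 (Or.inl h)
    · exact Prod.Lex.toLex_lt_toLex.2 (Or.inr ⟨h, Prod.Lex.toLex_lt_toLex.2 (Or.inl h')⟩)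
  have hexc : ∀ T S, IsExceptional K g T S ↔ IsExceptional K g' T S := by
    intro T S
    simp only [IsExceptional]
    refine and_congr_right fun hT => and_congr_right fun hS => and_congr_right fun hTS =>
      and_congr_right fun hc => ?_
    by_cases h : g S ≤ g T
    · refine iff_of_true h (le_of_lt ?_)
      have hexc : IsExceptional K g T S := ⟨hT, hS, hTS, hc, h⟩
      rw [hg' S hS T hT]
      have h1 : lev S = lev T := by
        have h2 : ∃ T, IsExceptional K g T S := ⟨T, hexc⟩
        have h3 : ¬ ∃ U, IsExceptional K g U T := fun ⟨U, hU⟩ => hg.not_face_and_coface hU hexc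
        simp only [lev, h2, h3, if_true, if_false]
        omega
      rcases h.lt_or_eq with h | h
      · exact hkey S T h1.le h
      · refine Prod.Lex.toLex_lt_toLex.2 (Or.inr ⟨h1, Prod.Lex.toLex_lt_toLex.2 (Or.inr ⟨h,
          Prod.Lex.toLex_lt_toLex.2 (Or.inl ?_)⟩)⟩)
        exact OrderDual.toDual_lt_toDual.2 (by omega)
    · refine iff_of_false h (not_le.2 ?_)
      rw [hg' T hT S hS]
      refine hkey T S ?_ (not_le.1 h)
      have := hlev T
      have := hlev' S
      omega
  refine ⟨g', ⟨fun S hS => ?_, fun S hS T hT h => ?_, fun T hT S hS hTS hc => ?_⟩,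
    isEquivalent_of_exceptional hexc⟩
  · simpa only [← hexc] using hg S hS
  · have h1 : key S = key T := le_antisymm
      (not_lt.1 fun h' => ((hg' T hT S hS).2 h').ne' h)
      (not_lt.1 fun h' => ((hg' S hS T hT).2 h').ne h)
    refine hidx hS hT ?_
    exact congrArg (fun p : ℕ ×ₗ ℝ ×ₗ ℕᵒᵈ ×ₗ ℕ => (ofLex (ofLex (ofLex p).2).2).2) h1
  · rw [hg' T hT S hS]
    refine Prod.Lex.toLex_lt_toLex.2 (Or.inl ?_)
    have := hlev T
    have := hlev' S
    have := Finset.card_lt_card hTS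
    change lev T < lev S
    omega

end Generic

/-! ### From generic discrete Morse functions to PL Morse functions. -/

section PLMorseFunction

variable {E : Type*} [NormedAddCommGroup E] [NormedSpace ℝ E] [FiniteDimensional ℝ E]
  {K : Geometry.SimplicialComplex ℝ E} {g : Finset E → ℝ}

omit [FiniteDimensional ℝ E] in
lemma IsGenericDiscreteMorse.lt_of_not_exceptional (hg : IsGenericDiscreteMorse K g)
    {T S : Finset E} (hT : T ∈ K.faces) (hS : S ∈ K.faces) (hTS : T ⊂ S)
    (h : ¬ IsExceptional K g T S) : g T < g S := by
  by_cases hc : T.card + 1 = S.card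
  · exact not_le.1 fun h' => h ⟨hT, hS, hTS, hc, h'⟩
  · exact hg.2.2 T hT S hS hTS hc

omit [FiniteDimensional ℝ E] in
lemma IsGenericDiscreteMorse.lt_of_exceptional (hg : IsGenericDiscreteMorse K g)
    {T S : Finset E} (h : IsExceptional K g T S) : g S < g T :=
  lt_of_le_of_ne h.2.2.2.2 fun h' => h.2.2.1.ne (hg.2.1 h.2.1 h.1 h').symm

variable [Fintype K.faces] {v : Finset E → E} {ψ : E × ℝ → K.faces → ℝ} {d : ℕ}

lemma isNondegenerateCritical_vertex (hK : IsCombinatorialManifold K d)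
    (hg : IsGenericDiscreteMorse K g) (hv : ∀ S ∈ K.faces, InOpenSimplex S (v S))
    (hψ : ConeEquiv (faceChains K) (coneOver K.space) (realize K v) ψ) {S : Finset E}
    (hS : IsCriticalCell K g S) {k : ℕ} (hk : S.card = k + 1) :
    IsNondegenerateCritical K.space d k (fun z => ∑ T, ψ (z, 1) T * g T.1) (v S) := by
  obtain ⟨n, hn, hl⟩ := hK S hS.1
  obtain rfl : d = k + n := by omega
  exact isNondegenerateCritical_of_values (S := ⟨S, hS.1⟩) (a := fun T => g T.1) hv hψ hk hl
    (fun T => hg.lt_of_not_exceptional T.1.2 hS.1 T.2 (hS.2.1 _))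
    (fun T => hg.lt_of_not_exceptional hS.1 T.1.2 T.2 (hS.2.2 _))

/-- A noncritical cell has an exceptional face or coface, never both, and it is unique; genericity
makes all other comparisons strict in the expected direction. -/
lemma isStronglyRegular_vertex (hK : IsCombinatorialManifold K d)
    (hg : IsGenericDiscreteMorse K g) (hv : ∀ S ∈ K.faces, InOpenSimplex S (v S))
    (hψ : ConeEquiv (faceChains K) (coneOver K.space) (realize K v) ψ) {S : Finset E}
    (hS : S ∈ K.faces) (hSc : ¬ IsCriticalCell K g S) :
    IsStronglyRegular K.space d (fun z => ∑ T, ψ (z, 1) T * g T.1) (v S) := by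
  obtain ⟨n, hn, hl⟩ := hK S hS
  obtain ⟨k, hk⟩ : ∃ k, S.card = k + 1 :=
    Nat.exists_eq_succ_of_ne_zero (K.nonempty_of_mem_faces hS).card_pos.ne'
  obtain rfl : d = k + n := by omega
  by_cases hface : ∃ R, IsExceptional K g R S
  · obtain ⟨R, hR⟩ := hface
    exact isStronglyRegular_of_exceptional_face (S := ⟨S, hS⟩) (a := fun T => g T.1) hv hψ hk hl
      (R := ⟨⟨R, hR.1⟩, hR.2.2.1⟩) (hg.lt_of_exceptional hR)
      (fun T hT => hg.lt_of_not_exceptional T.1.2 hS T.2 fun h =>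
        hT (Subtype.ext (Subtype.ext ((hg.1 S hS).1 h hR))))
      (fun T => hg.lt_of_not_exceptional hS T.1.2 T.2 (hg.1.not_face_and_coface hR))
  · obtain ⟨R, hR⟩ : ∃ R, IsExceptional K g S R := by
      by_contra! h
      exact hSc ⟨hS, fun T hT => hface ⟨T, hT⟩, h⟩
    exact isStronglyRegular_of_exceptional_coface (S := ⟨S, hS⟩) (a := fun T => g T.1) hv hψ hk hl
      (R := ⟨⟨R, hR.2.1⟩, hR.2.2.1⟩)
      (fun T => hg.lt_of_not_exceptional T.1.2 hS T.2 fun h => hface ⟨_, h⟩)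
      (hg.lt_of_exceptional hR)
      (fun T hT => hg.lt_of_not_exceptional hS T.1.2 T.2 fun h =>
        hT (Subtype.ext (Subtype.ext ((hg.1 S hS).2 h hR))))

omit [FiniteDimensional ℝ E] in
lemma value_vertex (hψ : ConeEquiv (faceChains K) (coneOver K.space) (realize K v) ψ)
    {S : Finset E} (hS : S ∈ K.faces) : ∑ T, ψ (v S, 1) T * g T.1 = g S := by
  classical
  have h : ψ (v S, 1) = Pi.single ⟨S, hS⟩ 1 := by
    have h1 := hψ.left_inv (single_mem_faceChains ⟨S, hS⟩)
    rwa [realize_single] at h1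
  simp [h, Pi.single_apply]

lemma isGenericPL_derived (hg : InjOn g K.faces) (hv : ∀ S ∈ K.faces, InOpenSimplex S (v S))
    (hψ : ConeEquiv (faceChains K) (coneOver K.space) (realize K v) ψ) :
    IsGenericPL (derived hv) fun z => ∑ T, ψ (z, 1) T * g T.1 := by
  classical
  constructor
  · rintro _ ⟨C, -, hC, hch, rfl⟩
    obtain ⟨L, hL⟩ := exists_functional_of_chain hv hch
    refine ⟨affSlice ((∑ T, g T.1 • LinearMap.proj T : (K.faces → ℝ) →ₗ[ℝ] ℝ) ∘ₗ L),
      fun z hz => ?_⟩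
    have hz' : z ∈ convexHull ℝ ((C.image v : Finset E) : Set E) := by convert hz
    obtain ⟨c, h0, hcC, hc⟩ := (mem_convexHull_image_iff hv hC).1 hz'
    rw [affSlice_apply, ← hc]
    simp only [← hc, hψ.left_inv (mem_faceChains_of_chain hch h0 hcC), LinearMap.comp_apply,
      hL c hcC]
    simp [mul_comm]
  · intro x hx y hy h
    obtain ⟨S, hS, rfl⟩ := (bijOn_derived_vertices hv).surjOn hx
    obtain ⟨T, hT, rfl⟩ := (bijOn_derived_vertices hv).surjOn hy
    simp only [value_vertex hψ hS, value_vertex hψ hT] at h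
    rw [hg hS hT h]

end PLMorseFunction
end PLMorse

theorem mainTheorem5 {E : Type*} [NormedAddCommGroup E] [NormedSpace ℝ E] [FiniteDimensional ℝ E]
    (K : Geometry.SimplicialComplex ℝ E) (hfin : K.faces.Finite)
    (d : ℕ) (hK : PLMorse.IsCombinatorialManifold K d)
    (g : Finset E → ℝ) (hg : PLMorse.IsDiscreteMorse K g) :
    (∃ g' : Finset E → ℝ, PLMorse.IsGenericDiscreteMorse K g' ∧ PLMorse.IsEquivalent K g g') ∧
    ∀ g' : Finset E → ℝ, PLMorse.IsGenericDiscreteMorse K g' → PLMorse.IsEquivalent K g g' →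
      ∀ v : Finset E → E, (∀ S ∈ K.faces, PLMorse.InOpenSimplex S (v S)) →
        ∃ (L : Geometry.SimplicialComplex ℝ E) (f : E → ℝ),
          PLMorse.IsDerivedSubdivision K v L ∧
          Set.BijOn v K.faces L.vertices ∧
          (∀ S ∈ K.faces, f (v S) = g' S) ∧
          PLMorse.IsPLMorse L d f ∧
          (∀ S ∈ K.faces, ¬ PLMorse.IsCriticalCell K g S →
            PLMorse.IsStronglyRegular L.space d f (v S)) ∧
          (∀ (S : Finset E) (k : ℕ), PLMorse.IsCriticalCell K g S → S.card = k + 1 →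
            PLMorse.IsNondegenerateCritical L.space d k f (v S)) := by
  refine ⟨PLMorse.exists_generic hfin hg, fun g' hg' heq v hv => ?_⟩
  let _ : Fintype K.faces := hfin.fintype
  -- The map `ψ` reads off chain weights, so `∑ T, ψ (z, 1) T * g' T` is the affine extension of the
  -- values of `g'`.
  obtain ⟨ψ, hψ⟩ := PLMorse.exists_coneEquiv_realize hv
  have hspace : (PLMorse.derived hv).space = K.space :=
    (PLMorse.isDerivedSubdivision_derived hv).isSubdivision.1
  have hreg : ∀ S ∈ K.faces, ¬ PLMorse.IsCriticalCell K g S → PLMorse.IsStronglyRegular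
      (PLMorse.derived hv).space d (fun z => ∑ T, ψ (z, 1) T * g' T.1) (v S) := by
    intro S hS hSc
    rw [hspace]
    rw [heq.1] at hSc
    exact PLMorse.isStronglyRegular_vertex hK hg' hv hψ hS hSc
  have hcrit : ∀ (S : Finset E) (k : ℕ), PLMorse.IsCriticalCell K g S → S.card = k + 1 →
      PLMorse.IsNondegenerateCritical (PLMorse.derived hv).space d k
        (fun z => ∑ T, ψ (z, 1) T * g' T.1) (v S) := by
    intro S k hS hk
    rw [hspace]
    rw [heq.1] at hS
    exact PLMorse.isNondegenerateCritical_vertex hK hg' hv hψ hS hk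
  refine ⟨PLMorse.derived hv, fun z => ∑ T, ψ (z, 1) T * g' T.1,
    PLMorse.isDerivedSubdivision_derived hv, PLMorse.bijOn_derived_vertices hv,
    fun S hS => PLMorse.value_vertex hψ hS,
    ⟨PLMorse.isGenericPL_derived hg'.2.1 hv hψ, fun p hp => ?_⟩, hreg, hcrit⟩
  obtain ⟨S, hS, rfl⟩ := (PLMorse.bijOn_derived_vertices hv).surjOn hp
  by_cases hSc : PLMorse.IsCriticalCell K g S
  · obtain ⟨k, hk⟩ : ∃ k, S.card = k + 1 :=
      Nat.exists_eq_succ_of_ne_zero (K.nonempty_of_mem_faces hS).card_pos.ne'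
    exact Or.inr ⟨k, hcrit S k hSc hk⟩
  · exact Or.inl (hreg S hS hSc)
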